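/- Conventions. Consider the Navier–Stokes equations with unit viscosity on $\mathbb R^3\times(0,\infty)$. A mild solution with initial data $u_0$ (a distribution) is a measurable field $u$, with $u(t)$ locally integrable and divergence free for each $t>0$, such that for all $t,\tau>0$ and a.e. $x$ $$u(t+\tau)=e^{\tau\Delta}u(t)-\int_0^\tau e^{(\tau-s)\Delta}\mathbb P\nabla\cdot(u\otimes u)(t+s)\,ds$$ (with absolutely convergent kernel integrals, $\mathbb P$ the Leray projection), and $u(t)\to u_0$ in the sense of distributions as $t\to0^+$. Fix a radial $\chi\in C_c^\infty(B_1)$, $\chi\ge 0$, $\chi=1$ on $B_{1/2}$; put $\phi(\xi)=\chi(\xi/2)-\chi(\xi)$, $\dot\Delta_jf=\mathcal F^{-1}[\phi(2^{-j}\cdot)]*f$, $f_{<J}=\mathcal F^{-1}[\chi(2^{-J}\cdot)]*f$ (formally $\sum_{j<J}\dot\Delta_jf$), $f_{\ge J}=f-f_{<J}$, $f_{J\le j\le J'}=\sum_{j=J}^{J'}\dot\Delta_jf$ and $\|f\|_{\dot B^s_{q,\infty}}=\sup_{j\in\mathbb Z}2^{js}\|\dot\Delta_jf\|_{L^q}$.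 Exponents at $p=\infty$ are read as limits. For $w=u-v$ and constants $c_1,c_2>0$ consider (A1) $\ \displaystyle\sup_{t>0}\sup_{3<q\le\infty}\Big(t^{1/2-3/(2q)}\big(\|u\|_{L^q}+\|v\|_{L^q}\big)(t)+\|u\|_{\dot B^{-1+3/q}_{q,\infty}}(t)+\|v\|_{\dot B^{-1+3/q}_{q,\infty}}(t)\Big)\le c_1$; (A2) $\ \|w(t)\|_{L^p}\,t^{1/2-3/(2p)}\ge c_2$ for all $t>0$. Theorem. Let $u$ and $v$ be mild solutions with the same initial data, $w=u-v$, and let $p\in(3,\infty]$. (1) (Uniqueness criterion) Let $c_1>0$. There are $\epsilon_2=\epsilon_2(c_1,p)>0$ and $J_1:(0,\infty)\to\mathbb Z$, depending only on $c_1,p$, with $2^{J_1(t)}\sim_{c_1,p}t^{-1/2}$, such that if (A1) holds and, for some $T>0$, $\|w_{\ge J_1(t)}(t)\|_{L^p}\le\epsilon_2\|w_{<J_1(t)}(t)\|_{L^p}$ for all $0<t<T$, then $w=0$ at all times $t>0$. For (2) and (3), let $\tilde c_p>0$ and $C_B>0$ be arbitrary fixed constants, let $M_0(t)=2\max\{\|u(t)\|_{L^p},\|v(t)\|_{L^p}\}$,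 and set $$\Theta(t)=\big(4\tilde c_pM_0(t)^{2p/(3-p)}+t\big)^{1/2-3/(2p)},\qquad \gamma(t)=\frac{c_2}{4M_0(t)\Theta(t)}.$$ (2) (Low frequencies are active) Assume $u,v\in L^\infty_{loc}((0,\infty);L^p)$ and (A2) for some $c_2>0$. Then $M_0(t)>0$ for all $t>0$ and there is $J_2(t)\in\mathbb Z$, depending only on $p,C_B,\tilde c_p,c_2,M_0(t),t$, with $$2^{J_2(t)}\sim_{p,C_B,\tilde c_p}\frac{4M_0(t)\Theta(t)}{c_2}\Big(\frac{c_2}{4M_0(t)^2C_B\Theta(t)}\Big)^{\frac p{3-p}},$$ such that for every $t>0$, $w_{<J_2(t)}(t)\ne0$ and $$\frac{\|w_{\ge J_2(t)}(t)\|_{L^p}}{\|w_{<J_2(t)}(t)\|_{L^p}}\le\gamma(t)^{-1}.$$ (3) (Intermediate frequencies are active) If (A1) and (A2) hold for some $c_1,c_2>0$, then, with the same $J_2$, there is $J_3:(0,\infty)\to\mathbb Z$ such that for all $t>0$: $J_3(t)<J_2(t)$, $2^{J_2(t)}\sim t^{-1/2}$, $2^{J_3(t)}\sim t^{-1/2}$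 and $$\|w_{J_3(t)\le j\le J_2(t)}(t)\|_{L^p}\sim\|w(t)\|_{L^p}\sim t^{-1/2+3/(2p)},$$ with constants depending only on $c_1,c_2,p,C_B,\tilde c_p$. All implied constants may also depend on the fixed cut-off $\chi$. -/

import Mathlib

open Real Set Filter Topology MeasureTheory
open scoped ENNReal NNReal FourierTransform Distributions

noncomputable section

namespace NSFreq

/-- Physical (and frequency) space `ℝ³` with its Euclidean norm. -/
abbrev E3 : Type := EuclideanSpace ℝ (Fin 3)

/-! ### The heat kernel and the Oseen kernel -/

/-- The heat kernel `(4πt)^{-3/2} exp(-|x|²/(4t))`. -/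
def heatKernel (t : ℝ) (x : E3) : ℝ :=
  (4 * π * t) ^ (-(3 / 2) : ℝ) * Real.exp (-‖x‖ ^ 2 / (4 * t))

/-- The partial derivative `∂ᵢ f`. -/
def pd (i : Fin 3) (f : E3 → ℝ) (x : E3) : ℝ :=
  fderiv ℝ f x (EuclideanSpace.single i 1)

/-- The heat semigroup `e^{tΔ} f`. -/
def heatFlow (t : ℝ) (f : E3 → E3) (x : E3) : E3 :=
  ∫ y, heatKernel t (x - y) • f y

/-- The kernel of `e^{tΔ} ℙᵢⱼ ∂ₖ`, that is, the derivative `∂ₖ` of the Oseen kernel.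
Since `ℙᵢⱼ = δᵢⱼ - ∂ᵢ ∂ⱼ Δ⁻¹` and `-Δ⁻¹ e^{tΔ} = ∫_t^∞ e^{sΔ} ds`, the Oseen kernel is
`δᵢⱼ Γ(t) + ∫_t^∞ ∂ᵢ ∂ⱼ Γ(s) ds`, where `Γ` is the heat kernel. -/
def gradOseen (i j k : Fin 3) (t : ℝ) (x : E3) : ℝ :=
  (if i = j then pd k (heatKernel t) x else 0)
    + ∫ s in Ioi t, pd i (pd j (pd k (heatKernel s))) x

/-- `∫₀^τ e^{(τ-s)Δ} ℙ ∇·(u ⊗ u)(t+s) ds`, evaluated at `x`. -/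
def duhamel (u : ℝ → E3 → E3) (t τ : ℝ) (x : E3) : E3 :=
  WithLp.toLp 2 fun i => ∫ s in (0 : ℝ)..τ, ∫ y,
    ∑ j, ∑ k, gradOseen i j k (τ - s) (x - y) * (u (t + s) y j * u (t + s) y k)

/-! ### Mild solutions -/

/-- `u` is a (global) mild solution of the Navier-Stokes equations on `ℝ³ × (0, ∞)` (with unit
viscosity) with initial data the distribution `u₀`; only the values `u t` with `t > 0` matter. -/
structure IsMildSolution (u : ℝ → E3 → E3) (u₀ : 𝓓'((⊤ : TopologicalSpace.Opens E3), E3)) :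
    Prop where
  measurable : Measurable (Function.uncurry u)
  locallyIntegrable : ∀ t > 0, LocallyIntegrable (u t) volume
  /-- `u(t)` is divergence free in the sense of distributions -/
  divFree : ∀ t > 0, ∀ φ : 𝓓((⊤ : TopologicalSpace.Opens E3), ℝ),
    ∫ x, fderiv ℝ φ x (u t x) = 0
  /-- the integral defining the caloric part converges absolutely -/
  integrable_heat : ∀ t > 0, ∀ τ > 0, ∀ᵐ x,
    Integrable (fun y => heatKernel τ (x - y) • u t y) volume
  /-- the integral defining the nonlinear part converges absolutely -/
  integrable_duhamel : ∀ t > 0, ∀ τ > 0, ∀ i j k : Fin 3, ∀ᵐ x,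
    Integrable (fun z : ℝ × E3 => gradOseen i j k (τ - z.1) (x - z.2) *
        (u (t + z.1) z.2 j * u (t + z.1) z.2 k))
      ((volume.restrict (Ioo (0 : ℝ) τ)).prod volume)
  /-- Duhamel's formula -/
  mild : ∀ t > 0, ∀ τ > 0, ∀ᵐ x, u (t + τ) x = heatFlow τ (u t) x - duhamel u t τ x
  /-- `u(t) → u₀` in the sense of distributions as `t → 0⁺` -/
  initial : ∀ φ : 𝓓((⊤ : TopologicalSpace.Opens E3), ℝ),
    Tendsto (fun t => ∫ x, φ x • u t x) (𝓝[>] 0) (𝓝 (u₀ φ))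

/-- `u ∈ L^∞_loc((0, ∞); L^p(ℝ³))`. -/
def LocBddLp (p : ℝ≥0∞) (u : ℝ → E3 → E3) : Prop :=
  ∀ a b : ℝ, 0 < a → a ≤ b → ∃ M : ℝ≥0, ∀ t ∈ Icc a b, eLpNorm (u t) p volume ≤ M

/-! ### Littlewood-Paley decomposition -/

/-- The radial cut-off functions `χ ∈ C_c^∞(B₁)` with `χ = 1` on `B_{1/2}` on which a
Littlewood-Paley decomposition is built. -/
structure IsLPCutoff (χ : E3 → ℝ) : Prop where
  smooth : ContDiff ℝ ((⊤ : ℕ∞) : WithTop ℕ∞) χ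
  nonneg : ∀ ξ, 0 ≤ χ ξ
  radial : ∀ ξ η : E3, ‖ξ‖ = ‖η‖ → χ ξ = χ η
  support : tsupport χ ⊆ Metric.ball 0 1
  eq_one : ∀ ξ ∈ Metric.ball (0 : E3) (1 / 2), χ ξ = 1

/-- The convolution `(𝓕⁻¹ m) * f`, for a real and even symbol `m` (so that `𝓕⁻¹ m` is real and
taking the real part changes nothing). -/
def fourierMult (m : E3 → ℝ) (f : E3 → E3) (x : E3) : E3 :=
  ∫ y, (𝓕⁻ (fun ξ : E3 => ((m ξ : ℝ) : ℂ)) (x - y)).re • f y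

/-- The symbol `φ(ξ) = χ(ξ/2) - χ(ξ)`. -/
def lpPhi (χ : E3 → ℝ) (ξ : E3) : ℝ := χ ((2 : ℝ)⁻¹ • ξ) - χ ξ

/-- The homogeneous dyadic block, with symbol `φ(2^{-j} ξ)`. -/
def dyadicBlock (χ : E3 → ℝ) (j : ℤ) (f : E3 → E3) : E3 → E3 :=
  fourierMult (fun ξ => lpPhi χ ((2 : ℝ) ^ (-j) • ξ)) f

/-- `f_{<J}`: the sum of the blocks with index `j < J`, whose symbols `φ(2^{-j} ξ)` telescope to
`χ(2^{-J} ξ)`. -/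
def lowFreq (χ : E3 → ℝ) (J : ℤ) (f : E3 → E3) : E3 → E3 :=
  fourierMult (fun ξ => χ ((2 : ℝ) ^ (-J) • ξ)) f

/-- `f_{≥J} = f - f_{<J}`. -/
def highFreq (χ : E3 → ℝ) (J : ℤ) (f : E3 → E3) : E3 → E3 := f - lowFreq χ J f

/-- `f_{J ≤ j ≤ J'}`: the sum of the blocks with index `J ≤ j ≤ J'`. -/
def bandFreq (χ : E3 → ℝ) (J J' : ℤ) (f : E3 → E3) : E3 → E3 :=
  ∑ j ∈ Finset.Icc J J', dyadicBlock χ j f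

/-- The homogeneous Besov norm of `Ḃ^s_{q,∞}`. -/
def besovNorm (χ : E3 → ℝ) (s : ℝ) (q : ℝ≥0∞) (f : E3 → E3) : ℝ≥0∞ :=
  ⨆ j : ℤ, ENNReal.ofReal ((2 : ℝ) ^ ((j : ℝ) * s)) * eLpNorm (dyadicBlock χ j f) q volume

/-! ### Exponents and assumptions -/

/-- The exponent `1/2 - 3/(2q)` (equal to `1/2` for `q = ∞`). -/
def critExp (q : ℝ≥0∞) : ℝ := 1 / 2 - 3 / 2 * (q⁻¹).toReal

/-- The exponent `p/(3-p) = 1/(3/p - 1)` (equal to `-1` for `p = ∞`). -/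
def thetaExp (p : ℝ≥0∞) : ℝ := 1 / (3 * (p⁻¹).toReal - 1)

/-- The scaling invariant upper bounds on the two flows `u` and `v`, with constant `c₁`. -/
def TypeIBound (χ : E3 → ℝ) (c₁ : ℝ) (u v : ℝ → E3 → E3) : Prop :=
  ∀ t > 0, ∀ q : ℝ≥0∞, 3 < q →
    ENNReal.ofReal (t ^ critExp q) * (eLpNorm (u t) q volume + eLpNorm (v t) q volume)
      + besovNorm χ (-1 + 3 * (q⁻¹).toReal) q (u t)
      + besovNorm χ (-1 + 3 * (q⁻¹).toReal) q (v t) ≤ ENNReal.ofReal c₁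

/-- The scaling invariant lower bound in `L^p` on the error `w`, with constant `c₂`. -/
def ErrorLowerBound (p : ℝ≥0∞) (c₂ : ℝ) (w : ℝ → E3 → E3) : Prop :=
  ∀ t > 0, ENNReal.ofReal c₂ ≤ eLpNorm (w t) p volume * ENNReal.ofReal (t ^ critExp p)

/-- `M₀(t) = 2 max(‖u(t)‖_p, ‖v(t)‖_p)`. -/
def M0 (p : ℝ≥0∞) (u v : ℝ → E3 → E3) (t : ℝ) : ℝ :=
  2 * max (eLpNorm (u t) p volume).toReal (eLpNorm (v t) p volume).toReal

/-- `(4 c̃ M^{2p/(3-p)} + t)^{1/2 - 3/(2p)}`. -/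
def timeFactor (p : ℝ≥0∞) (ct M t : ℝ) : ℝ :=
  (4 * ct * M ^ (2 * thetaExp p) + t) ^ critExp p

/-- `γ = c₂ / (4 M (4 c̃ M^{2p/(3-p)} + t)^{1/2 - 3/(2p)})`. -/
def gammaFactor (p : ℝ≥0∞) (ct c₂ M t : ℝ) : ℝ :=
  c₂ / (4 * M * timeFactor p ct M t)

/-- The frequency scale to which `2^{J₂}` is comparable. -/
def freqScale (p : ℝ≥0∞) (CB ct c₂ M t : ℝ) : ℝ :=
  4 * M * timeFactor p ct M t / c₂ *
    (c₂ / (4 * M ^ 2 * CB * timeFactor p ct M t)) ^ thetaExp p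

/-- `A` and `B` are comparable with constant `K`: `K⁻¹ B ≤ A ≤ K B`. -/
def Comparable (K A B : ℝ) : Prop := K⁻¹ * B ≤ A ∧ A ≤ K * B

/-- The same for extended nonnegative quantities. -/
def EComparable (K : ℝ) (A B : ℝ≥0∞) : Prop :=
  ENNReal.ofReal K⁻¹ * B ≤ A ∧ A ≤ ENNReal.ofReal K * B

end NSFreq

end

noncomputable section

namespace NSFreq

/-! ### Integral inequalities for nonnegative functions -/

section Lebesgue

variable {α β : Type*} [MeasurableSpace α] [MeasurableSpace β]

/-! Write a = `critExp p` and w = u - v. For positive t and τ, w(t+τ) is e^{τΔ}w(t) minus a term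
bilinear in w and (u, v). The gradient of the Oseen kernel is O(t^{-1/2}) in L¹ and O(t^{-2}) in
L^∞, so Minkowski's inequality in time and Young's in space (`eLpNorm_oseenMajorant_le`) give every
nonlinear estimate; in L^p over a time τ the bilinear term costs τ^a, and a > 0 because p > 3.

Low frequencies (`exists_lowFreq_lower_bound`). Choose τ so short that the L^p norms of u and v at
most double on [t, t+τ], that (t+τ)^a ≤ Θ, and that the bilinear term is at most c₂/(3Θ). The lower
bound at time t+τ says ‖w(t+τ)‖ ≥ c₂/Θ. The heat flow damps w_{≥J} by the factor 2^{-J}τ^{-1/2}, so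
for 2^J above the stated frequency the high part is also at most c₂/(3Θ) at time t+τ. The remaining
third must come from w_{<J}(t).

Intermediate frequencies (`low_and_intermediate_frequencies`). The scale invariant bounds force
M₀(t) ~ t^{-a}, whence 2^{J₂} ~ t^{-1/2}. Bernstein's inequality from L^q with 3 < q < p shows that
the frequencies below δt^{-1/2} carry only a small multiple of t^{-a} when δ is small
(`exists_lowFreq_small`), so what is found below J₂ lies between the two scales.

Uniqueness (`uniqueness_of_highFreq_le`). Since u and v have the same data, w_{<J}(s) tends to 0
uniformly in x as s → 0 (`exists_enorm_lowFreq_le`). Hence w_{<J}(t) is given by the Duhamel term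
started at time 0 alone, and Bernstein's inequality bounds it by 2^{J/2}t^{1/4-a} times L = sup
s^a‖w(s)‖ (`exists_eLpNorm_lowFreq_le`). At 2^J ~ δt^{-1/2} this is a small multiple of t^{-a}L. If
the high part is dominated by the low part, then L ≤ L/2, so w vanishes near time 0, and forward
uniqueness in L^p propagates this to all times. -/

/-- Hölder's inequality for the factorisation K f = K^{1-1/q} (K f^q)^{1/q}. It drives both
Minkowski's and Young's inequality below. -/
theorem lintegral_mul_le_weighted {μ : Measure α} {K f : α → ℝ≥0∞} (hK : Measurable K)
    (hf : Measurable f) {q : ℝ} (hq : 1 ≤ q) :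
    ∫⁻ x, K x * f x ∂μ ≤
      (∫⁻ x, K x ∂μ) ^ (1 - 1 / q) * (∫⁻ x, K x * f x ^ q ∂μ) ^ (1 / q) := by
  have hq0 : 0 < q := by linarith
  have h1 : 0 ≤ 1 - 1 / q := by
    rw [sub_nonneg, div_le_one hq0]; exact hq
  have h2 : 0 ≤ 1 / q := by positivity
  refine le_trans (le_of_eq ?_) (ENNReal.lintegral_mul_norm_pow_le (μ := μ) (f := K)
    (g := fun x => K x * f x ^ q) hK.aemeasurable (by fun_prop) h1 h2 (by ring))
  refine lintegral_congr fun x => ?_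
  rw [ENNReal.mul_rpow_of_nonneg _ _ h2, ← mul_assoc, ← ENNReal.rpow_add_of_nonneg _ _ h1 h2,
    ← ENNReal.rpow_mul]
  have : q * (1 / q) = 1 := by field_simp
  rw [this]
  simp

theorem eLpNorm_le_of_lintegral_rpow_le {μ : Measure α} {f : α → ℝ≥0∞} {p : ℝ≥0∞} (hp : 1 ≤ p)
    (hp' : p ≠ ∞) {c : ℝ≥0∞} (h : ∫⁻ x, f x ^ p.toReal ∂μ ≤ c ^ p.toReal) :
    eLpNorm f p μ ≤ c := by
  have h0 : p ≠ 0 := (zero_lt_one.trans_le hp).ne'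
  have h1 : 0 < p.toReal := ENNReal.toReal_pos h0 hp'
  rw [eLpNorm_eq_lintegral_rpow_enorm_toReal h0 hp']
  calc _ ≤ (c ^ p.toReal) ^ (1 / p.toReal) := by
        gcongr
        simpa using h
    _ = c := by rw [← ENNReal.rpow_mul]; field_simp; simp

theorem lintegral_rpow_eq_eLpNorm_rpow {μ : Measure α} (f : α → ℝ≥0∞) {p : ℝ≥0∞} (hp : 1 ≤ p)
    (hp' : p ≠ ∞) : ∫⁻ x, f x ^ p.toReal ∂μ = eLpNorm f p μ ^ p.toReal := by
  have h0 : p ≠ 0 := (zero_lt_one.trans_le hp).ne'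
  have h1 : 0 < p.toReal := ENNReal.toReal_pos h0 hp'
  rw [eLpNorm_eq_lintegral_rpow_enorm_toReal h0 hp', ← ENNReal.rpow_mul]
  field_simp
  simp

theorem eLpNorm_top_le_of_ae_le {μ : Measure α} {f : α → ℝ≥0∞} {c : ℝ≥0∞}
    (h : ∀ᵐ x ∂μ, f x ≤ c) : eLpNorm f ∞ μ ≤ c := by
  rw [eLpNorm_exponent_top]
  exact essSup_le_of_ae_le _ (h.mono fun x hx => by simpa using hx)

theorem ae_le_eLpNorm_top {μ : Measure α} (f : α → ℝ≥0∞) :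
    ∀ᵐ x ∂μ, f x ≤ eLpNorm f ∞ μ := by
  rw [eLpNorm_exponent_top]
  simpa using enorm_ae_le_eLpNormEssSup f μ

/-- The weighted Hölder inequality with weight φ, applied to d = φ · (d/φ), followed by Tonelli:
each slice d/φ has norm at most one. The division is why φ must be nonzero and finite almost
everywhere. -/
theorem eLpNorm_lintegral_le_of_ne_zero {μ : Measure α} {ν : Measure β} [SFinite μ] [SFinite ν]
    {d : α → β → ℝ≥0∞} (hd : Measurable (Function.uncurry d)) {φ : α → ℝ≥0∞} (hφ : Measurable φ)
    {p : ℝ≥0∞} (hp : 1 ≤ p) (h0 : ∀ᵐ s ∂μ, φ s ≠ 0) (htop : ∀ᵐ s ∂μ, φ s ≠ ∞)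
    (h : ∀ᵐ s ∂μ, eLpNorm (d s) p ν ≤ φ s) :
    eLpNorm (fun x => ∫⁻ s, d s x ∂μ) p ν ≤ ∫⁻ s, φ s ∂μ := by
  rcases eq_or_ne p ∞ with rfl | hp'
  · apply eLpNorm_top_le_of_ae_le
    have h1 : ∀ᵐ s ∂μ, ∀ᵐ x ∂ν, d s x ≤ φ s := by
      filter_upwards [h] with s hs
      filter_upwards [ae_le_eLpNorm_top (μ := ν) (d s)] with x hx using hx.trans hs
    have h2 : MeasurableSet {z : α × β | Function.uncurry d z ≤ φ z.1} :=
      measurableSet_le hd (by fun_prop)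
    have h3 : ∀ᵐ x ∂ν, ∀ᵐ s ∂μ, d s x ≤ φ s := (Measure.ae_ae_comm h2).1 h1
    filter_upwards [h3] with x hx using lintegral_mono_ae hx
  · set q := p.toReal with hq
    have hq1 : 1 ≤ q := by
      rw [hq, ← ENNReal.toReal_one]
      exact ENNReal.toReal_mono hp' hp
    have hq0 : 0 < q := by linarith
    apply eLpNorm_le_of_lintegral_rpow_le hp hp'
    rw [← hq]
    have key : ∀ x, (∫⁻ s, d s x ∂μ) ^ q ≤
        (∫⁻ s, φ s ∂μ) ^ (q - 1) * ∫⁻ s, φ s * (d s x / φ s) ^ q ∂μ := by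
      intro x
      have e1 : ∫⁻ s, d s x ∂μ = ∫⁻ s, φ s * (d s x / φ s) ∂μ := by
        apply lintegral_congr_ae
        filter_upwards [h0, htop] with s a b
        rw [ENNReal.mul_div_cancel a b]
      have e2 := lintegral_mul_le_weighted (μ := μ) (K := φ) (f := fun s => d s x / φ s) hφ
        ((hd.comp (measurable_id.prodMk measurable_const)).div hφ) hq1
      rw [e1]
      calc _ ≤ _ := ENNReal.rpow_le_rpow e2 hq0.le
        _ = _ := by
          rw [ENNReal.mul_rpow_of_nonneg _ _ hq0.le, ← ENNReal.rpow_mul, ← ENNReal.rpow_mul]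
          congr 2
          · field_simp
          · field_simp; simp
    calc ∫⁻ x, (∫⁻ s, d s x ∂μ) ^ q ∂ν
        ≤ ∫⁻ x, (∫⁻ s, φ s ∂μ) ^ (q - 1) * ∫⁻ s, φ s * (d s x / φ s) ^ q ∂μ ∂ν :=
          lintegral_mono key
      _ = (∫⁻ s, φ s ∂μ) ^ (q - 1) * ∫⁻ x, ∫⁻ s, φ s * (d s x / φ s) ^ q ∂μ ∂ν := by
          rw [lintegral_const_mul]
          apply Measurable.lintegral_prod_right' (f := fun z : β × α => φ z.2 * (d z.2 z.1 / φ z.2) ^ q)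
          have := hd.comp (measurable_snd.prodMk measurable_fst : Measurable fun z : β × α => (z.2, z.1))
          have h' : Measurable fun z : β × α => d z.2 z.1 := this
          fun_prop
      _ = (∫⁻ s, φ s ∂μ) ^ (q - 1) * ∫⁻ s, ∫⁻ x, φ s * (d s x / φ s) ^ q ∂ν ∂μ := by
          rw [lintegral_lintegral_swap]
          have := hd.comp (measurable_snd.prodMk measurable_fst : Measurable fun z : β × α => (z.2, z.1))
          have h' : Measurable fun z : β × α => d z.2 z.1 := this
          apply Measurable.aemeasurable
          simp only [Function.uncurry_def]
          fun_prop
      _ ≤ (∫⁻ s, φ s ∂μ) ^ (q - 1) * ∫⁻ s, φ s ∂μ := by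
          gcongr 1
          apply lintegral_mono_ae
          filter_upwards [h0, htop, h] with s a b c
          have hm : Measurable (d s) := hd.comp measurable_prodMk_left
          rw [lintegral_const_mul _ (by fun_prop)]
          have : ∀ x, (d s x / φ s) ^ q = (φ s)⁻¹ ^ q * d s x ^ q := by
            intro x
            rw [div_eq_mul_inv, ENNReal.mul_rpow_of_nonneg _ _ hq0.le, mul_comm]
          simp_rw [this]
          rw [lintegral_const_mul _ (by fun_prop), hq, lintegral_rpow_eq_eLpNorm_rpow _ hp hp', ← hq,
            ← ENNReal.mul_rpow_of_nonneg _ _ hq0.le]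
          calc φ s * ((φ s)⁻¹ * eLpNorm (d s) p ν) ^ q ≤ φ s * ((φ s)⁻¹ * φ s) ^ q := by gcongr
            _ = φ s := by rw [ENNReal.inv_mul_cancel a b]; simp
      _ = (∫⁻ s, φ s ∂μ) ^ q := by
          nth_rw 2 [← ENNReal.rpow_one (∫⁻ s, φ s ∂μ)]
          rw [← ENNReal.rpow_add_of_nonneg _ _ (by linarith) zero_le_one]
          ring_nf

/-- Minkowski's integral inequality, with an explicit majorant of the inner norms. -/
theorem eLpNorm_lintegral_le {μ : Measure α} {ν : Measure β} [SFinite μ] [SFinite ν]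
    {d : α → β → ℝ≥0∞} (hd : Measurable (Function.uncurry d)) {φ : α → ℝ≥0∞} (hφ : Measurable φ)
    {p : ℝ≥0∞} (hp : 1 ≤ p) (h : ∀ᵐ s ∂μ, eLpNorm (d s) p ν ≤ φ s) :
    eLpNorm (fun x => ∫⁻ s, d s x ∂μ) p ν ≤ ∫⁻ s, φ s ∂μ := by
  rcases eq_or_ne (∫⁻ s, φ s ∂μ) ∞ with htop | htop
  · rw [htop]; exact le_top
  have hp0 : p ≠ 0 := (zero_lt_one.trans_le hp).ne'
  have hZ : MeasurableSet {s | φ s ≠ 0} := hφ (measurableSet_singleton 0).compl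
  -- Where the majorant vanishes so does the slice, and such s contribute nothing for almost every
  -- x; the previous lemma covers the rest.
  have h1 : ∀ᵐ s ∂μ.restrict {s | φ s ≠ 0}ᶜ, ∀ᵐ x ∂ν, d s x = 0 := by
    filter_upwards [ae_restrict_of_ae h, ae_restrict_mem hZ.compl] with s hs hs'
    have h0 : φ s = 0 := by simpa using hs'
    have h2 : eLpNorm (d s) p ν = 0 := le_antisymm (h0 ▸ hs) (zero_le)
    have hm : Measurable (d s) := hd.comp measurable_prodMk_left
    exact (eLpNorm_eq_zero_iff hm.aestronglyMeasurable hp0).1 h2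
  have h2 : MeasurableSet {z : α × β | Function.uncurry d z = 0} :=
    hd (measurableSet_singleton 0)
  have h3 : ∀ᵐ x ∂ν, ∀ᵐ s ∂μ.restrict {s | φ s ≠ 0}ᶜ, d s x = 0 :=
    (Measure.ae_ae_comm h2).1 h1
  have h4 : (fun x => ∫⁻ s, d s x ∂μ) =ᵐ[ν] fun x => ∫⁻ s, d s x ∂μ.restrict {s | φ s ≠ 0} := by
    filter_upwards [h3] with x hx
    rw [← lintegral_add_compl _ hZ, lintegral_congr_ae hx]
    simp
  rw [eLpNorm_congr_ae h4]
  refine (eLpNorm_lintegral_le_of_ne_zero (μ := μ.restrict {s | φ s ≠ 0}) hd hφ hp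
    (ae_restrict_mem hZ)
    (ae_restrict_of_ae ?_) (ae_restrict_of_ae h)).trans (setLIntegral_le_lintegral _ _)
  filter_upwards [ae_lt_top hφ htop] with s hs using hs.ne

end Lebesgue

/-! ### Young's inequality -/

/-- Convolution of nonnegative functions. -/
def lconv (K f : E3 → ℝ≥0∞) (x : E3) : ℝ≥0∞ := ∫⁻ y, K (x - y) * f y

theorem lintegral_sub_left_eq (K : E3 → ℝ≥0∞) (x : E3) : ∫⁻ y, K (x - y) = ∫⁻ y, K y :=
  lintegral_sub_left_eq_self K x

theorem lconv_le {K f : E3 → ℝ≥0∞} (hK : Measurable K) (hf : Measurable f) {A B q : ℝ≥0∞}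
    (hA : ∫⁻ x, K x ≤ A) (hB : ∀ x, K x ≤ B) (hq : 1 ≤ q) (x : E3) :
    lconv K f x ≤ A ^ (1 - q⁻¹.toReal) * B ^ q⁻¹.toReal * eLpNorm f q volume := by
  have hA' : ∫⁻ y, K (x - y) ≤ A := by rwa [lintegral_sub_left_eq]
  have hKx : Measurable fun y => K (x - y) := by fun_prop
  rcases eq_or_ne q ∞ with rfl | hq'
  · simp only [ENNReal.inv_top, ENNReal.toReal_zero, sub_zero, ENNReal.rpow_one,
      ENNReal.rpow_zero, mul_one]
    calc lconv K f x ≤ ∫⁻ y, K (x - y) * eLpNorm f ∞ volume := by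
          apply lintegral_mono_ae
          filter_upwards [ae_le_eLpNorm_top (μ := volume) f] with y hy
          gcongr
      _ = (∫⁻ y, K (x - y)) * eLpNorm f ∞ volume := lintegral_mul_const _ hKx
      _ ≤ _ := by gcongr
  · set r := q.toReal with hr
    have hr1 : 1 ≤ r := by
      rw [hr, ← ENNReal.toReal_one]
      exact ENNReal.toReal_mono hq' hq
    have hr0 : 0 < r := by linarith
    have hi : q⁻¹.toReal = 1 / r := by rw [ENNReal.toReal_inv, one_div]
    have h1 : 0 ≤ 1 - 1 / r := by rw [sub_nonneg, div_le_one hr0]; exact hr1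
    rw [hi]
    calc lconv K f x
        ≤ (∫⁻ y, K (x - y)) ^ (1 - 1 / r) * (∫⁻ y, K (x - y) * f y ^ r) ^ (1 / r) :=
          lintegral_mul_le_weighted hKx hf hr1
      _ ≤ A ^ (1 - 1 / r) * (∫⁻ y, B * f y ^ r) ^ (1 / r) := by
          gcongr with y
          exact hB _
      _ = A ^ (1 - 1 / r) * B ^ (1 / r) * eLpNorm f q volume := by
          rw [lintegral_const_mul _ (by fun_prop), hr, lintegral_rpow_eq_eLpNorm_rpow _ hq hq', ← hr,
            ENNReal.mul_rpow_of_nonneg _ _ (by positivity), ← ENNReal.rpow_mul, mul_assoc]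
          field_simp
          simp

/-- Young's inequality, with the norm of the kernel interpolated between L¹ and L^∞. In the p-th
power of the convolution, p - q factors are bounded by the sup estimate `lconv_le` and the other q
are integrated by Tonelli. -/
theorem eLpNorm_lconv_le {K f : E3 → ℝ≥0∞} (hK : Measurable K) (hf : Measurable f)
    {A B p q : ℝ≥0∞} (hA : ∫⁻ x, K x ≤ A) (hB : ∀ x, K x ≤ B) (hq : 1 ≤ q) (hqp : q ≤ p) :
    eLpNorm (lconv K f) p volume ≤
      A ^ (1 - (q⁻¹.toReal - p⁻¹.toReal)) * B ^ (q⁻¹.toReal - p⁻¹.toReal) *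
        eLpNorm f q volume := by
  rcases eq_or_ne p ∞ with rfl | hp'
  · simp only [ENNReal.inv_top, ENNReal.toReal_zero, sub_zero]
    exact eLpNorm_top_le_of_ae_le (ae_of_all _ (lconv_le hK hf hA hB hq))
  have hq' : q ≠ ∞ := ne_top_of_le_ne_top hp' hqp
  have hp : 1 ≤ p := hq.trans hqp
  set r := q.toReal with hr
  set s := p.toReal with hs
  have hr1 : 1 ≤ r := by
    rw [hr, ← ENNReal.toReal_one]
    exact ENNReal.toReal_mono hq' hq
  have hr0 : 0 < r := by linarith
  have hrs : r ≤ s := ENNReal.toReal_mono hp' hqp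
  have hs0 : 0 < s := by linarith
  have hi : q⁻¹.toReal = 1 / r := by rw [ENNReal.toReal_inv, one_div]
  have hi' : p⁻¹.toReal = 1 / s := by rw [ENNReal.toReal_inv, one_div]
  have h1 : 0 ≤ 1 - 1 / r := by rw [sub_nonneg, div_le_one hr0]; exact hr1
  have h2 : 1 / s ≤ 1 / r := one_div_le_one_div_of_le hr0 hrs
  have h3 : 0 ≤ 1 - (1 / r - 1 / s) := by have : 0 < 1 / s := by positivity
                                          linarith
  apply eLpNorm_le_of_lintegral_rpow_le hp hp'
  rw [hi, hi', ← hs]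
  set N := eLpNorm f q volume with hN
  have hpow : ∀ x, lconv K f x ^ r ≤ A ^ (r - 1) * ∫⁻ y, K (x - y) * f y ^ r := by
    intro x
    have hKx : Measurable fun y => K (x - y) := by fun_prop
    calc lconv K f x ^ r
        ≤ ((∫⁻ y, K (x - y)) ^ (1 - 1 / r) * (∫⁻ y, K (x - y) * f y ^ r) ^ (1 / r)) ^ r :=
          ENNReal.rpow_le_rpow (lintegral_mul_le_weighted hKx hf hr1) hr0.le
      _ = (∫⁻ y, K (x - y)) ^ (r - 1) * ∫⁻ y, K (x - y) * f y ^ r := by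
          rw [ENNReal.mul_rpow_of_nonneg _ _ hr0.le, ← ENNReal.rpow_mul, ← ENNReal.rpow_mul]
          congr 2
          · field_simp
          · field_simp; simp
      _ ≤ _ := by
          gcongr
          rwa [lintegral_sub_left_eq]
  have hint : ∫⁻ x, ∫⁻ y, K (x - y) * f y ^ r ≤ A * N ^ r := by
    rw [lintegral_lintegral_swap (by
      apply Measurable.aemeasurable
      simp only [Function.uncurry_def]
      fun_prop)]
    calc ∫⁻ y, ∫⁻ x, K (x - y) * f y ^ r = ∫⁻ y, (∫⁻ x, K x) * f y ^ r := by
          refine lintegral_congr fun y => ?_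
          rw [lintegral_mul_const _ (by fun_prop), lintegral_sub_right_eq_self K y]
      _ = (∫⁻ x, K x) * N ^ r := by
          rw [lintegral_const_mul _ (by fun_prop), hr, lintegral_rpow_eq_eLpNorm_rpow _ hq hq']
      _ ≤ _ := by gcongr
  calc ∫⁻ x, lconv K f x ^ s
      = ∫⁻ x, lconv K f x ^ (s - r) * lconv K f x ^ r := by
        refine lintegral_congr fun x => ?_
        rw [← ENNReal.rpow_add_of_nonneg _ _ (by linarith) hr0.le]
        ring_nf
    _ ≤ ∫⁻ x, (A ^ (1 - 1 / r) * B ^ (1 / r) * N) ^ (s - r) *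
          (A ^ (r - 1) * ∫⁻ y, K (x - y) * f y ^ r) := by
        refine lintegral_mono fun x => ?_
        have := lconv_le hK hf hA hB hq x
        rw [hi] at this
        have h' := hpow x
        gcongr
    _ = (A ^ (1 - 1 / r) * B ^ (1 / r) * N) ^ (s - r) *
          (A ^ (r - 1) * ∫⁻ x, ∫⁻ y, K (x - y) * f y ^ r) := by
        have hm : Measurable fun x => ∫⁻ y, K (x - y) * f y ^ r := by
          apply Measurable.lintegral_prod_right' (f := fun z : E3 × E3 => K (z.1 - z.2) * f z.2 ^ r)
          fun_prop
        rw [lintegral_const_mul _ (by fun_prop), lintegral_const_mul _ (by fun_prop)]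
    _ ≤ (A ^ (1 - 1 / r) * B ^ (1 / r) * N) ^ (s - r) * (A ^ (r - 1) * (A * N ^ r)) := by
        gcongr
    _ = (A ^ (1 - (1 / r - 1 / s)) * B ^ (1 / r - 1 / s) * N) ^ s := by
        have hsr : 0 ≤ s - r := by linarith
        rw [ENNReal.mul_rpow_of_nonneg _ _ hsr, ENNReal.mul_rpow_of_nonneg _ _ hsr,
          ENNReal.mul_rpow_of_nonneg _ _ hs0.le, ENNReal.mul_rpow_of_nonneg _ _ hs0.le,
          ← ENNReal.rpow_mul, ← ENNReal.rpow_mul, ← ENNReal.rpow_mul, ← ENNReal.rpow_mul]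
        calc _ = (A ^ ((1 - 1 / r) * (s - r)) * (A ^ (r - 1) * A ^ (1 : ℝ))) *
              B ^ (1 / r * (s - r)) * (N ^ (s - r) * N ^ r) := by rw [ENNReal.rpow_one]; ring
          _ = _ := by
              rw [← ENNReal.rpow_add_of_nonneg _ _ (by linarith : 0 ≤ r - 1) zero_le_one,
                ← ENNReal.rpow_add_of_nonneg _ _ (by positivity) (by linarith),
                ← ENNReal.rpow_add_of_nonneg _ _ hsr hr0.le]
              congr 3
              · field_simp; ring
              · field_simp
              · ring

/-! ### Convolution of a scalar kernel with a vector field -/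

/-- Convolution of a scalar kernel with a vector field. -/
def conv (K : E3 → ℝ) (f : E3 → E3) (x : E3) : E3 := ∫ y, K (x - y) • f y

theorem heatFlow_eq_conv (t : ℝ) (f : E3 → E3) : heatFlow t f = conv (heatKernel t) f := rfl

theorem conv_eq_integral_shift (K : E3 → ℝ) (f : E3 → E3) (x : E3) :
    conv K f x = ∫ y, K y • f (x - y) := by
  rw [← integral_sub_left_eq_self (fun y => K y • f (x - y)) volume x]
  simp [conv]

theorem measurable_conv {K : E3 → ℝ} {f : E3 → E3} (hK : Measurable K) (hf : Measurable f) :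
    Measurable (conv K f) := by
  have : StronglyMeasurable (fun z : E3 × E3 => K (z.1 - z.2) • f z.2) :=
    Measurable.stronglyMeasurable (by fun_prop)
  exact this.integral_prod_right'.measurable

theorem enorm_conv_le (K : E3 → ℝ) (f : E3 → E3) (x : E3) :
    ‖conv K f x‖ₑ ≤ lconv (fun y => ‖K y‖ₑ) (fun y => ‖f y‖ₑ) x := by
  refine (enorm_integral_le_lintegral_enorm _).trans (le_of_eq ?_)
  exact lintegral_congr fun y => enorm_smul _ _

/-- `K` is a measurable kernel with `L¹` norm at most `A`, bounded by `B`. -/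
structure KernelBound (K : E3 → ℝ) (A B : ℝ≥0∞) : Prop where
  measurable : Measurable K
  lintegral_le : ∫⁻ x, ‖K x‖ₑ ≤ A
  enorm_le : ∀ x, ‖K x‖ₑ ≤ B

namespace KernelBound

variable {K K' : E3 → ℝ} {A B A' B' : ℝ≥0∞} {f g : E3 → E3} {p q : ℝ≥0∞}

theorem eLpNorm_conv_le (h : KernelBound K A B) (hf : Measurable f) (hq : 1 ≤ q) (hqp : q ≤ p) :
    eLpNorm (conv K f) p volume ≤
      A ^ (1 - (q⁻¹.toReal - p⁻¹.toReal)) * B ^ (q⁻¹.toReal - p⁻¹.toReal) *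
        eLpNorm f q volume := by
  have h1 := eLpNorm_lconv_le h.measurable.enorm hf.enorm h.lintegral_le h.enorm_le hq hqp
  rw [eLpNorm_enorm] at h1
  refine le_trans (eLpNorm_mono_enorm fun x => ?_) h1
  simpa using enorm_conv_le K f x

theorem eLpNorm_conv_le_self (h : KernelBound K A B) (hf : Measurable f) (hq : 1 ≤ q) :
    eLpNorm (conv K f) q volume ≤ A * eLpNorm f q volume := by
  simpa using h.eLpNorm_conv_le hf hq le_rfl

theorem lconv_le (h : KernelBound K A B) (hf : Measurable f) (hq : 1 ≤ q) (x : E3) :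
    lconv (fun y => ‖K y‖ₑ) (fun y => ‖f y‖ₑ) x ≤
      A ^ (1 - q⁻¹.toReal) * B ^ q⁻¹.toReal * eLpNorm f q volume := by
  have h1 := NSFreq.lconv_le h.measurable.enorm hf.enorm h.lintegral_le h.enorm_le hq x
  rwa [eLpNorm_enorm] at h1

theorem enorm_conv_le (h : KernelBound K A B) (hf : Measurable f) (hq : 1 ≤ q) (x : E3) :
    ‖conv K f x‖ₑ ≤ A ^ (1 - q⁻¹.toReal) * B ^ q⁻¹.toReal * eLpNorm f q volume :=
  (NSFreq.enorm_conv_le K f x).trans (h.lconv_le hf hq x)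

theorem inv_toReal_le_one (hq : 1 ≤ q) : q⁻¹.toReal ≤ 1 := by
  have : q⁻¹ ≤ 1 := ENNReal.inv_le_one.2 hq
  simpa using ENNReal.toReal_mono ENNReal.one_ne_top this

theorem lconv_lt_top (h : KernelBound K A B) (hA : A ≠ ∞) (hB : B ≠ ∞) (hf : Measurable f)
    (hq : 1 ≤ q) (hfq : eLpNorm f q volume ≠ ∞) (x : E3) :
    lconv (fun y => ‖K y‖ₑ) (fun y => ‖f y‖ₑ) x < ∞ := by
  refine (h.lconv_le hf hq x).trans_lt ?_
  have := inv_toReal_le_one hq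
  refine ENNReal.mul_lt_top (ENNReal.mul_lt_top ?_ ?_) hfq.lt_top
  · exact ENNReal.rpow_lt_top_of_nonneg (by linarith) hA
  · exact ENNReal.rpow_lt_top_of_nonneg (by positivity) hB

theorem integrable_smul (h : KernelBound K A B) (hA : A ≠ ∞) (hB : B ≠ ∞) (hf : Measurable f)
    (hq : 1 ≤ q) (hfq : eLpNorm f q volume ≠ ∞) (x : E3) :
    Integrable (fun y => K (x - y) • f y) := by
  have hK := h.measurable
  refine ⟨Measurable.aestronglyMeasurable (by fun_prop), ?_⟩
  refine lt_of_eq_of_lt ?_ (h.lconv_lt_top hA hB hf hq hfq x)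
  exact lintegral_congr fun y => enorm_smul _ _

theorem integrable_smul_shift (h : KernelBound K A B) (hA : A ≠ ∞) (hB : B ≠ ∞)
    (hf : Measurable f) (hq : 1 ≤ q) (hfq : eLpNorm f q volume ≠ ∞) (x : E3) :
    Integrable (fun y => K y • f (x - y)) := by
  have := (h.integrable_smul hA hB hf hq hfq x).comp_sub_left x
  simpa using this

theorem integrable (h : KernelBound K A B) (hA : A ≠ ∞) : Integrable K :=
  ⟨h.measurable.aestronglyMeasurable, h.lintegral_le.trans_lt hA.lt_top⟩

theorem conv_sub (h : KernelBound K A B) (hA : A ≠ ∞) (hB : B ≠ ∞) (hf : Measurable f)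
    (hg : Measurable g) (hq : 1 ≤ q) (hfq : eLpNorm f q volume ≠ ∞)
    (hp : 1 ≤ p) (hgp : eLpNorm g p volume ≠ ∞) : conv K (f - g) = conv K f - conv K g := by
  ext1 x
  simp only [conv, Pi.sub_apply, smul_sub]
  exact integral_sub (h.integrable_smul hA hB hf hq hfq x) (h.integrable_smul hA hB hg hp hgp x)

theorem sub_conv (h : KernelBound K A B) (hA : A ≠ ∞) (hB : B ≠ ∞) (h' : KernelBound K' A' B')
    (hA' : A' ≠ ∞) (hB' : B' ≠ ∞) (hf : Measurable f)
    (hq : 1 ≤ q) (hfq : eLpNorm f q volume ≠ ∞) :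
    conv (K - K') f = conv K f - conv K' f := by
  ext1 x
  simp only [conv, Pi.sub_apply, sub_smul]
  exact integral_sub (h.integrable_smul hA hB hf hq hfq x)
    (h'.integrable_smul hA' hB' hf hq hfq x)

/-- Fubini after shifting both variables; absolute convergence comes from the pointwise Young bound
for K' and the integrability of K. It lets the heat flow and the frequency projections be
interchanged. -/
theorem conv_comm (h : KernelBound K A B) (hA : A ≠ ∞) (h' : KernelBound K' A' B')
    (hA' : A' ≠ ∞) (hB' : B' ≠ ∞) (hf : Measurable f)
    (hq : 1 ≤ q) (hfq : eLpNorm f q volume ≠ ∞) :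
    conv K (conv K' f) = conv K' (conv K f) := by
  ext1 x
  have hK := h.measurable
  have hK' := h'.measurable
  simp only [conv_eq_integral_shift, ← integral_smul]
  rw [integral_integral_swap]
  · refine integral_congr_ae (ae_of_all _ fun y => integral_congr_ae (ae_of_all _ fun z => ?_))
    simp only [smul_smul, mul_comm (K z), sub_right_comm x z y]
  · refine ⟨Measurable.aestronglyMeasurable ?_, ?_⟩
    · simp only [Function.uncurry_def]
      fun_prop
    · have hm : Measurable fun z : E3 × E3 => ‖K z.1 • K' z.2 • f (x - z.1 - z.2)‖ₑ := by fun_prop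
      have h1 := h'.lconv_le (f := f) hf hq
      simp only [HasFiniteIntegral, Function.uncurry_def]
      rw [lintegral_prod _ hm.aemeasurable]
      have e : ∀ y, ∫⁻ z, ‖K y • K' z • f (x - y - z)‖ₑ
          = ‖K y‖ₑ * lconv (fun y => ‖K' y‖ₑ) (fun y => ‖f y‖ₑ) (x - y) := by
        intro y
        rw [lconv, ← lintegral_sub_left_eq_self (fun z => ‖K' (x - y - z)‖ₑ * ‖f z‖ₑ) (x - y),
          ← lintegral_const_mul _ (by fun_prop)]
        simp [enorm_smul]
      simp only [e]
      calc _ ≤ ∫⁻ y, ‖K y‖ₑ * (A' ^ (1 - q⁻¹.toReal) * B' ^ q⁻¹.toReal * eLpNorm f q volume) := by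
            gcongr with y
            exact h1 _
        _ = (∫⁻ y, ‖K y‖ₑ) * (A' ^ (1 - q⁻¹.toReal) * B' ^ q⁻¹.toReal * eLpNorm f q volume) :=
            lintegral_mul_const _ hK.enorm
        _ < ∞ := by
          have := inv_toReal_le_one hq
          refine ENNReal.mul_lt_top (h.lintegral_le.trans_lt hA.lt_top) ?_
          refine ENNReal.mul_lt_top (ENNReal.mul_lt_top ?_ ?_) hfq.lt_top
          · exact ENNReal.rpow_lt_top_of_nonneg (by linarith) hA'
          · exact ENNReal.rpow_lt_top_of_nonneg (by positivity) hB'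

/-- A translate of a convolution is the convolution with the translated kernel. -/
theorem conv_translate_sub (h : KernelBound K A B) (hA : A ≠ ∞) (hB : B ≠ ∞) (hf : Measurable f)
    (hq : 1 ≤ q) (hfq : eLpNorm f q volume ≠ ∞) (x y : E3) :
    conv K f (x - y) - conv K f x = conv (fun z => K (z - y) - K z) f x := by
  simp only [conv, sub_smul]
  rw [integral_sub]
  · simp [sub_right_comm]
  · simpa [sub_right_comm] using h.integrable_smul hA hB hf hq hfq (x - y)
  · exact h.integrable_smul hA hB hf hq hfq x

/-- Pointwise bound on `g - K * g` for a kernel of mass one. -/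
theorem enorm_sub_conv_le (h : KernelBound K A B) (hA : A ≠ ∞) (hB : B ≠ ∞) (h1 : ∫ x, K x = 1)
    (hg : Measurable g) (hq : 1 ≤ q) (hgq : eLpNorm g q volume ≠ ∞) (x : E3) :
    ‖g x - conv K g x‖ₑ ≤ ∫⁻ y, ‖K y‖ₑ * ‖g (x - y) - g x‖ₑ := by
  have e : g x - conv K g x = ∫ y, K y • (g x - g (x - y)) := by
    simp only [smul_sub]
    rw [integral_sub ((h.integrable hA).smul_const _) (h.integrable_smul_shift hA hB hg hq hgq x),
      integral_smul_const, h1, one_smul, conv_eq_integral_shift]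
  rw [e]
  refine (enorm_integral_le_lintegral_enorm _).trans (le_of_eq ?_)
  refine lintegral_congr fun y => ?_
  rw [enorm_smul, enorm_sub_rev]

/-- An average against a kernel of mass one differs from g by at most the first moment of the kernel
times the L^q Lipschitz constant L of the translates of g. -/
theorem eLpNorm_sub_conv_le (h : KernelBound K A B) (hA : A ≠ ∞) (hB : B ≠ ∞)
    (h1 : ∫ x, K x = 1) (hg : Measurable g) (hq : 1 ≤ q) (hgq : eLpNorm g q volume ≠ ∞)
    {L : ℝ≥0∞} (hL : ∀ y, eLpNorm (fun x => g (x - y) - g x) q volume ≤ L * ‖y‖ₑ) :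
    eLpNorm (g - conv K g) q volume ≤ (∫⁻ y, ‖K y‖ₑ * ‖y‖ₑ) * L := by
  have hK := h.measurable
  calc eLpNorm (g - conv K g) q volume
      ≤ eLpNorm (fun x => ∫⁻ y, ‖K y‖ₑ * ‖g (x - y) - g x‖ₑ) q volume :=
        eLpNorm_mono_enorm fun x => by
          simpa using h.enorm_sub_conv_le hA hB h1 hg hq hgq x
    _ ≤ ∫⁻ y, ‖K y‖ₑ * ‖y‖ₑ * L := by
        refine eLpNorm_lintegral_le ?_ (by fun_prop) hq (ae_of_all _ fun y => ?_)
        · simp only [Function.uncurry_def]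
          fun_prop
        · have : (fun x => ‖K y‖ₑ * ‖g (x - y) - g x‖ₑ) =
              fun x => ‖K y • (g (x - y) - g x)‖ₑ := by
            ext1 x; rw [enorm_smul]
          rw [this, eLpNorm_enorm]
          have e : (fun x => K y • (g (x - y) - g x)) = K y • fun x => g (x - y) - g x := rfl
          rw [e, eLpNorm_const_smul, mul_assoc]
          gcongr
          rw [mul_comm]
          exact hL y
    _ = _ := lintegral_mul_const _ (hK.enorm.mul measurable_enorm)

end KernelBound

/-! ### Translation estimates for differentiable kernels -/

/-- The fundamental theorem of calculus along the segment from x to x - y. Keeping the integral over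
θ allows both an L¹ and a sup bound to be read off. -/
theorem enorm_translate_sub_le {K : E3 → ℝ} (hK : ContDiff ℝ 1 K) (x y : E3) :
    ‖K (x - y) - K x‖ₑ ≤ ∫⁻ θ in Ioc (0 : ℝ) 1, ‖fderiv ℝ K (x - θ • y)‖ₑ * ‖y‖ₑ := by
  have hc : Continuous (fderiv ℝ K) := hK.continuous_fderiv one_ne_zero
  have hd : ∀ θ ∈ Set.uIcc (0 : ℝ) 1,
      HasDerivAt (fun θ : ℝ => K (x - θ • y)) (fderiv ℝ K (x - θ • y) (-y)) θ := by
    intro θ _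
    have h1 : HasDerivAt (fun θ : ℝ => x - θ • y) (-y) θ := by
      simpa using ((hasDerivAt_id θ).smul_const y).const_sub x
    exact ((hK.differentiable one_ne_zero (x - θ • y)).hasFDerivAt).comp_hasDerivAt θ h1
  have hint : IntervalIntegrable (fun θ : ℝ => fderiv ℝ K (x - θ • y) (-y)) volume 0 1 := by
    apply Continuous.intervalIntegrable
    fun_prop
  have e := intervalIntegral.integral_eq_sub_of_hasDerivAt hd hint
  simp only [one_smul, zero_smul, sub_zero] at e
  rw [← e, intervalIntegral.integral_of_le zero_le_one]
  refine (enorm_integral_le_lintegral_enorm _).trans (lintegral_mono fun θ => ?_)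
  refine (ContinuousLinearMap.le_opENorm _ _).trans ?_
  rw [enorm_neg]

theorem lintegral_translate_sub_le {K : E3 → ℝ} (hK : ContDiff ℝ 1 K) (y : E3) :
    ∫⁻ x, ‖K (x - y) - K x‖ₑ ≤ (∫⁻ x, ‖fderiv ℝ K x‖ₑ) * ‖y‖ₑ := by
  have hc : Continuous (fderiv ℝ K) := hK.continuous_fderiv one_ne_zero
  calc ∫⁻ x, ‖K (x - y) - K x‖ₑ
      ≤ ∫⁻ x, ∫⁻ θ in Ioc (0 : ℝ) 1, ‖fderiv ℝ K (x - θ • y)‖ₑ * ‖y‖ₑ :=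
        lintegral_mono fun x => enorm_translate_sub_le hK x y
    _ = ∫⁻ θ in Ioc (0 : ℝ) 1, ∫⁻ x, ‖fderiv ℝ K (x - θ • y)‖ₑ * ‖y‖ₑ := by
        rw [lintegral_lintegral_swap]
        apply Measurable.aemeasurable
        simp only [Function.uncurry_def]
        have : Continuous fun z : E3 × ℝ => fderiv ℝ K (z.1 - z.2 • y) := by fun_prop
        exact this.measurable.enorm.mul_const _
    _ = ∫⁻ θ in Ioc (0 : ℝ) 1, (∫⁻ x, ‖fderiv ℝ K x‖ₑ) * ‖y‖ₑ := by
        refine lintegral_congr fun θ => ?_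
        rw [lintegral_mul_const _ (by
          have : Continuous fun x : E3 => fderiv ℝ K (x - θ • y) := by fun_prop
          exact this.measurable.enorm), lintegral_sub_right_eq_self (fun x => ‖fderiv ℝ K x‖ₑ) (θ • y)]
    _ = _ := by simp

theorem kernelBound_translate_sub {K : E3 → ℝ} (hK : ContDiff ℝ 1 K) {A B : ℝ≥0∞}
    (hA : ∫⁻ x, ‖fderiv ℝ K x‖ₑ ≤ A) (hB : ∀ x, ‖fderiv ℝ K x‖ₑ ≤ B) (y : E3) :
    KernelBound (fun x => K (x - y) - K x) (A * ‖y‖ₑ) (B * ‖y‖ₑ) where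
  measurable := by
    have := hK.continuous.measurable
    fun_prop
  lintegral_le := (lintegral_translate_sub_le hK y).trans (by gcongr)
  enorm_le x := by
    refine (enorm_translate_sub_le hK x y).trans ?_
    calc _ ≤ ∫⁻ θ in Ioc (0 : ℝ) 1, B * ‖y‖ₑ := by
          gcongr with θ
          exact hB _
      _ = _ := by simp

/-! ### The heat kernel -/

theorem heatKernel_nonneg {t : ℝ} (ht : 0 ≤ t) (x : E3) : 0 ≤ heatKernel t x := by
  unfold heatKernel
  positivity

theorem contDiff_heatKernel (t : ℝ) {n : WithTop ℕ∞} : ContDiff ℝ n (heatKernel t) := by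
  unfold heatKernel
  have : ContDiff ℝ n fun x : E3 => ‖x‖ ^ 2 := contDiff_norm_sq ℝ
  fun_prop

theorem measurable_heatKernel : Measurable (Function.uncurry heatKernel) := by
  simp only [Function.uncurry_def, heatKernel]
  fun_prop

theorem hasFDerivAt_heatKernel (t : ℝ) (x : E3) :
    HasFDerivAt (heatKernel t) ((-(heatKernel t x / (2 * t))) • innerSL ℝ x) x := by
  have h1 : HasFDerivAt (fun x : E3 => ‖x‖ ^ 2) (2 • innerSL ℝ x) x :=
    (hasStrictFDerivAt_norm_sq x).hasFDerivAt
  have h2 := ((h1.neg.mul_const (4 * t)⁻¹).exp).const_mul ((4 * π * t) ^ (-(3 / 2) : ℝ))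
  refine h2.congr_fderiv ?_
  ext y
  simp only [heatKernel, div_eq_mul_inv, mul_inv_rev]
  simp
  ring

theorem pd_mul_heatKernel (t : ℝ) (i : Fin 3) {g : E3 → ℝ} {x : E3} (hg : DifferentiableAt ℝ g x) :
    pd i (fun x => g x * heatKernel t x) x
      = (pd i g x - g x * x i / (2 * t)) * heatKernel t x := by
  have h := hg.hasFDerivAt.fun_mul (hasFDerivAt_heatKernel t x)
  rw [pd, h.fderiv]
  simp [pd, EuclideanSpace.inner_single_right]
  ring

theorem pd_heatKernel (t : ℝ) (i : Fin 3) :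
    pd i (heatKernel t) = fun x => (-(x i) / (2 * t)) * heatKernel t x := by
  ext1 x
  rw [pd, (hasFDerivAt_heatKernel t x).fderiv]
  simp [EuclideanSpace.inner_single_right]
  ring

theorem pd_pd_heatKernel (t : ℝ) (i j : Fin 3) :
    pd i (pd j (heatKernel t)) = fun x =>
      (-(if i = j then 1 else 0) / (2 * t) + x i * x j / (2 * t) ^ 2) * heatKernel t x := by
  ext1 x
  have h : HasFDerivAt (fun x : E3 => -(x j) / (2 * t))
      (-((2 * t)⁻¹ • (EuclideanSpace.proj j : E3 →L[ℝ] ℝ))) x := by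
    have := ((EuclideanSpace.proj j : E3 →L[ℝ] ℝ).hasFDerivAt (x := x)).neg.mul_const (2 * t)⁻¹
    refine this.congr_fderiv ?_
    ext y; simp
  rw [pd_heatKernel, pd_mul_heatKernel _ _ h.differentiableAt, pd, h.fderiv]
  congr 1
  by_cases hij : i = j
  · subst hij; simp; ring
  · simp [hij, Ne.symm hij]; ring

theorem pd_pd_pd_heatKernel (t : ℝ) (i j k : Fin 3) :
    pd i (pd j (pd k (heatKernel t))) = fun x =>
      (((if i = j then x k else 0) + (if i = k then x j else 0) + (if j = k then x i else 0))
          / (2 * t) ^ 2 - x i * x j * x k / (2 * t) ^ 3) * heatKernel t x := by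
  ext1 x
  have hp : ∀ l : Fin 3, HasFDerivAt (fun x : E3 => x l) (EuclideanSpace.proj l : E3 →L[ℝ] ℝ) x :=
    fun l => (EuclideanSpace.proj l : E3 →L[ℝ] ℝ).hasFDerivAt
  have h := ((((hp j).fun_mul (hp k)).mul_const ((2 * t) ^ 2)⁻¹).const_add
    (-(if j = k then (1 : ℝ) else 0) / (2 * t)))
  rw [pd_pd_heatKernel]
  simp only [← div_eq_mul_inv] at h
  rw [pd_mul_heatKernel _ _ h.differentiableAt, pd, h.fderiv]
  congr 1
  have e : ∀ l : Fin 3, (EuclideanSpace.single i (1 : ℝ) : E3) l = if i = l then 1 else 0 := by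
    intro l
    simp [eq_comm]
  have e1 : ∀ (P : Prop) [Decidable P] (a : ℝ), (if P then a else 0) = (if P then 1 else 0) * a :=
    fun P _ a => by split_ifs <;> simp
  rw [e1 (i = j) (x k), e1 (i = k) (x j), e1 (j = k) (x i)]
  simp only [smul_apply, add_apply, EuclideanSpace.coe_proj, e, smul_eq_mul]
  ring

theorem integral_heatKernel {t : ℝ} (ht : 0 < t) : ∫ x, heatKernel t x = 1 := by
  have h := GaussianFourier.integral_rexp_neg_mul_sq_norm (V := E3) (b := 1 / (4 * t)) (by positivity)
  simp only [heatKernel]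
  rw [integral_const_mul]
  have e : ∀ x : E3, rexp (-‖x‖ ^ 2 / (4 * t)) = rexp (-(1 / (4 * t)) * ‖x‖ ^ 2) := by
    intro x; congr 1; ring
  simp_rw [e, h]
  have e2 : π / (1 / (4 * t)) = 4 * π * t := by field_simp
  rw [e2]
  simp only [finrank_euclideanSpace, Fintype.card_fin, Nat.cast_ofNat]
  rw [← Real.rpow_add (by positivity)]
  simp

theorem integrable_heatKernel {t : ℝ} (ht : 0 < t) : Integrable (heatKernel t) := by
  -- A non-integrable function has integral 0 by convention, which contradicts mass one.
  by_contra h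
  have := integral_heatKernel ht
  rw [integral_undef h] at this
  exact zero_ne_one this

theorem lintegral_heatKernel {t : ℝ} (ht : 0 < t) : ∫⁻ x, ENNReal.ofReal (heatKernel t x) = 1 := by
  rw [← ofReal_integral_eq_lintegral_ofReal (integrable_heatKernel ht)
    (ae_of_all _ (heatKernel_nonneg ht.le)), integral_heatKernel ht, ENNReal.ofReal_one]

theorem heatKernel_le {t : ℝ} (ht : 0 < t) (x : E3) : heatKernel t x ≤ t ^ (-(3 / 2) : ℝ) := by
  have hpi := Real.pi_gt_three
  calc heatKernel t x ≤ (4 * π * t) ^ (-(3 / 2) : ℝ) * 1 := by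
        unfold heatKernel
        gcongr
        rw [Real.exp_le_one_iff, div_nonpos_iff]
        right; constructor
        · have := sq_nonneg ‖x‖; linarith
        · positivity
    _ ≤ t ^ (-(3 / 2) : ℝ) := by
        rw [mul_one]
        apply Real.rpow_le_rpow_of_nonpos ht
        · nlinarith
        · norm_num

theorem kernelBound_heatKernel {t : ℝ} (ht : 0 < t) :
    KernelBound (heatKernel t) 1 (ENNReal.ofReal (t ^ (-(3 / 2) : ℝ))) where
  measurable := measurable_heatKernel.of_uncurry_left
  lintegral_le := by
    rw [← lintegral_heatKernel ht]
    refine lintegral_mono fun x => ?_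
    rw [Real.enorm_of_nonneg (heatKernel_nonneg ht.le x)]
  enorm_le x := by
    rw [Real.enorm_of_nonneg (heatKernel_nonneg ht.le x)]
    exact ENNReal.ofReal_le_ofReal (heatKernel_le ht x)

/-- Powers of `‖x‖` are absorbed by passing to twice the time. -/
theorem mul_heatKernel_le {t : ℝ} (ht : 0 < t) (x : E3) {a : ℝ}
    (ha : a ≤ Real.exp (‖x‖ ^ 2 / (8 * t))) : a * heatKernel t x ≤ 3 * heatKernel (2 * t) x := by
  have e1 : (4 * π * t) ^ (-(3 / 2) : ℝ) ≤ 3 * (4 * π * (2 * t)) ^ (-(3 / 2) : ℝ) := by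
    have : 4 * π * (2 * t) = 2 * (4 * π * t) := by ring
    rw [this, Real.mul_rpow (x := 2) (y := 4 * π * t) (by norm_num) (by positivity), ← mul_assoc]
    have h2 : (1 : ℝ) ≤ 3 * 2 ^ (-(3 / 2) : ℝ) := by
      rw [Real.rpow_neg (by norm_num), ← div_eq_mul_inv, le_div_iff₀ (by positivity), one_mul]
      have h3 : ((2 : ℝ) ^ (3 / 2 : ℝ)) ^ 2 = 8 := by
        rw [← Real.rpow_natCast, ← Real.rpow_mul (by norm_num)]; norm_num
      have h4 : 0 ≤ (2 : ℝ) ^ (3 / 2 : ℝ) := by positivity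
      nlinarith
    have h5 : 0 ≤ (4 * π * t) ^ (-(3 / 2) : ℝ) := by positivity
    nlinarith
  have e2 : Real.exp (‖x‖ ^ 2 / (8 * t)) * Real.exp (-‖x‖ ^ 2 / (4 * t))
      = Real.exp (-‖x‖ ^ 2 / (4 * (2 * t))) := by
    rw [← Real.exp_add]
    congr 1
    field_simp
    ring
  calc a * heatKernel t x ≤ Real.exp (‖x‖ ^ 2 / (8 * t)) * heatKernel t x := by
        gcongr
        exact heatKernel_nonneg ht.le x
    _ = (4 * π * t) ^ (-(3 / 2) : ℝ) * Real.exp (-‖x‖ ^ 2 / (4 * (2 * t))) := by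
        rw [← e2, heatKernel]; ring
    _ ≤ 3 * (4 * π * (2 * t)) ^ (-(3 / 2) : ℝ) * Real.exp (-‖x‖ ^ 2 / (4 * (2 * t))) := by gcongr
    _ = _ := by rw [heatKernel]; ring

theorem norm_mul_heatKernel_le {t : ℝ} (ht : 0 < t) (x : E3) :
    ‖x‖ * heatKernel t x ≤ 12 * t ^ (1 / 2 : ℝ) * heatKernel (2 * t) x := by
  set s := t ^ (1 / 2 : ℝ) with hs
  have hs0 : 0 < s := by positivity
  have hst : t = s ^ 2 := by rw [hs, ← Real.rpow_natCast, ← Real.rpow_mul ht.le]; norm_num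
  -- With y = ‖x‖/(4s) the exponent is 2y², and exp(2y²) ≥ 1 + 2y² ≥ y.
  have key := mul_heatKernel_le ht x (a := ‖x‖ / (4 * s)) (by
    have h1 := Real.add_one_le_exp (‖x‖ ^ 2 / (8 * t))
    refine le_trans ?_ h1
    have e : ‖x‖ ^ 2 / (8 * t) = 2 * (‖x‖ / (4 * s)) ^ 2 := by rw [hst]; field_simp; ring
    rw [e]
    nlinarith [sq_nonneg (‖x‖ / (4 * s) - 1 / 4)])
  calc ‖x‖ * heatKernel t x = 4 * s * (‖x‖ / (4 * s) * heatKernel t x) := by field_simp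
    _ ≤ 4 * s * (3 * heatKernel (2 * t) x) := by gcongr
    _ = _ := by ring

theorem norm_pow_three_mul_heatKernel_le {t : ℝ} (ht : 0 < t) (x : E3) :
    ‖x‖ ^ 3 * heatKernel t x ≤ 384 * t ^ (3 / 2 : ℝ) * heatKernel (2 * t) x := by
  set s := t ^ (1 / 2 : ℝ) with hs
  have hs0 : 0 < s := by positivity
  have hst : t = s ^ 2 := by rw [hs, ← Real.rpow_natCast, ← Real.rpow_mul ht.le]; norm_num
  have hs3 : t ^ (3 / 2 : ℝ) = s ^ 3 := by
    rw [hs, ← Real.rpow_natCast, ← Real.rpow_mul ht.le]; norm_num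
  -- With z = ‖x‖/s the exponent is z²/8, whose quadratic Taylor bound contains z²/8 + z⁴/128 ≥
  -- z³/128.
  have key := mul_heatKernel_le ht x (a := (‖x‖ / s) ^ 3 / 128) (by
    have h1 := Real.quadratic_le_exp_of_nonneg (x := ‖x‖ ^ 2 / (8 * t)) (by positivity)
    refine le_trans ?_ h1
    have e : ‖x‖ ^ 2 / (8 * t) = (‖x‖ / s) ^ 2 / 8 := by rw [hst]; field_simp
    rw [e]
    have h0 : 0 ≤ ‖x‖ / s := by positivity
    nlinarith [sq_nonneg ((‖x‖ / s) ^ 2 - ‖x‖ / s), sq_nonneg (‖x‖ / s), sq_nonneg (‖x‖ / s - 1)])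
  rw [hs3]
  calc ‖x‖ ^ 3 * heatKernel t x = 128 * s ^ 3 * ((‖x‖ / s) ^ 3 / 128 * heatKernel t x) := by
        field_simp
    _ ≤ 128 * s ^ 3 * (3 * heatKernel (2 * t) x) := by gcongr
    _ = _ := by ring

theorem lintegral_enorm_heatKernel_mul_enorm_le {t : ℝ} (ht : 0 < t) :
    ∫⁻ y, ‖heatKernel t y‖ₑ * ‖y‖ₑ ≤ ENNReal.ofReal (12 * t ^ (1 / 2 : ℝ)) := by
  have hm : Measurable (heatKernel (2 * t)) := measurable_heatKernel.of_uncurry_left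
  calc ∫⁻ y, ‖heatKernel t y‖ₑ * ‖y‖ₑ
      ≤ ∫⁻ y, ENNReal.ofReal (12 * t ^ (1 / 2 : ℝ)) * ENNReal.ofReal (heatKernel (2 * t) y) := by
        refine lintegral_mono fun y => ?_
        rw [Real.enorm_of_nonneg (heatKernel_nonneg ht.le y), ← ofReal_norm,
          ← ENNReal.ofReal_mul (heatKernel_nonneg ht.le y), ← ENNReal.ofReal_mul (by positivity)]
        apply ENNReal.ofReal_le_ofReal
        rw [mul_comm]
        exact norm_mul_heatKernel_le ht y
    _ = _ := by
        rw [lintegral_const_mul _ (by fun_prop), lintegral_heatKernel (by positivity), mul_one]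

theorem norm_fderiv_heatKernel_le {t : ℝ} (ht : 0 < t) (x : E3) :
    ‖fderiv ℝ (heatKernel t) x‖ ≤ 6 * t ^ (-(1 / 2) : ℝ) * heatKernel (2 * t) x := by
  rw [(hasFDerivAt_heatKernel t x).fderiv, norm_smul, innerSL_apply_norm, norm_neg, norm_div,
    Real.norm_of_nonneg (heatKernel_nonneg ht.le x), Real.norm_of_nonneg (by positivity : 0 ≤ 2 * t)]
  have h := norm_mul_heatKernel_le ht x
  have e : t ^ (-(1 / 2) : ℝ) = t ^ (1 / 2 : ℝ) / t := by
    rw [show (-(1 / 2) : ℝ) = 1 / 2 - 1 by norm_num, Real.rpow_sub_one ht.ne']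
  rw [e]
  calc _ = (‖x‖ * heatKernel t x) / (2 * t) := by ring
    _ ≤ (12 * t ^ (1 / 2 : ℝ) * heatKernel (2 * t) x) / (2 * t) := by gcongr
    _ = _ := by field_simp; ring

theorem lintegral_enorm_fderiv_heatKernel_le {t : ℝ} (ht : 0 < t) :
    ∫⁻ x, ‖fderiv ℝ (heatKernel t) x‖ₑ ≤ ENNReal.ofReal (6 * t ^ (-(1 / 2) : ℝ)) := by
  have hm : Measurable (heatKernel (2 * t)) := measurable_heatKernel.of_uncurry_left
  calc ∫⁻ x, ‖fderiv ℝ (heatKernel t) x‖ₑ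
      ≤ ∫⁻ y, ENNReal.ofReal (6 * t ^ (-(1 / 2) : ℝ)) * ENNReal.ofReal (heatKernel (2 * t) y) := by
        refine lintegral_mono fun y => ?_
        rw [← ofReal_norm, ← ENNReal.ofReal_mul (by positivity)]
        exact ENNReal.ofReal_le_ofReal (norm_fderiv_heatKernel_le ht y)
    _ = _ := by
        rw [lintegral_const_mul _ (by fun_prop), lintegral_heatKernel (by positivity), mul_one]

theorem kernelBound_heatKernel_translate_sub {t : ℝ} (ht : 0 < t) (y : E3) :
    KernelBound (fun x => heatKernel t (x - y) - heatKernel t x)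
      (ENNReal.ofReal (6 * t ^ (-(1 / 2) : ℝ)) * ‖y‖ₑ)
      (ENNReal.ofReal (6 * t ^ (-(1 / 2) : ℝ) * t ^ (-(3 / 2) : ℝ)) * ‖y‖ₑ) := by
  refine kernelBound_translate_sub (contDiff_heatKernel t)
    (lintegral_enorm_fderiv_heatKernel_le ht) (fun x => ?_) y
  rw [← ofReal_norm]
  apply ENNReal.ofReal_le_ofReal
  refine (norm_fderiv_heatKernel_le ht x).trans ?_
  gcongr
  refine (heatKernel_le (by positivity) x).trans ?_
  exact Real.rpow_le_rpow_of_nonpos ht (by linarith) (by norm_num)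

/-! ### The gradient of the Oseen kernel -/

theorem abs_apply_le (x : E3) (i : Fin 3) : |x i| ≤ ‖x‖ := by
  simpa using PiLp.norm_apply_le x i

theorem abs_pd_heatKernel_le {t : ℝ} (ht : 0 < t) (k : Fin 3) (x : E3) :
    |pd k (heatKernel t) x| ≤ 6 * t ^ (-(1 / 2) : ℝ) * heatKernel (2 * t) x := by
  refine le_trans ?_ (norm_fderiv_heatKernel_le ht x)
  rw [pd, ← Real.norm_eq_abs]
  refine ((fderiv ℝ (heatKernel t) x).le_opNorm _).trans ?_
  simp

theorem abs_pd_pd_pd_heatKernel_le {t : ℝ} (ht : 0 < t) (i j k : Fin 3) (x : E3) :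
    |pd i (pd j (pd k (heatKernel t))) x| ≤ 57 * t ^ (-(3 / 2) : ℝ) * heatKernel (2 * t) x := by
  have h1 := norm_mul_heatKernel_le ht x
  have h3 := norm_pow_three_mul_heatKernel_le ht x
  have e1 : t ^ (1 / 2 : ℝ) = t ^ (-(3 / 2) : ℝ) * t ^ 2 := by
    rw [← Real.rpow_natCast, ← Real.rpow_add ht]; norm_num
  have e3 : t ^ (3 / 2 : ℝ) = t ^ (-(3 / 2) : ℝ) * t ^ 3 := by
    rw [← Real.rpow_natCast, ← Real.rpow_add ht]; norm_num
  rw [e1] at h1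
  rw [e3] at h3
  have hG := heatKernel_nonneg ht.le x
  have hi := abs_apply_le x i
  have hj := abs_apply_le x j
  have hk := abs_apply_le x k
  have hn := norm_nonneg x
  have b1 : |(if i = j then x k else 0) + (if i = k then x j else 0) + (if j = k then x i else 0)|
      ≤ 3 * ‖x‖ := by
    refine (abs_add_three _ _ _).trans ?_
    have a1 : |if i = j then x k else 0| ≤ ‖x‖ := by split_ifs <;> simp [hk]
    have a2 : |if i = k then x j else 0| ≤ ‖x‖ := by split_ifs <;> simp [hj]
    have a3 : |if j = k then x i else 0| ≤ ‖x‖ := by split_ifs <;> simp [hi]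
    linarith
  have b3 : |x i * x j * x k| ≤ ‖x‖ ^ 3 := by
    rw [abs_mul, abs_mul, show ‖x‖ ^ 3 = ‖x‖ * ‖x‖ * ‖x‖ by ring]
    gcongr
  rw [pd_pd_pd_heatKernel, abs_mul, abs_of_nonneg hG]
  calc _ ≤ (3 * ‖x‖ / (2 * t) ^ 2 + ‖x‖ ^ 3 / (2 * t) ^ 3) * heatKernel t x := by
        gcongr
        refine (abs_sub _ _).trans ?_
        rw [abs_div, abs_div, abs_of_pos (by positivity : 0 < (2 * t) ^ 2),
          abs_of_pos (by positivity : 0 < (2 * t) ^ 3)]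
        gcongr
    _ = 3 * (‖x‖ * heatKernel t x) / (2 * t) ^ 2 + (‖x‖ ^ 3 * heatKernel t x) / (2 * t) ^ 3 := by ring
    _ ≤ 3 * (12 * (t ^ (-(3 / 2) : ℝ) * t ^ 2) * heatKernel (2 * t) x) / (2 * t) ^ 2
        + (384 * (t ^ (-(3 / 2) : ℝ) * t ^ 3) * heatKernel (2 * t) x) / (2 * t) ^ 3 := by gcongr
    _ = _ := by field_simp; ring

theorem measurable_pd_heatKernel (k : Fin 3) :
    Measurable fun z : ℝ × E3 => pd k (heatKernel z.1) z.2 := by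
  have := measurable_heatKernel
  simp only [Function.uncurry_def] at this
  simp only [pd_heatKernel]
  fun_prop

theorem measurable_pd_pd_pd_heatKernel (i j k : Fin 3) :
    Measurable fun z : ℝ × E3 => pd i (pd j (pd k (heatKernel z.1))) z.2 := by
  have := measurable_heatKernel
  simp only [Function.uncurry_def] at this
  simp only [pd_pd_pd_heatKernel]
  split_ifs <;> fun_prop

/-- The domain of integration depends on the parameter; as an indicator on the product space it
becomes part of a jointly measurable integrand. -/
theorem measurable_integral_Ioi {G : ℝ × E3 → ℝ} (hG : Measurable G) :
    Measurable fun z : ℝ × E3 => ∫ s in Ioi z.1, G (s, z.2) := by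
  have h : StronglyMeasurable fun z : (ℝ × E3) × ℝ =>
      ({z | z.1.1 < z.2} : Set ((ℝ × E3) × ℝ)).indicator (fun z => G (z.2, z.1.2)) z := by
    apply Measurable.stronglyMeasurable
    apply Measurable.indicator
    · fun_prop
    · exact measurableSet_lt (by fun_prop) (by fun_prop)
  have h2 := (h.integral_prod_right' (ν := volume)).measurable
  have e : (fun z : ℝ × E3 => ∫ s in Ioi z.1, G (s, z.2)) = fun z => ∫ y,
      ({z | z.1.1 < z.2} : Set ((ℝ × E3) × ℝ)).indicator (fun z => G (z.2, z.1.2)) (z, y) := by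
    ext1 z
    rw [← integral_indicator measurableSet_Ioi]
    rfl
  rwa [e]

theorem measurable_gradOseen (i j k : Fin 3) :
    Measurable fun z : ℝ × E3 => gradOseen i j k z.1 z.2 := by
  unfold gradOseen
  apply Measurable.add
  · split_ifs
    · exact measurable_pd_heatKernel k
    · exact measurable_const
  · exact measurable_integral_Ioi (measurable_pd_pd_pd_heatKernel i j k)

theorem enorm_gradOseen_le {t : ℝ} (ht : 0 < t) (i j k : Fin 3) (x : E3) :
    ‖gradOseen i j k t x‖ₑ ≤ ENNReal.ofReal (6 * t ^ (-(1 / 2) : ℝ) * heatKernel (2 * t) x)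
      + ∫⁻ s in Ioi t, ENNReal.ofReal (57 * s ^ (-(3 / 2) : ℝ) * heatKernel (2 * s) x) := by
  refine (enorm_add_le _ _).trans ?_
  gcongr
  · split_ifs
    · rw [← ofReal_norm]
      exact ENNReal.ofReal_le_ofReal (abs_pd_heatKernel_le ht k x)
    · simp
  · refine (enorm_integral_le_lintegral_enorm _).trans ?_
    refine setLIntegral_mono' measurableSet_Ioi fun s hs => ?_
    rw [← ofReal_norm]
    exact ENNReal.ofReal_le_ofReal (abs_pd_pd_pd_heatKernel_le (ht.trans hs) i j k x)

theorem lintegral_Ioi_rpow {a t : ℝ} (ha : a < -1) (ht : 0 < t) :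
    ∫⁻ s in Ioi t, ENNReal.ofReal (s ^ a) = ENNReal.ofReal (-t ^ (a + 1) / (a + 1)) := by
  rw [← integral_Ioi_rpow_of_lt ha ht, ofReal_integral_eq_lintegral_ofReal]
  · exact integrableOn_Ioi_rpow_of_lt ha ht
  · filter_upwards [ae_restrict_mem measurableSet_Ioi] with s hs
    exact Real.rpow_nonneg (ht.trans hs).le _

/-- Both powers of t are dictated by scaling. The nonlocal part integrates heat kernel bounds over s
> t: in L¹ the tail of s^{-3/2} is 2t^{-1/2}, giving 6 + 57 · 2 = 120, and in L^∞ the tail of s^{-3}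
is t^{-2}/2, giving 6 + 57/2 ≤ 120. -/
theorem kernelBound_gradOseen {t : ℝ} (ht : 0 < t) (i j k : Fin 3) :
    KernelBound (gradOseen i j k t) (ENNReal.ofReal (120 * t ^ (-(1 / 2) : ℝ)))
      (ENNReal.ofReal (120 * t ^ (-2 : ℝ))) where
  measurable := (measurable_gradOseen i j k).comp measurable_prodMk_left
  lintegral_le := by
    have hm := measurable_heatKernel
    simp only [Function.uncurry_def] at hm
    have hm1 : Measurable (heatKernel (2 * t)) := measurable_heatKernel.of_uncurry_left
    calc ∫⁻ x, ‖gradOseen i j k t x‖ₑ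
        ≤ ∫⁻ x, (ENNReal.ofReal (6 * t ^ (-(1 / 2) : ℝ) * heatKernel (2 * t) x)
          + ∫⁻ s in Ioi t, ENNReal.ofReal (57 * s ^ (-(3 / 2) : ℝ) * heatKernel (2 * s) x)) :=
          lintegral_mono (enorm_gradOseen_le ht i j k)
      _ = ENNReal.ofReal (6 * t ^ (-(1 / 2) : ℝ)) + ∫⁻ s in Ioi t, ∫⁻ x,
            ENNReal.ofReal (57 * s ^ (-(3 / 2) : ℝ) * heatKernel (2 * s) x) := by
          rw [lintegral_add_left (by fun_prop), lintegral_lintegral_swap]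
          · congr 1
            have : ∀ x : E3, ENNReal.ofReal (6 * t ^ (-(1 / 2) : ℝ) * heatKernel (2 * t) x) =
                ENNReal.ofReal (6 * t ^ (-(1 / 2) : ℝ)) * ENNReal.ofReal (heatKernel (2 * t) x) :=
              fun x => ENNReal.ofReal_mul (by positivity)
            simp_rw [this]
            rw [lintegral_const_mul _ (by fun_prop), lintegral_heatKernel (by positivity), mul_one]
          · apply Measurable.aemeasurable
            simp only [Function.uncurry_def]
            have : Measurable fun z : E3 × ℝ => heatKernel (2 * z.2) z.1 :=
              hm.comp ((measurable_snd.const_mul 2).prodMk measurable_fst)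
            fun_prop
      _ = ENNReal.ofReal (6 * t ^ (-(1 / 2) : ℝ)) + ENNReal.ofReal 57 *
            ∫⁻ s in Ioi t, ENNReal.ofReal (s ^ (-(3 / 2) : ℝ)) := by
          congr 1
          rw [← lintegral_const_mul _ (by fun_prop)]
          refine setLIntegral_congr_fun measurableSet_Ioi fun s hs => ?_
          have hs' : 0 < s := ht.trans hs
          have hm2 : Measurable (heatKernel (2 * s)) := measurable_heatKernel.of_uncurry_left
          have : ∀ x : E3, ENNReal.ofReal (57 * s ^ (-(3 / 2) : ℝ) * heatKernel (2 * s) x) =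
              ENNReal.ofReal (57 * s ^ (-(3 / 2) : ℝ)) * ENNReal.ofReal (heatKernel (2 * s) x) :=
            fun x => ENNReal.ofReal_mul (by positivity)
          simp only [this]
          rw [lintegral_const_mul _ (by fun_prop), lintegral_heatKernel (by positivity), mul_one,
            ENNReal.ofReal_mul (by norm_num)]
      _ = ENNReal.ofReal (120 * t ^ (-(1 / 2) : ℝ)) := by
          rw [lintegral_Ioi_rpow (by norm_num) ht, ← ENNReal.ofReal_mul (by norm_num),
            ← ENNReal.ofReal_add (by positivity)]
          · congr 1
            norm_num
            ring
          · norm_num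
            positivity
  enorm_le x := by
    have e1 : t ^ (-(1 / 2) : ℝ) * t ^ (-(3 / 2) : ℝ) = t ^ (-2 : ℝ) := by
      rw [← Real.rpow_add ht]; norm_num
    have hle : ∀ s : ℝ, 0 < s → heatKernel (2 * s) x ≤ s ^ (-(3 / 2) : ℝ) := fun s hs =>
      (heatKernel_le (by positivity) x).trans
        (Real.rpow_le_rpow_of_nonpos hs (by linarith) (by norm_num))
    calc ‖gradOseen i j k t x‖ₑ
        ≤ ENNReal.ofReal (6 * t ^ (-(1 / 2) : ℝ) * heatKernel (2 * t) x)
          + ∫⁻ s in Ioi t, ENNReal.ofReal (57 * s ^ (-(3 / 2) : ℝ) * heatKernel (2 * s) x) :=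
          enorm_gradOseen_le ht i j k x
      _ ≤ ENNReal.ofReal (6 * t ^ (-2 : ℝ))
          + ∫⁻ s in Ioi t, ENNReal.ofReal 57 * ENNReal.ofReal (s ^ (-3 : ℝ)) := by
          gcongr ?_ + ?_
          · apply ENNReal.ofReal_le_ofReal
            rw [← e1, mul_assoc]
            gcongr
            exact hle t ht
          · refine setLIntegral_mono' measurableSet_Ioi fun s hs => ?_
            have hs' : 0 < s := ht.trans hs
            rw [← ENNReal.ofReal_mul (by norm_num)]
            apply ENNReal.ofReal_le_ofReal
            rw [mul_assoc]
            gcongr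
            have e3 : s ^ (-3 : ℝ) = s ^ (-(3 / 2) : ℝ) * s ^ (-(3 / 2) : ℝ) := by
              rw [← Real.rpow_add hs']; norm_num
            rw [e3]
            gcongr
            exact hle s hs'
      _ ≤ _ := by
          have h0 : 0 ≤ (t ^ 2)⁻¹ := by positivity
          rw [lintegral_const_mul _ (by fun_prop), lintegral_Ioi_rpow (by norm_num) ht,
            ← ENNReal.ofReal_mul (by norm_num), ← ENNReal.ofReal_add (by positivity)]
          · apply ENNReal.ofReal_le_ofReal
            norm_num
            linarith
          · norm_num
            linarith

/-! ### The kernels of the Littlewood-Paley projections -/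

/-- The convolution kernel of `lowFreq χ J`. -/
def lpKernel (χ : E3 → ℝ) (J : ℤ) (x : E3) : ℝ :=
  (𝓕⁻ (fun ξ : E3 => ((χ ((2 : ℝ) ^ (-J) • ξ) : ℝ) : ℂ)) x).re

theorem lowFreq_eq_conv (χ : E3 → ℝ) (J : ℤ) (f : E3 → E3) :
    lowFreq χ J f = conv (lpKernel χ J) f := rfl

namespace IsLPCutoff

variable {χ : E3 → ℝ}

theorem hasCompactSupport (hχ : IsLPCutoff χ) : HasCompactSupport χ :=
  HasCompactSupport.of_support_subset_isCompact (isCompact_closedBall (0 : E3) 1)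
    ((subset_tsupport χ).trans (hχ.support.trans Metric.ball_subset_closedBall))

theorem hasCompactSupport_symbol (hχ : IsLPCutoff χ) (J : ℤ) :
    HasCompactSupport fun ξ : E3 => ((χ ((2 : ℝ) ^ (-J) • ξ) : ℝ) : ℂ) := by
  have h1 : HasCompactSupport fun ξ : E3 => χ ((2 : ℝ) ^ (-J) • ξ) :=
    hχ.hasCompactSupport.comp_homeomorph (Homeomorph.smulOfNeZero ((2 : ℝ) ^ (-J)) (by positivity))
  exact h1.comp_left (g := fun r : ℝ => (r : ℂ)) Complex.ofReal_zero

theorem contDiff_symbol (hχ : IsLPCutoff χ) (J : ℤ) :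
    ContDiff ℝ ((⊤ : ℕ∞) : WithTop ℕ∞) fun ξ : E3 => ((χ ((2 : ℝ) ^ (-J) • ξ) : ℝ) : ℂ) := by
  have h1 : ContDiff ℝ ((⊤ : ℕ∞) : WithTop ℕ∞) fun ξ : E3 => (2 : ℝ) ^ (-J) • ξ := by fun_prop
  exact Complex.ofRealCLM.contDiff.comp (hχ.smooth.comp h1)

/-- The symbol of `lowFreq χ J` as a Schwartz function. -/
def symbol (hχ : IsLPCutoff χ) (J : ℤ) : SchwartzMap E3 ℂ :=
  (hχ.hasCompactSupport_symbol J).toSchwartzMap (hχ.contDiff_symbol J)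

theorem symbol_apply (hχ : IsLPCutoff χ) (J : ℤ) (ξ : E3) :
    hχ.symbol J ξ = ((χ ((2 : ℝ) ^ (-J) • ξ) : ℝ) : ℂ) := rfl

/-- The kernel of `lowFreq χ J` as a Schwartz function. -/
def kernel (hχ : IsLPCutoff χ) (J : ℤ) : SchwartzMap E3 ℝ :=
  (𝓕⁻ (hχ.symbol J)).postcompCLM Complex.reCLM

theorem coe_kernel (hχ : IsLPCutoff χ) (J : ℤ) : (hχ.kernel J : E3 → ℝ) = lpKernel χ J := by
  ext1 x
  change ((𝓕⁻ (hχ.symbol J)) x).re = _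
  rw [SchwartzMap.fourierInv_coe]
  rfl

/-- The mass of a kernel is its symbol at the origin, here χ(0) = 1, read off from Fourier inversion
for Schwartz functions. -/
theorem integral_kernel (hχ : IsLPCutoff χ) (J : ℤ) : ∫ x, lpKernel χ J x = 1 := by
  have h1 : ∫ x, (𝓕⁻ (hχ.symbol J)) x = 1 := by
    have h2 : 𝓕 (𝓕⁻ (hχ.symbol J)) = hχ.symbol J := FourierTransform.fourier_fourierInv_eq _
    have h3 := congrArg (fun S : SchwartzMap E3 ℂ => S 0) h2
    rw [SchwartzMap.fourier_coe, Real.fourier_eq, symbol_apply, smul_zero,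
      hχ.eq_one 0 (by simp)] at h3
    simpa using h3
  rw [← hχ.coe_kernel]
  change ∫ x, RCLike.re ((𝓕⁻ (hχ.symbol J)) x) = 1
  rw [integral_re (SchwartzMap.integrable _), h1]
  simp

theorem lpKernel_scaling (χ : E3 → ℝ) (J : ℤ) (x : E3) :
    lpKernel χ J x = ((2 : ℝ) ^ J) ^ 3 * lpKernel χ 0 ((2 : ℝ) ^ J • x) := by
  have h2 : (2 : ℝ) ^ J ≠ 0 := by positivity
  have h := Measure.integral_comp_smul (volume : Measure E3)
    (fun v : E3 => Real.fourierChar (inner ℝ v ((2 : ℝ) ^ J • x)) • ((χ v : ℝ) : ℂ)) ((2 : ℝ) ^ (-J))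
  have e : 𝓕⁻ (fun ξ : E3 => ((χ ((2 : ℝ) ^ (-J) • ξ) : ℝ) : ℂ)) x =
      ((((2 : ℝ) ^ J) ^ 3 : ℝ) : ℂ) * 𝓕⁻ (fun ξ : E3 => ((χ ξ : ℝ) : ℂ)) ((2 : ℝ) ^ J • x) := by
    rw [Real.fourierInv_eq, Real.fourierInv_eq, ← Complex.real_smul]
    convert h using 1
    · congr 1
      ext1 v
      rw [real_inner_smul_left, real_inner_smul_right, ← mul_assoc, zpow_neg, inv_mul_cancel₀ h2,
        one_mul]
    · congr 1
      rw [finrank_euclideanSpace, Fintype.card_fin, zpow_neg, inv_pow, inv_inv,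
        abs_of_pos (by positivity)]
  rw [lpKernel, e, Complex.re_ofReal_mul, lpKernel]
  simp

theorem lintegral_comp_smul_eq {f : E3 → ℝ} (hf : Integrable f) (J : ℤ) :
    ∫⁻ x, ‖((2 : ℝ) ^ J) ^ 3 * f ((2 : ℝ) ^ J • x)‖ₑ = ENNReal.ofReal (∫ x, ‖f x‖) := by
  have h2 : (2 : ℝ) ^ J ≠ 0 := by positivity
  have h3 : Integrable fun x => ((2 : ℝ) ^ J) ^ 3 * f ((2 : ℝ) ^ J • x) :=
    ((integrable_comp_smul_iff volume f h2).2 hf).const_mul _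
  rw [← ofReal_integral_norm_eq_lintegral_enorm h3]
  congr 1
  simp only [norm_mul]
  rw [integral_const_mul, Measure.integral_comp_smul volume (fun x => ‖f x‖),
    finrank_euclideanSpace, Fintype.card_fin, abs_of_pos (by positivity),
    Real.norm_of_nonneg (by positivity), smul_eq_mul, ← mul_assoc, mul_inv_cancel₀ (by positivity),
    one_mul]

/-- Scale invariant bounds for the Littlewood-Paley kernels. -/
theorem exists_kernelBound (hχ : IsLPCutoff χ) : ∃ N : ℝ, 1 ≤ N ∧ ∀ J : ℤ,
    KernelBound (lpKernel χ J) (ENNReal.ofReal N) (ENNReal.ofReal (N * ((2 : ℝ) ^ J) ^ 3)) ∧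
    ∫⁻ y, ‖lpKernel χ J y‖ₑ * ‖y‖ₑ ≤ ENNReal.ofReal (N * ((2 : ℝ) ^ J)⁻¹) := by
  have i0 : Integrable (lpKernel χ 0) := by
    rw [← hχ.coe_kernel]; exact SchwartzMap.integrable _
  have i1 : Integrable fun x => ‖x‖ * lpKernel χ 0 x := by
    have := SchwartzMap.integrable_pow_mul volume (hχ.kernel 0) 1
    rw [hχ.coe_kernel] at this
    simp only [pow_one] at this
    refine this.mono ?_ (ae_of_all _ fun x => by simp)
    exact (continuous_norm.mul (by rw [← hχ.coe_kernel]; exact SchwartzMap.continuous _)).aestronglyMeasurable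
  obtain ⟨S, hS0, hS⟩ : ∃ S : ℝ, 0 ≤ S ∧ ∀ x, ‖lpKernel χ 0 x‖ ≤ S :=
    ⟨_, apply_nonneg _ _, fun x => by
      rw [← hχ.coe_kernel]; exact SchwartzMap.norm_le_seminorm ℝ (hχ.kernel 0) x⟩
  set I0 := ∫ x, ‖lpKernel χ 0 x‖ with hI0
  set I1 := ∫ x, ‖‖x‖ * lpKernel χ 0 x‖ with hI1
  have p0 : 0 ≤ I0 := integral_nonneg fun x => norm_nonneg _
  have p1 : 0 ≤ I1 := integral_nonneg fun x => norm_nonneg _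
  refine ⟨1 + I0 + I1 + S, by linarith, fun J => ⟨⟨?_, ?_, fun x => ?_⟩, ?_⟩⟩
  · rw [← hχ.coe_kernel]; exact (SchwartzMap.continuous _).measurable
  · simp_rw [lpKernel_scaling χ J]
    rw [lintegral_comp_smul_eq i0]
    exact ENNReal.ofReal_le_ofReal (by linarith)
  · rw [lpKernel_scaling χ J, ← ofReal_norm, norm_mul, Real.norm_of_nonneg (by positivity), mul_comm]
    apply ENNReal.ofReal_le_ofReal
    gcongr
    exact (hS _).trans (by linarith)
  · have e : ∀ y : E3, ‖lpKernel χ J y‖ₑ * ‖y‖ₑ = ENNReal.ofReal ((2 : ℝ) ^ J)⁻¹ *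
        ‖((2 : ℝ) ^ J) ^ 3 * (‖(2 : ℝ) ^ J • y‖ * lpKernel χ 0 ((2 : ℝ) ^ J • y))‖ₑ := by
      intro y
      rw [lpKernel_scaling χ J, ← ofReal_norm, ← ofReal_norm, ← ofReal_norm,
        ← ENNReal.ofReal_mul (by positivity), ← ENNReal.ofReal_mul (by positivity)]
      congr 1
      simp only [norm_mul, norm_smul, norm_norm]
      rw [Real.norm_of_nonneg (by positivity : 0 ≤ ((2 : ℝ) ^ J) ^ 3),
        Real.norm_of_nonneg (by positivity : 0 ≤ (2 : ℝ) ^ J)]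
      field_simp
    have hm : Measurable fun y : E3 =>
        ‖((2 : ℝ) ^ J) ^ 3 * (‖(2 : ℝ) ^ J • y‖ * lpKernel χ 0 ((2 : ℝ) ^ J • y))‖ₑ := by
      have : Measurable (lpKernel χ 0) := by
        rw [← hχ.coe_kernel]; exact (SchwartzMap.continuous _).measurable
      fun_prop
    simp_rw [e]
    rw [lintegral_const_mul _ hm, lintegral_comp_smul_eq (f := fun x => ‖x‖ * lpKernel χ 0 x) i1,
      ← ENNReal.ofReal_mul (by positivity), mul_comm]
    apply ENNReal.ofReal_le_ofReal
    gcongr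
    linarith

theorem contDiff_kernel (hχ : IsLPCutoff χ) (J : ℤ) :
    ContDiff ℝ ((⊤ : ℕ∞) : WithTop ℕ∞) (lpKernel χ J) := by
  rw [← hχ.coe_kernel]
  exact SchwartzMap.smooth _ _

theorem exists_fderiv_kernel_bound (hχ : IsLPCutoff χ) (J : ℤ) : ∃ C : ℝ≥0∞, C ≠ ∞ ∧
    ∫⁻ x, ‖fderiv ℝ (lpKernel χ J) x‖ₑ ≤ C ∧ ∀ x, ‖fderiv ℝ (lpKernel χ J) x‖ₑ ≤ C := by
  set S := SchwartzMap.fderivCLM ℝ E3 ℝ (hχ.kernel J) with hS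
  have e : ∀ x, fderiv ℝ (lpKernel χ J) x = S x := by
    intro x
    rw [hS, SchwartzMap.fderivCLM_apply, hχ.coe_kernel]
  simp_rw [e]
  refine ⟨(∫⁻ x, ‖S x‖ₑ) + ENNReal.ofReal (SchwartzMap.seminorm ℝ 0 0 S), ?_, le_self_add, ?_⟩
  · exact ENNReal.add_ne_top.2 ⟨(SchwartzMap.integrable S).2.ne, ENNReal.ofReal_ne_top⟩
  · intro x
    refine le_trans ?_ le_add_self
    rw [← ofReal_norm]
    exact ENNReal.ofReal_le_ofReal (SchwartzMap.norm_le_seminorm ℝ S x)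

/-- The symbols satisfy this identity by definition; membership of f in L^q makes both convolutions
converge separately. -/
theorem dyadicBlock_eq (hχ : IsLPCutoff χ) (j : ℤ) {f : E3 → E3} (hf : Measurable f) {q : ℝ≥0∞}
    (hq : 1 ≤ q) (hfq : eLpNorm f q volume ≠ ∞) :
    dyadicBlock χ j f = lowFreq χ (j + 1) f - lowFreq χ j f := by
  obtain ⟨N, -, hN⟩ := hχ.exists_kernelBound
  rw [lowFreq_eq_conv, lowFreq_eq_conv, ← (hN (j + 1)).1.sub_conv ENNReal.ofReal_ne_top
    ENNReal.ofReal_ne_top (hN j).1 ENNReal.ofReal_ne_top ENNReal.ofReal_ne_top hf hq hfq]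
  have e : (fun ξ : E3 => ((lpPhi χ ((2 : ℝ) ^ (-j) • ξ) : ℝ) : ℂ)) =
      (hχ.symbol (j + 1) - hχ.symbol j : SchwartzMap E3 ℂ) := by
    ext1 ξ
    rw [sub_apply, symbol_apply, symbol_apply, lpPhi, smul_smul]
    have : (2 : ℝ)⁻¹ * 2 ^ (-j) = 2 ^ (-(j + 1)) := by
      rw [neg_add, zpow_add₀ (by norm_num), zpow_neg_one, mul_comm]
    rw [this]
    push_cast
    rfl
  ext1 x
  simp only [dyadicBlock, fourierMult, conv]
  rw [e, ← SchwartzMap.fourierInv_coe, sub_eq_add_neg, FourierInvAdd.fourierInv_add,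
    FourierTransform.fourierInv_neg, ← sub_eq_add_neg]
  congr 1
  ext1 y
  rw [Pi.sub_apply, ← hχ.coe_kernel, ← hχ.coe_kernel]
  rfl

/-- The blocks telescope. Block J' is included, so the upper projection has index J' + 1; the case J
= J' + 1 is the empty band that starts the induction. -/
theorem bandFreq_eq (hχ : IsLPCutoff χ) {J J' : ℤ} (hJ : J ≤ J' + 1) {f : E3 → E3}
    (hf : Measurable f) {q : ℝ≥0∞} (hq : 1 ≤ q) (hfq : eLpNorm f q volume ≠ ∞) :
    bandFreq χ J J' f = lowFreq χ (J' + 1) f - lowFreq χ J f := by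
  obtain ⟨n, hn⟩ : ∃ n : ℕ, J' + 1 = J + n := ⟨(J' + 1 - J).toNat, by omega⟩
  induction n generalizing J' with
  | zero =>
    have h1 : J' + 1 = J := by simpa using hn
    have : Finset.Icc J J' = ∅ := Finset.Icc_eq_empty (by omega)
    simp [bandFreq, this, h1]
  | succ n ih =>
    have h1 := ih (J' := J' - 1) (by push_cast at hn; omega) (by push_cast at hn; omega)
    rw [sub_add_cancel] at h1
    have h2 : Finset.Icc J J' = insert J' (Finset.Icc J (J' - 1)) := by
      ext a
      simp only [Finset.mem_Icc, Finset.mem_insert]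
      push_cast at hn
      omega
    rw [bandFreq] at h1
    rw [bandFreq, h2, Finset.sum_insert (by simp), h1, hχ.dyadicBlock_eq J' hf hq hfq]
    abel

end IsLPCutoff

/-! ### The bilinear term -/

theorem measurable_comp_uncurry {α β γ δ : Type*} [MeasurableSpace α] [MeasurableSpace β]
    [MeasurableSpace γ] [MeasurableSpace δ] (K : β → γ → δ) (hK : Measurable (Function.uncurry K))
    {a : α → β} {b : α → γ} (ha : Measurable a) (hb : Measurable b) :
    Measurable fun z => K (a z) (b z) :=
  hK.comp (ha.prodMk hb)

/-- A majorant of all components of the gradient of the Oseen kernel. -/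
def oseenSum (t : ℝ) (x : E3) : ℝ≥0∞ := ∑ i, ∑ j, ∑ k, ‖gradOseen i j k t x‖ₑ

theorem measurable_oseenSum : Measurable (Function.uncurry oseenSum) := by
  simp only [Function.uncurry_def, oseenSum]
  have := measurable_gradOseen
  refine Finset.measurable_sum _ fun i _ => Finset.measurable_sum _ fun j _ =>
    Finset.measurable_sum _ fun k _ => (this i j k).enorm

/-- Here 3240 = 27 · 120, one summand for each triple of indices. -/
theorem lintegral_oseenSum_le {t : ℝ} (ht : 0 < t) :
    ∫⁻ x, oseenSum t x ≤ ENNReal.ofReal (3240 * t ^ (-(1 / 2) : ℝ)) := by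
  have hb := kernelBound_gradOseen ht
  have e : ENNReal.ofReal (3240 * t ^ (-(1 / 2) : ℝ)) =
      ∑ _i : Fin 3, ∑ _j : Fin 3, ∑ _k : Fin 3, ENNReal.ofReal (120 * t ^ (-(1 / 2) : ℝ)) := by
    simp only [Finset.sum_const, Finset.card_univ, Fintype.card_fin, nsmul_eq_mul]
    rw [show (3240 : ℝ) * t ^ (-(1 / 2) : ℝ) = 27 * (120 * t ^ (-(1 / 2) : ℝ)) by ring,
      ENNReal.ofReal_mul (by norm_num), ← mul_assoc, ← mul_assoc]
    norm_num
  rw [e]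
  unfold oseenSum
  have hm := fun i j k => (hb i j k).measurable.enorm
  rw [lintegral_finsetSum _ fun i _ => by fun_prop]
  refine Finset.sum_le_sum fun i _ => ?_
  rw [lintegral_finsetSum _ fun i _ => by fun_prop]
  refine Finset.sum_le_sum fun j _ => ?_
  rw [lintegral_finsetSum _ fun i _ => by fun_prop]
  exact Finset.sum_le_sum fun k _ => (hb i j k).lintegral_le

theorem oseenSum_le {t : ℝ} (ht : 0 < t) (x : E3) :
    oseenSum t x ≤ ENNReal.ofReal (3240 * t ^ (-2 : ℝ)) := by
  have hb := kernelBound_gradOseen ht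
  have e : ENNReal.ofReal (3240 * t ^ (-2 : ℝ)) =
      ∑ _i : Fin 3, ∑ _j : Fin 3, ∑ _k : Fin 3, ENNReal.ofReal (120 * t ^ (-2 : ℝ)) := by
    simp only [Finset.sum_const, Finset.card_univ, Fintype.card_fin, nsmul_eq_mul]
    rw [show (3240 : ℝ) * t ^ (-2 : ℝ) = 27 * (120 * t ^ (-2 : ℝ)) by ring,
      ENNReal.ofReal_mul (by norm_num), ← mul_assoc, ← mul_assoc]
    norm_num
  rw [e]
  exact Finset.sum_le_sum fun i _ => Finset.sum_le_sum fun j _ => Finset.sum_le_sum fun k _ =>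
    (hb i j k).enorm_le x

/-- The space-time convolution of the majorant of the Oseen kernel with `g`. -/
def oseenMajorant (g : ℝ → E3 → ℝ≥0∞) (τ : ℝ) (x : E3) : ℝ≥0∞ :=
  ∫⁻ s in Ioo 0 τ, lconv (oseenSum (τ - s)) (g s) x

theorem inv_toReal_sub_nonneg {m p : ℝ≥0∞} (hm : 1 ≤ m) (hmp : m ≤ p) :
    0 ≤ m⁻¹.toReal - p⁻¹.toReal := by
  rw [sub_nonneg]
  exact ENNReal.toReal_mono (ENNReal.inv_ne_top.2 (zero_lt_one.trans_le hm).ne')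
    (ENNReal.inv_le_inv.2 hmp)

theorem inv_toReal_sub_le_one {m p : ℝ≥0∞} (hm : 1 ≤ m) : m⁻¹.toReal - p⁻¹.toReal ≤ 1 := by
  have h1 := KernelBound.inv_toReal_le_one hm
  have h2 : 0 ≤ p⁻¹.toReal := ENNReal.toReal_nonneg
  linarith

theorem ofReal_rpow_interpolate {c r a b θ : ℝ} (hc : 0 < c) (hr : 0 < r) (h0 : 0 ≤ θ)
    (h1 : θ ≤ 1) : ENNReal.ofReal (c * r ^ a) ^ (1 - θ) * ENNReal.ofReal (c * r ^ b) ^ θ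
      = ENNReal.ofReal (c * r ^ (a * (1 - θ) + b * θ)) := by
  rw [ENNReal.ofReal_rpow_of_nonneg (by positivity) (by linarith),
    ENNReal.ofReal_rpow_of_nonneg (by positivity) h0, ← ENNReal.ofReal_mul (by positivity),
    Real.mul_rpow hc.le (by positivity), Real.mul_rpow hc.le (by positivity), ← Real.rpow_mul hr.le,
    ← Real.rpow_mul hr.le, Real.rpow_add hr]
  have : c ^ (1 - θ) * c ^ θ = c := by rw [← Real.rpow_add hc]; simp
  congr 1
  calc _ = (c ^ (1 - θ) * c ^ θ) * (r ^ (a * (1 - θ)) * r ^ (b * θ)) := by ring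
    _ = _ := by rw [this]

/-- Minkowski's inequality in s reduces to Young's inequality from L^m to L^p at each time. With θ =
1/m - 1/p, interpolating between t^{-1/2} and t^{-2} gives the power -(1-θ)/2 - 2θ = -1/2 - 3θ/2. -/
theorem eLpNorm_oseenMajorant_le {g : ℝ → E3 → ℝ≥0∞} (hg : Measurable (Function.uncurry g)) {τ : ℝ}
    {m p : ℝ≥0∞} (hm : 1 ≤ m) (hmp : m ≤ p) {ψ : ℝ → ℝ≥0∞} (hψ : Measurable ψ)
    (h : ∀ s ∈ Ioo 0 τ, eLpNorm (g s) m volume ≤ ψ s) :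
    eLpNorm (oseenMajorant g τ) p volume ≤ ∫⁻ s in Ioo 0 τ,
      ENNReal.ofReal (3240 * (τ - s) ^ (-(1 / 2) - 3 / 2 * (m⁻¹.toReal - p⁻¹.toReal))) * ψ s := by
  refine eLpNorm_lintegral_le ?_ (by fun_prop) (hm.trans hmp) ?_
  · have : Measurable fun z : (ℝ × E3) × E3 => oseenSum (τ - z.1.1) (z.1.2 - z.2) * g z.1.1 z.2 := by
      refine Measurable.mul ?_ ?_
      · exact measurable_comp_uncurry oseenSum measurable_oseenSum (by fun_prop) (by fun_prop)
      · exact measurable_comp_uncurry g hg (by fun_prop) (by fun_prop)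
    exact this.lintegral_prod_right'
  · filter_upwards [ae_restrict_mem measurableSet_Ioo] with s hs
    have hr : 0 < τ - s := sub_pos.2 hs.2
    have h1 := eLpNorm_lconv_le (K := oseenSum (τ - s)) (f := g s) measurable_oseenSum.of_uncurry_left
      hg.of_uncurry_left (lintegral_oseenSum_le hr) (oseenSum_le hr) hm hmp
    rw [ofReal_rpow_interpolate (by norm_num) hr (inv_toReal_sub_nonneg hm hmp)
      (inv_toReal_sub_le_one hm)] at h1
    refine h1.trans ?_
    have e : -(1 / 2) * (1 - (m⁻¹.toReal - p⁻¹.toReal)) + -2 * (m⁻¹.toReal - p⁻¹.toReal)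
        = -(1 / 2) - 3 / 2 * (m⁻¹.toReal - p⁻¹.toReal) := by ring
    rw [e]
    gcongr
    exact h s hs

theorem enorm_le_sum_enorm (x : E3) : ‖x‖ₑ ≤ ∑ i, ‖x i‖ₑ := by
  have h : ‖x‖ ≤ ∑ i, ‖x i‖ := by
    rw [EuclideanSpace.norm_eq]
    refine Real.sqrt_le_iff.2 ⟨Finset.sum_nonneg fun i _ => norm_nonneg _, ?_⟩
    simp only [Fin.sum_univ_three]
    nlinarith [norm_nonneg (x 0), norm_nonneg (x 1), norm_nonneg (x 2),
      mul_nonneg (norm_nonneg (x 0)) (norm_nonneg (x 1)),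
      mul_nonneg (norm_nonneg (x 0)) (norm_nonneg (x 2)),
      mul_nonneg (norm_nonneg (x 1)) (norm_nonneg (x 2))]
  rw [← ofReal_norm]
  refine (ENNReal.ofReal_le_ofReal h).trans (le_of_eq ?_)
  rw [ENNReal.ofReal_sum_of_nonneg fun i _ => norm_nonneg _]
  simp only [ofReal_norm]

/-- The tensor H is left free so that the same bound serves u ⊗ u and the difference u ⊗ u - v ⊗ v.
-/
theorem enorm_oseen_integral_le {H : Fin 3 → Fin 3 → ℝ × E3 → ℝ} {g : ℝ → E3 → ℝ≥0∞}
    (hg : Measurable (Function.uncurry g)) (hH : ∀ j k z, ‖H j k z‖ₑ ≤ g z.1 z.2) {τ : ℝ} (x : E3) {V : E3}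
    (hV : ∀ i, V i = ∫ z : ℝ × E3, ∑ j, ∑ k, gradOseen i j k (τ - z.1) (x - z.2) * H j k z
      ∂(volume.restrict (Ioo (0 : ℝ) τ)).prod volume) :
    ‖V‖ₑ ≤ oseenMajorant g τ x := by
  have hG : ∀ i j k, Measurable fun z : ℝ × E3 => gradOseen i j k (τ - z.1) (x - z.2) :=
    fun i j k => measurable_comp_uncurry (gradOseen i j k) (measurable_gradOseen i j k)
      (by fun_prop) (by fun_prop)
  have hg' : Measurable fun z : ℝ × E3 => g z.1 z.2 := hg
  calc ‖V‖ₑ ≤ ∑ i, ‖V i‖ₑ := enorm_le_sum_enorm V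
    _ ≤ ∑ i, ∫⁻ z : ℝ × E3, ∑ j, ∑ k, ‖gradOseen i j k (τ - z.1) (x - z.2)‖ₑ * g z.1 z.2
          ∂(volume.restrict (Ioo (0 : ℝ) τ)).prod volume := by
        refine Finset.sum_le_sum fun i _ => ?_
        rw [hV i]
        refine (enorm_integral_le_lintegral_enorm _).trans (lintegral_mono fun z => ?_)
        refine (enorm_sum_le _ _).trans (Finset.sum_le_sum fun j _ => ?_)
        refine (enorm_sum_le _ _).trans (Finset.sum_le_sum fun k _ => ?_)
        rw [enorm_mul]
        gcongr
        exact hH j k z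
    _ = ∫⁻ z : ℝ × E3, oseenSum (τ - z.1) (x - z.2) * g z.1 z.2
          ∂(volume.restrict (Ioo (0 : ℝ) τ)).prod volume := by
        rw [← lintegral_finsetSum _ fun i _ => by
          refine Finset.measurable_sum _ fun j _ => Finset.measurable_sum _ fun k _ => ?_
          exact (hG i j k).enorm.mul hg']
        refine lintegral_congr fun z => ?_
        simp only [oseenSum, Finset.sum_mul]
    _ = _ := by
        rw [lintegral_prod]
        · rfl
        · apply Measurable.aemeasurable
          refine Measurable.mul ?_ hg'
          exact measurable_comp_uncurry oseenSum measurable_oseenSum (by fun_prop) (by fun_prop)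

namespace IsMildSolution

variable {u v : ℝ → E3 → E3} {u₀ v₀ : 𝓓'((⊤ : TopologicalSpace.Opens E3), E3)}

theorem measurable_apply (hu : IsMildSolution u u₀) (t : ℝ) : Measurable (u t) :=
  hu.measurable.of_uncurry_left

/-- Absolute convergence turns the iterated integral into one over space-time, where two Duhamel
terms can be subtracted under a single integral sign. -/
theorem duhamel_apply (hu : IsMildSolution u u₀) {t τ : ℝ} (ht : 0 < t) (hτ : 0 < τ) :
    ∀ᵐ x, ∀ i, duhamel u t τ x i = ∫ z : ℝ × E3, ∑ j, ∑ k,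
      gradOseen i j k (τ - z.1) (x - z.2) * (u (t + z.1) z.2 j * u (t + z.1) z.2 k)
      ∂(volume.restrict (Ioo (0 : ℝ) τ)).prod volume := by
  have h := fun i j k => hu.integrable_duhamel t ht τ hτ i j k
  simp only [← ae_all_iff] at h
  filter_upwards [h] with x hx i
  rw [integral_prod _ (integrable_finsetSum _ fun j _ => integrable_finsetSum _ fun k _ => hx i j k),
    duhamel]
  simp only
  rw [intervalIntegral.integral_of_le hτ.le, integral_Ioc_eq_integral_Ioo]

theorem heatFlow_sub_ae (hu : IsMildSolution u u₀) {t τ : ℝ} (ht : 0 < t) (hτ : 0 < τ) :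
    ∀ᵐ x, heatFlow τ (u t) x - u (t + τ) x = duhamel u t τ x := by
  filter_upwards [hu.mild t ht τ hτ] with x hx
  rw [hx]; abel

theorem enorm_heatFlow_sub_le (hu : IsMildSolution u u₀) {t τ : ℝ} (ht : 0 < t) (hτ : 0 < τ) :
    ∀ᵐ x, ‖heatFlow τ (u t) x - u (t + τ) x‖ₑ ≤
      oseenMajorant (fun s y => ‖u (t + s) y‖ₑ * ‖u (t + s) y‖ₑ) τ x := by
  have hm : Measurable fun z : ℝ × E3 => u (t + z.1) z.2 :=
    hu.measurable.comp ((measurable_const.add measurable_fst).prodMk measurable_snd)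
  filter_upwards [hu.heatFlow_sub_ae ht hτ, hu.duhamel_apply ht hτ] with x h1 h2
  rw [h1]
  refine enorm_oseen_integral_le (H := fun j k z => u (t + z.1) z.2 j * u (t + z.1) z.2 k) ?_
    (fun j k z => ?_) x h2
  · exact hm.enorm.mul hm.enorm
  · rw [enorm_mul]
    gcongr <;> exact PiLp.enorm_apply_le _ _

theorem enorm_heatFlow_sub_sub_le (hu : IsMildSolution u u₀) (hv : IsMildSolution v v₀) {t τ : ℝ}
    (ht : 0 < t) (hτ : 0 < τ) :
    ∀ᵐ x, ‖heatFlow τ (u t - v t) x - (u (t + τ) - v (t + τ)) x‖ₑ ≤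
      oseenMajorant (fun s y => ‖(u (t + s) - v (t + s)) y‖ₑ *
        (‖u (t + s) y‖ₑ + ‖v (t + s) y‖ₑ)) τ x := by
  have hmu : Measurable fun z : ℝ × E3 => u (t + z.1) z.2 :=
    hu.measurable.comp ((measurable_const.add measurable_fst).prodMk measurable_snd)
  have hmv : Measurable fun z : ℝ × E3 => v (t + z.1) z.2 :=
    hv.measurable.comp ((measurable_const.add measurable_fst).prodMk measurable_snd)
  have i1 := fun i j k => hu.integrable_duhamel t ht τ hτ i j k
  have i2 := fun i j k => hv.integrable_duhamel t ht τ hτ i j k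
  simp only [← ae_all_iff] at i1 i2
  filter_upwards [hu.heatFlow_sub_ae ht hτ, hu.duhamel_apply ht hτ, hv.heatFlow_sub_ae ht hτ,
    hv.duhamel_apply ht hτ, hu.integrable_heat t ht τ hτ, hv.integrable_heat t ht τ hτ, i1, i2]
    with x a1 a2 b1 b2 c1 c2 d1 d2
  have e1 : heatFlow τ (u t - v t) x = heatFlow τ (u t) x - heatFlow τ (v t) x := by
    simp only [heatFlow, Pi.sub_apply, smul_sub]
    exact integral_sub c1 c2
  have e2 : heatFlow τ (u t - v t) x - (u (t + τ) - v (t + τ)) x =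
      duhamel u t τ x - duhamel v t τ x := by
    rw [← a1, ← b1, e1, Pi.sub_apply]; abel
  rw [e2]
  refine enorm_oseen_integral_le (H := fun j k z => u (t + z.1) z.2 j * u (t + z.1) z.2 k -
    v (t + z.1) z.2 j * v (t + z.1) z.2 k) ?_ (fun j k z => ?_) x fun i => ?_
  · exact (hmu.sub hmv).enorm.mul (hmu.enorm.add hmv.enorm)
  · simp only [Pi.sub_apply]
    set a := u (t + z.1) z.2
    set b := v (t + z.1) z.2
    -- Polarisation: the difference of the quadratic terms is linear in the error.
    have e : a j * a k - b j * b k = a j * (a - b) k + (a - b) j * b k := by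
      simp only [PiLp.sub_apply]; ring
    rw [e, mul_add]
    refine (enorm_add_le _ _).trans ?_
    rw [enorm_mul, enorm_mul, mul_comm ‖a j‖ₑ]
    gcongr <;> exact PiLp.enorm_apply_le _ _
  · rw [PiLp.sub_apply, a2 i, b2 i, ← integral_sub]
    · simp only [← Finset.sum_sub_distrib, mul_sub]
    · exact integrable_finsetSum _ fun j _ => integrable_finsetSum _ fun k _ => d1 i j k
    · exact integrable_finsetSum _ fun j _ => integrable_finsetSum _ fun k _ => d2 i j k

/-- The `L^p` estimate of the Duhamel term of a difference of mild solutions. -/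
theorem eLpNorm_heatFlow_sub_sub_le (hu : IsMildSolution u u₀) (hv : IsMildSolution v v₀) {t τ : ℝ}
    (ht : 0 < t) (hτ : 0 < τ) {m p : ℝ≥0∞} (hm : 1 ≤ m) (hmp : m ≤ p) {ψ : ℝ → ℝ≥0∞}
    (hψ : Measurable ψ) (h : ∀ s ∈ Ioo 0 τ, eLpNorm (fun y => ‖(u (t + s) - v (t + s)) y‖ₑ *
        (‖u (t + s) y‖ₑ + ‖v (t + s) y‖ₑ)) m volume ≤ ψ s) :
    eLpNorm (heatFlow τ (u t - v t) - (u (t + τ) - v (t + τ))) p volume ≤ ∫⁻ s in Ioo 0 τ,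
      ENNReal.ofReal (3240 * (τ - s) ^ (-(1 / 2) - 3 / 2 * (m⁻¹.toReal - p⁻¹.toReal))) * ψ s := by
  have hmu : Measurable fun z : ℝ × E3 => u (t + z.1) z.2 :=
    hu.measurable.comp ((measurable_const.add measurable_fst).prodMk measurable_snd)
  have hmv : Measurable fun z : ℝ × E3 => v (t + z.1) z.2 :=
    hv.measurable.comp ((measurable_const.add measurable_fst).prodMk measurable_snd)
  refine le_trans (eLpNorm_mono_enorm_ae ?_) (eLpNorm_oseenMajorant_le
    (g := fun s y => ‖(u (t + s) - v (t + s)) y‖ₑ * (‖u (t + s) y‖ₑ + ‖v (t + s) y‖ₑ))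
    ((hmu.sub hmv).enorm.mul (hmu.enorm.add hmv.enorm)) hm hmp hψ h)
  simpa using hu.enorm_heatFlow_sub_sub_le hv ht hτ

/-- The `L^p` estimate of the Duhamel term of a mild solution. -/
theorem eLpNorm_heatFlow_sub_le (hu : IsMildSolution u u₀) {t τ : ℝ}
    (ht : 0 < t) (hτ : 0 < τ) {m p : ℝ≥0∞} (hm : 1 ≤ m) (hmp : m ≤ p) {ψ : ℝ → ℝ≥0∞}
    (hψ : Measurable ψ) (h : ∀ s ∈ Ioo 0 τ,
      eLpNorm (fun y => ‖u (t + s) y‖ₑ * ‖u (t + s) y‖ₑ) m volume ≤ ψ s) :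
    eLpNorm (heatFlow τ (u t) - u (t + τ)) p volume ≤ ∫⁻ s in Ioo 0 τ,
      ENNReal.ofReal (3240 * (τ - s) ^ (-(1 / 2) - 3 / 2 * (m⁻¹.toReal - p⁻¹.toReal))) * ψ s := by
  have hmu : Measurable fun z : ℝ × E3 => u (t + z.1) z.2 :=
    hu.measurable.comp ((measurable_const.add measurable_fst).prodMk measurable_snd)
  refine le_trans (eLpNorm_mono_enorm_ae ?_) (eLpNorm_oseenMajorant_le
    (g := fun s y => ‖u (t + s) y‖ₑ * ‖u (t + s) y‖ₑ) (hmu.enorm.mul hmu.enorm) hm hmp hψ h)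
  simpa using hu.enorm_heatFlow_sub_le ht hτ

end IsMildSolution

/-! ### Integrals of powers of time -/

theorem lintegral_Ioo_sub_rpow {b : ℝ} (hb : -1 < b) {c τ : ℝ} (hc : c ≤ τ) :
    ∫⁻ s in Ioo c τ, ENNReal.ofReal ((τ - s) ^ b) =
      ENNReal.ofReal ((τ - c) ^ (b + 1) / (b + 1)) := by
  have h0 : IntervalIntegrable (fun s : ℝ => s ^ b) volume (τ - c) 0 :=
    intervalIntegral.intervalIntegrable_rpow' hb
  have h1 : IntervalIntegrable (fun s : ℝ => (τ - s) ^ b) volume c τ := by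
    simpa using h0.comp_sub_left τ
  rw [← ofReal_integral_eq_lintegral_ofReal]
  · rw [← integral_Ioc_eq_integral_Ioo, ← intervalIntegral.integral_of_le hc,
      intervalIntegral.integral_comp_sub_left (fun s : ℝ => s ^ b), integral_rpow (Or.inl hb),
      sub_self, Real.zero_rpow (by linarith), sub_zero]
  · exact ((intervalIntegrable_iff_integrableOn_Ioc_of_le hc).1 h1).mono_set Ioo_subset_Ioc_self
  · filter_upwards [ae_restrict_mem measurableSet_Ioo] with s hs
    exact Real.rpow_nonneg (sub_nonneg.2 hs.2.le) _

theorem lintegral_Ioo_rpow {b : ℝ} (hb : -1 < b) {τ : ℝ} (hτ : 0 ≤ τ) :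
    ∫⁻ s in Ioo 0 τ, ENNReal.ofReal (s ^ b) = ENNReal.ofReal (τ ^ (b + 1) / (b + 1)) := by
  rw [← ofReal_integral_eq_lintegral_ofReal]
  · rw [← integral_Ioc_eq_integral_Ioo, ← intervalIntegral.integral_of_le hτ,
      integral_rpow (Or.inl hb), Real.zero_rpow (by linarith), sub_zero]
  · exact ((intervalIntegrable_iff_integrableOn_Ioc_of_le hτ).1
      (intervalIntegral.intervalIntegrable_rpow' hb)).mono_set Ioo_subset_Ioc_self
  · filter_upwards [ae_restrict_mem measurableSet_Ioo] with s hs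
    exact Real.rpow_nonneg hs.1.le _

/-! ### Hölder's inequality and exponents -/

theorem inv_toReal_lt_third {p : ℝ≥0∞} (hp : 3 < p) : p⁻¹.toReal < 1 / 3 := by
  have h : p⁻¹ < 3⁻¹ := ENNReal.inv_lt_inv.2 hp
  have := ENNReal.toReal_strict_mono (by simp) h
  simpa using this

theorem critExp_pos {p : ℝ≥0∞} (hp : 3 < p) : 0 < critExp p := by
  have := inv_toReal_lt_third hp
  unfold critExp
  linarith

theorem critExp_le_half (p : ℝ≥0∞) : critExp p ≤ 1 / 2 := by
  have : 0 ≤ p⁻¹.toReal := ENNReal.toReal_nonneg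
  unfold critExp
  linarith

theorem two_mul_thetaExp {p : ℝ≥0∞} (hp : 3 < p) : 2 * thetaExp p = -(1 / critExp p) := by
  have h := inv_toReal_lt_third hp
  unfold thetaExp critExp
  have h1 : 3 * p⁻¹.toReal - 1 ≠ 0 := by linarith
  have h2 : 1 / 2 - 3 / 2 * p⁻¹.toReal ≠ 0 := by linarith
  rw [show (1 : ℝ) / 2 - 3 / 2 * p⁻¹.toReal = -(3 * p⁻¹.toReal - 1) / 2 by ring]
  field_simp

theorem one_le_of_three_lt {p : ℝ≥0∞} (hp : 3 < p) : 1 ≤ p := le_trans (by norm_num) hp.le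

/-- The exponent of a product of functions in `L^p` and `L^r`. -/
def prodExp (p r : ℝ≥0∞) : ℝ≥0∞ := (p⁻¹ + r⁻¹)⁻¹

instance (p r : ℝ≥0∞) : ENNReal.HolderTriple p r (prodExp p r) := ⟨by simp [prodExp]⟩

theorem prodExp_le_left (p r : ℝ≥0∞) : prodExp p r ≤ p := by
  rw [prodExp, ENNReal.inv_le_iff_inv_le]
  exact le_self_add

theorem one_le_prodExp {p r : ℝ≥0∞} (hp : 3 < p) (hr : 3 < r) : 1 ≤ prodExp p r := by
  rw [prodExp, ENNReal.one_le_inv]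
  calc p⁻¹ + r⁻¹ ≤ 3⁻¹ + 3⁻¹ := by gcongr
    _ ≤ 2⁻¹ + 2⁻¹ := by gcongr <;> norm_num
    _ = 1 := ENNReal.inv_two_add_inv_two

theorem inv_prodExp_toReal {p r : ℝ≥0∞} (hp : 3 < p) (hr : 3 < r) :
    (prodExp p r)⁻¹.toReal = p⁻¹.toReal + r⁻¹.toReal := by
  rw [prodExp, inv_inv, ENNReal.toReal_add]
  · exact ENNReal.inv_ne_top.2 (lt_trans (by norm_num) hp).ne'
  · exact ENNReal.inv_ne_top.2 (lt_trans (by norm_num) hr).ne'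

theorem eLpNorm_enorm_mul_add_le {f g h : E3 → E3} (hf : Measurable f) (hg : Measurable g)
    (hh : Measurable h) {p r : ℝ≥0∞} (hr : 1 ≤ r) :
    eLpNorm (fun y => ‖f y‖ₑ * (‖g y‖ₑ + ‖h y‖ₑ)) (prodExp p r) volume ≤
      eLpNorm f p volume * (eLpNorm g r volume + eLpNorm h r volume) := by
  have e : (fun y => ‖f y‖ₑ * (‖g y‖ₑ + ‖h y‖ₑ)) =
      fun y => ‖((fun y => ‖f y‖) • fun y => ‖g y‖ + ‖h y‖) y‖ₑ := by
    ext1 y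
    simp only [Pi.smul_apply', enorm_smul, enorm_norm]
    congr 1
    rw [Real.enorm_of_nonneg (by positivity), ENNReal.ofReal_add (norm_nonneg _) (norm_nonneg _),
      ofReal_norm, ofReal_norm]
  rw [e, eLpNorm_enorm]
  have hs : AEStronglyMeasurable (fun y => ‖g y‖ + ‖h y‖) volume :=
    (hg.norm.add hh.norm).aestronglyMeasurable
  refine (eLpNorm_smul_le_mul_eLpNorm (p := p) (q := r) hs hf.norm.aestronglyMeasurable).trans ?_
  rw [eLpNorm_norm]
  gcongr
  refine (eLpNorm_add_le hg.norm.aestronglyMeasurable hh.norm.aestronglyMeasurable hr).trans ?_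
  rw [eLpNorm_norm, eLpNorm_norm]

theorem eLpNorm_enorm_mul_self_le {f : E3 → E3} (hf : Measurable f) {p r : ℝ≥0∞} (hr : 1 ≤ r) :
    eLpNorm (fun y => ‖f y‖ₑ * ‖f y‖ₑ) (prodExp p r) volume ≤
      eLpNorm f p volume * eLpNorm f r volume := by
  have h := eLpNorm_enorm_mul_add_le hf hf (measurable_const (a := (0 : E3))) (p := p) hr
  have e : eLpNorm (fun _ : E3 => (0 : E3)) r volume = 0 := eLpNorm_zero
  rw [e] at h
  simpa using h

/-! ### Short time estimates for mild solutions in `L^p` -/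

/-- The constant in the short time bilinear estimate in `L^p`. -/
def bilinConst (p : ℝ≥0∞) : ℝ := 3240 / critExp p

theorem bilinConst_pos {p : ℝ≥0∞} (hp : 3 < p) : 0 < bilinConst p :=
  div_pos (by norm_num) (critExp_pos hp)

/-- For a product of two L^p functions, in L^{p/2}, the time singularity has exponent `critExp p` -
1, which is integrable precisely because p > 3. -/
theorem oseen_exponent_eq {p : ℝ≥0∞} (hp : 3 < p) :
    -(1 / 2) - 3 / 2 * ((prodExp p p)⁻¹.toReal - p⁻¹.toReal) = critExp p - 1 := by
  rw [inv_prodExp_toReal hp hp, critExp]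
  ring

theorem lintegral_oseen_kernel {p : ℝ≥0∞} (hp : 3 < p) {c τ : ℝ} (hc : c ≤ τ) :
    ∫⁻ s in Ioo c τ, ENNReal.ofReal (3240 * (τ - s) ^ (critExp p - 1)) =
      ENNReal.ofReal (bilinConst p * (τ - c) ^ critExp p) := by
  have ha := critExp_pos hp
  have e : ∀ s, ENNReal.ofReal (3240 * (τ - s) ^ (critExp p - 1)) =
      ENNReal.ofReal 3240 * ENNReal.ofReal ((τ - s) ^ (critExp p - 1)) :=
    fun s => ENNReal.ofReal_mul (by norm_num)
  simp_rw [e]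
  rw [lintegral_const_mul _ (by fun_prop), lintegral_Ioo_sub_rpow (by linarith) hc,
    ← ENNReal.ofReal_mul (by norm_num), sub_add_cancel, bilinConst]
  congr 1
  ring

namespace IsMildSolution

variable {u v : ℝ → E3 → E3} {u₀ v₀ : 𝓓'((⊤ : TopologicalSpace.Opens E3), E3)} {p : ℝ≥0∞}

theorem measurable_sub_apply (hu : IsMildSolution u u₀) (hv : IsMildSolution v v₀) (t : ℝ) :
    Measurable (u t - v t) := (hu.measurable_apply t).sub (hv.measurable_apply t)

/-- Short time estimate with a better bound away from the last part of the time interval. -/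
theorem eLpNorm_heatFlow_sub_le_of_two_bounds (hu : IsMildSolution u u₀) (hp : 3 < p) {t τ h : ℝ}
    (ht : 0 < t) (hτ : 0 < τ) (hh : 0 < h) {B L : ℝ} (hB : 0 ≤ B) (hL : 0 ≤ L)
    (h1 : ∀ s ∈ Ioo 0 τ, s ≤ τ - h → eLpNorm (u (t + s)) p volume ≤ ENNReal.ofReal B)
    (h2 : ∀ s ∈ Ioo 0 τ, eLpNorm (u (t + s)) p volume ≤ ENNReal.ofReal L) :
    eLpNorm (heatFlow τ (u t) - u (t + τ)) p volume ≤
      ENNReal.ofReal (bilinConst p * (τ ^ critExp p * B ^ 2 + h ^ critExp p * L ^ 2)) := by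
  have ha := critExp_pos hp
  have hC := bilinConst_pos hp
  set ψ : ℝ → ℝ≥0∞ := fun s => ENNReal.ofReal (B ^ 2) +
    (Ioi (τ - h)).indicator (fun _ => ENNReal.ofReal (L ^ 2)) s with hψ
  have hψm : Measurable ψ :=
    (measurable_const (a := ENNReal.ofReal (B ^ 2))).add
      ((measurable_const (a := ENNReal.ofReal ((L : ℝ) ^ 2))).indicator
        (measurableSet_Ioi (a := τ - h)))
  have key := hu.eLpNorm_heatFlow_sub_le ht hτ (one_le_prodExp hp hp) (prodExp_le_left p p) hψm
    (fun s hs => by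
      refine (eLpNorm_enorm_mul_self_le (hu.measurable_apply _) (one_le_of_three_lt hp)).trans ?_
      by_cases hsh : s ≤ τ - h
      · calc _ ≤ ENNReal.ofReal B * ENNReal.ofReal B := by gcongr <;> exact h1 s hs hsh
          _ = ENNReal.ofReal (B ^ 2) := by rw [← ENNReal.ofReal_mul hB, sq]
          _ ≤ _ := le_self_add
      · calc _ ≤ ENNReal.ofReal L * ENNReal.ofReal L := by gcongr <;> exact h2 s hs
          _ = ENNReal.ofReal (L ^ 2) := by rw [← ENNReal.ofReal_mul hL, sq]
          _ ≤ _ := by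
            rw [hψ]
            simp only [Set.indicator_of_mem (show s ∈ Ioi (τ - h) from not_le.1 hsh)]
            exact le_add_self)
  rw [oseen_exponent_eq hp] at key
  refine key.trans ?_
  have hm : Measurable fun s : ℝ => ENNReal.ofReal (3240 * (τ - s) ^ (critExp p - 1)) := by fun_prop
  have e1 : ∫⁻ s in Ioo 0 τ, ENNReal.ofReal (3240 * (τ - s) ^ (critExp p - 1)) * ψ s =
      (∫⁻ s in Ioo 0 τ, ENNReal.ofReal (3240 * (τ - s) ^ (critExp p - 1))) * ENNReal.ofReal (B ^ 2) +
      ∫⁻ s in Ioo 0 τ, (Ioi (τ - h)).indicator (fun s =>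
        ENNReal.ofReal (3240 * (τ - s) ^ (critExp p - 1)) * ENNReal.ofReal (L ^ 2)) s := by
    rw [← lintegral_mul_const _ hm, ← lintegral_add_left (hm.mul_const _)]
    refine lintegral_congr fun s => ?_
    simp only [hψ, mul_add]
    congr 1
    by_cases hs : s ∈ Ioi (τ - h) <;> simp [hs]
  have e2 : ∫⁻ s in Ioo 0 τ, (Ioi (τ - h)).indicator (fun s =>
        ENNReal.ofReal (3240 * (τ - s) ^ (critExp p - 1)) * ENNReal.ofReal (L ^ 2)) s ≤
      (∫⁻ s in Ioo (τ - h) τ, ENNReal.ofReal (3240 * (τ - s) ^ (critExp p - 1))) *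
        ENNReal.ofReal (L ^ 2) := by
    rw [← lintegral_mul_const _ hm, setLIntegral_indicator measurableSet_Ioi]
    exact lintegral_mono_set fun s hs => ⟨hs.1, hs.2.2⟩
  rw [e1]
  refine (add_le_add_right e2 _).trans ?_
  rw [lintegral_oseen_kernel hp hτ.le, lintegral_oseen_kernel hp (by linarith),
    sub_zero, sub_sub_cancel, ← ENNReal.ofReal_mul (by positivity),
    ← ENNReal.ofReal_mul (by positivity), ← ENNReal.ofReal_add (by positivity) (by positivity)]
  apply ENNReal.ofReal_le_ofReal
  apply le_of_eq
  ring

/-- Short time estimate for differences. -/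
theorem eLpNorm_heatFlow_sub_sub_le_of_bounds (hu : IsMildSolution u u₀) (hv : IsMildSolution v v₀)
    (hp : 3 < p) {t τ : ℝ} (ht : 0 < t) (hτ : 0 < τ) {W : ℝ≥0∞} {B : ℝ} (hB : 0 ≤ B)
    (hW : ∀ s ∈ Ioo 0 τ, eLpNorm (u (t + s) - v (t + s)) p volume ≤ W)
    (h1 : ∀ s ∈ Ioo 0 τ, eLpNorm (u (t + s)) p volume ≤ ENNReal.ofReal B)
    (h2 : ∀ s ∈ Ioo 0 τ, eLpNorm (v (t + s)) p volume ≤ ENNReal.ofReal B) :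
    eLpNorm (heatFlow τ (u t - v t) - (u (t + τ) - v (t + τ))) p volume ≤
      ENNReal.ofReal (bilinConst p * τ ^ critExp p * (2 * B)) * W := by
  have hC := bilinConst_pos hp
  have key := hu.eLpNorm_heatFlow_sub_sub_le hv ht hτ (one_le_prodExp hp hp) (prodExp_le_left p p)
    (measurable_const (a := ENNReal.ofReal (2 * B) * W)) (fun s hs => by
      refine (eLpNorm_enorm_mul_add_le (hu.measurable_sub_apply hv _) (hu.measurable_apply _)
        (hv.measurable_apply _) (one_le_of_three_lt hp)).trans ?_
      calc _ ≤ W * (ENNReal.ofReal B + ENNReal.ofReal B) := by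
            gcongr
            · exact hW s hs
            · exact h1 s hs
            · exact h2 s hs
        _ = _ := by rw [← ENNReal.ofReal_add hB hB, ← two_mul, mul_comm])
  rw [oseen_exponent_eq hp, lintegral_mul_const _ (by fun_prop), lintegral_oseen_kernel hp hτ.le,
    sub_zero, ← mul_assoc, ← ENNReal.ofReal_mul (by positivity)] at key
  exact key

/-- A mild solution does not double its `L^p` norm before the local existence time. -/
theorem eLpNorm_le_two_mul (hu : IsMildSolution u u₀) (hp : 3 < p) (hloc : LocBddLp p u) {t τ A : ℝ}
    (ht : 0 < t) (hA : 0 < A) (hu' : eLpNorm (u t) p volume ≤ ENNReal.ofReal A)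
    (hsmall : bilinConst p * τ ^ critExp p * (4 * A) ≤ 1 / 2) :
    ∀ s ∈ Icc 0 τ, eLpNorm (u (t + s)) p volume ≤ ENNReal.ofReal (2 * A) := by
  intro s hs
  have hτ0 : 0 ≤ τ := hs.1.trans hs.2
  have ha := critExp_pos hp
  have hC := bilinConst_pos hp
  obtain ⟨L, hL⟩ := hloc t (t + τ) ht (by linarith)
  have hL' : ∀ s ∈ Icc 0 τ, eLpNorm (u (t + s)) p volume ≤ ENNReal.ofReal L := fun s hs => by
    simpa using hL (t + s) ⟨by linarith [hs.1], by linarith [hs.2]⟩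
  -- The bootstrap has to do without continuity of the norm in time. Instead it advances in steps of
  -- length h, chosen so that the crude local bound L, used only on the last step, contributes at
  -- most A/2.
  obtain ⟨h, hh, hhL⟩ : ∃ h : ℝ, 0 < h ∧ bilinConst p * (h ^ critExp p * (L : ℝ) ^ 2) ≤ A / 2 := by
    have hd : 0 < A / 2 / (bilinConst p * ((L : ℝ) ^ 2 + 1)) := by positivity
    refine ⟨(A / 2 / (bilinConst p * ((L : ℝ) ^ 2 + 1))) ^ (1 / critExp p), by positivity, ?_⟩
    rw [← Real.rpow_mul hd.le, one_div, inv_mul_cancel₀ ha.ne', Real.rpow_one]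
    have : A / 2 / (bilinConst p * ((L : ℝ) ^ 2 + 1)) * (bilinConst p * ((L : ℝ) ^ 2 + 1)) = A / 2 :=
      by field_simp
    have h3 : 0 ≤ A / 2 / (bilinConst p * ((L : ℝ) ^ 2 + 1)) * bilinConst p := by positivity
    nlinarith
  have main : ∀ n : ℕ, ∀ s ∈ Icc 0 τ, s ≤ n * h →
      eLpNorm (u (t + s)) p volume ≤ ENNReal.ofReal (2 * A) := by
    intro n
    induction n with
    | zero =>
      intro s hs hsn
      have : s = 0 := le_antisymm (by simpa using hsn) hs.1
      rw [this, add_zero]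
      exact hu'.trans (ENNReal.ofReal_le_ofReal (by linarith))
    | succ n ih =>
      intro s hs hsn
      rcases eq_or_lt_of_le hs.1 with h0 | h0
      · rw [← h0, add_zero]
        exact hu'.trans (ENNReal.ofReal_le_ofReal (by linarith))
      have hsn' : s ≤ n * h + h := by push_cast at hsn; linarith
      -- The induction hypothesis bounds u by 2A up to time s - h. The final count is A from the
      -- heat flow, A/2 from the times already controlled and A/2 from the last step.
      have hR := hu.eLpNorm_heatFlow_sub_le_of_two_bounds hp ht h0 hh (B := 2 * A) (L := L)
        (by positivity) L.2 (fun r hr hrh => ih r ⟨hr.1.le, hr.2.le.trans hs.2⟩ (by linarith))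
        (fun r hr => hL' r ⟨hr.1.le, hr.2.le.trans hs.2⟩)
      have hheat := (kernelBound_heatKernel h0).eLpNorm_conv_le_self (hu.measurable_apply t)
        (one_le_of_three_lt hp)
      rw [one_mul, ← heatFlow_eq_conv] at hheat
      have hm : Measurable (heatFlow s (u t)) :=
        measurable_conv (kernelBound_heatKernel h0).measurable (hu.measurable_apply t)
      have e : u (t + s) = heatFlow s (u t) - (heatFlow s (u t) - u (t + s)) := by abel
      rw [e]
      refine (eLpNorm_sub_le hm.aestronglyMeasurable
        (hm.sub (hu.measurable_apply _)).aestronglyMeasurable (one_le_of_three_lt hp)).trans ?_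
      refine (add_le_add (hheat.trans hu') hR).trans ?_
      rw [← ENNReal.ofReal_add hA.le (by positivity)]
      apply ENNReal.ofReal_le_ofReal
      have h5 : s ^ critExp p ≤ τ ^ critExp p := Real.rpow_le_rpow hs.1 hs.2 ha.le
      have h6 : bilinConst p * s ^ critExp p * (4 * A) ≤ 1 / 2 := le_trans (by gcongr) hsmall
      have h7 : bilinConst p * (s ^ critExp p * (2 * A) ^ 2) ≤ A / 2 := by
        calc _ = (bilinConst p * s ^ critExp p * (4 * A)) * A := by ring
          _ ≤ 1 / 2 * A := by gcongr
          _ = _ := by ring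
      rw [mul_add]
      linarith
  obtain ⟨n, hn⟩ := exists_nat_ge (s / h)
  exact main n s hs (by rwa [div_le_iff₀ hh] at hn)

end IsMildSolution

/-- The heat flow damps high frequencies. -/
theorem IsLPCutoff.exists_heatFlow_highFreq_le {χ : E3 → ℝ} (hχ : IsLPCutoff χ) :
    ∃ N : ℝ, 1 ≤ N ∧ ∀ (J : ℤ) (τ : ℝ), 0 < τ → ∀ (q : ℝ≥0∞), 1 ≤ q → ∀ f : E3 → E3,
      Measurable f → eLpNorm f q volume ≠ ∞ →
      eLpNorm (heatFlow τ (highFreq χ J f)) q volume ≤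
        ENNReal.ofReal (N * ((2 : ℝ) ^ J)⁻¹ * τ ^ (-(1 / 2) : ℝ)) * eLpNorm f q volume := by
  obtain ⟨N, hN1, hN⟩ := hχ.exists_kernelBound
  refine ⟨6 * N, by linarith, fun J τ hτ q hq f hf hfq => ?_⟩
  have hG := kernelBound_heatKernel hτ
  have hK := (hN J).1
  have hKf : eLpNorm (conv (lpKernel χ J) f) q volume ≠ ∞ :=
    ne_top_of_le_ne_top (ENNReal.mul_ne_top ENNReal.ofReal_ne_top hfq)
      (hK.eLpNorm_conv_le_self hf hq)
  have hGf : eLpNorm (conv (heatKernel τ) f) q volume ≠ ∞ :=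
    ne_top_of_le_ne_top (ENNReal.mul_ne_top ENNReal.one_ne_top hfq) (hG.eLpNorm_conv_le_self hf hq)
  -- The operators commute, so the quantity is g minus its mean against a kernel of mass one, with g
  -- = e^{τΔ}f. The first moment of that kernel is O(2^{-J}) and the translates of g are Lipschitz
  -- with constant O(τ^{-1/2}).
  have e : heatFlow τ (highFreq χ J f) =
      conv (heatKernel τ) f - conv (lpKernel χ J) (conv (heatKernel τ) f) := by
    rw [highFreq, lowFreq_eq_conv, heatFlow_eq_conv, hG.conv_sub ENNReal.one_ne_top
      ENNReal.ofReal_ne_top hf (measurable_conv hK.measurable hf) hq hfq hq hKf,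
      hG.conv_comm ENNReal.one_ne_top hK ENNReal.ofReal_ne_top ENNReal.ofReal_ne_top hf hq hfq]
  rw [e]
  refine (hK.eLpNorm_sub_conv_le ENNReal.ofReal_ne_top ENNReal.ofReal_ne_top (hχ.integral_kernel J)
    (measurable_conv hG.measurable hf) hq hGf
    (L := ENNReal.ofReal (6 * τ ^ (-(1 / 2) : ℝ)) * eLpNorm f q volume) fun y => ?_).trans ?_
  · simp_rw [hG.conv_translate_sub ENNReal.one_ne_top ENNReal.ofReal_ne_top hf hq hfq]
    refine ((kernelBound_heatKernel_translate_sub hτ y).eLpNorm_conv_le_self hf hq).trans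
      (le_of_eq ?_)
    ring
  · rw [← mul_assoc]
    gcongr
    refine (mul_le_mul_left (hN J).2 _).trans (le_of_eq ?_)
    rw [← ENNReal.ofReal_mul (by positivity)]
    congr 1
    ring

/-! ### Low frequencies are active -/

/-- The time step for the low frequency bound: τ = κX^{1/a} with X = c₂/(4M²·CB·Θ). The conditions
say in turn that the norms do not double before τ, that t + τ stays below the time inside Θ, that
the bilinear term is at most a third of c₂/Θ, and that τ^{-1/2} is the power of X in `freqScale`. -/
theorem exists_time_scale {a C CB ct : ℝ} (ha : 0 < a) (hC : 0 < C) (hCB : 0 < CB) (hct : 0 < ct) :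
    ∃ κ : ℝ, 0 < κ ∧ ∀ c₂ M Θ : ℝ, 0 < c₂ → 0 < M → 0 < Θ → c₂ ≤ M * Θ →
      ∃ τ : ℝ, 0 < τ ∧ C * τ ^ a * (4 * (M / 2)) ≤ 1 / 2 ∧ τ ≤ 4 * ct * M ^ (-(1 / a)) ∧
        C * τ ^ a * (2 * M) * (2 * M) ≤ c₂ / (3 * Θ) ∧
        τ ^ (-(1 / 2) : ℝ) =
          κ ^ (-(1 / 2) : ℝ) * (c₂ / (4 * M ^ 2 * CB * Θ)) ^ (-(1 / a) / 2) := by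
  have hδ : 0 < CB / (3 * C) := by positivity
  -- The first entry serves the two conditions on C τ^a, the second the comparison of τ with
  -- M^{-1/a}.
  set κ := min ((CB / (3 * C)) ^ (1 / a)) (4 * ct * CB ^ (1 / a)) with hκ
  have hκ0 : 0 < κ := lt_min (by positivity) (by positivity)
  have hκa : κ ^ a ≤ CB / (3 * C) := by
    calc κ ^ a ≤ ((CB / (3 * C)) ^ (1 / a)) ^ a :=
          Real.rpow_le_rpow hκ0.le (min_le_left _ _) ha.le
      _ = _ := by rw [← Real.rpow_mul hδ.le, one_div, inv_mul_cancel₀ ha.ne', Real.rpow_one]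
  refine ⟨κ, hκ0, fun c₂ M Θ hc₂ hM hΘ hle => ?_⟩
  set X := c₂ / (4 * M ^ 2 * CB * Θ) with hX
  have hX0 : 0 < X := by positivity
  have hτa : (κ * X ^ (1 / a)) ^ a ≤ CB / (3 * C) * X := by
    rw [Real.mul_rpow hκ0.le (by positivity), ← Real.rpow_mul hX0.le, one_div,
      inv_mul_cancel₀ ha.ne', Real.rpow_one]
    gcongr
  refine ⟨κ * X ^ (1 / a), by positivity, ?_, ?_, ?_, ?_⟩
  · calc C * (κ * X ^ (1 / a)) ^ a * (4 * (M / 2)) ≤ C * (CB / (3 * C) * X) * (4 * (M / 2)) := by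
          gcongr
      _ = c₂ / (6 * (M * Θ)) := by rw [hX]; field_simp; ring
      _ ≤ 1 / 2 := by
          rw [div_le_div_iff₀ (by positivity) (by norm_num)]
          nlinarith [mul_pos hM hΘ]
  · have h1 : X ≤ M⁻¹ * CB⁻¹ := by
      rw [hX, ← mul_inv, ← one_div, div_le_div_iff₀ (by positivity) (by positivity)]
      nlinarith [mul_le_mul_of_nonneg_left hle (mul_pos hM hCB).le, mul_pos hM hΘ,
        mul_pos (mul_pos hM hΘ) (mul_pos hM hCB)]
    calc κ * X ^ (1 / a) ≤ (4 * ct * CB ^ (1 / a)) * (M⁻¹ * CB⁻¹) ^ (1 / a) := by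
          gcongr
          exact min_le_right _ _
      _ = _ := by
          rw [Real.mul_rpow (by positivity) (by positivity), Real.inv_rpow hM.le,
            Real.inv_rpow hCB.le, Real.rpow_neg hM.le]
          field_simp
  · calc C * (κ * X ^ (1 / a)) ^ a * (2 * M) * (2 * M) ≤
          C * (CB / (3 * C) * X) * (2 * M) * (2 * M) := by gcongr
      _ = _ := by rw [hX]; field_simp; norm_num
  · rw [Real.mul_rpow hκ0.le (by positivity), ← Real.rpow_mul hX0.le]
    congr 2
    ring

theorem LocBddLp.eLpNorm_ne_top {p : ℝ≥0∞} {u : ℝ → E3 → E3} (h : LocBddLp p u) {t : ℝ}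
    (ht : 0 < t) : eLpNorm (u t) p volume ≠ ∞ := by
  obtain ⟨M, hM⟩ := h t t ht le_rfl
  exact ne_top_of_le_ne_top ENNReal.coe_ne_top (hM t ⟨le_rfl, le_rfl⟩)

theorem eLpNorm_le_half_M0_left {p : ℝ≥0∞} {u v : ℝ → E3 → E3} {t : ℝ}
    (h : eLpNorm (u t) p volume ≠ ∞) :
    eLpNorm (u t) p volume ≤ ENNReal.ofReal (M0 p u v t / 2) := by
  rw [← ENNReal.ofReal_toReal h, M0]
  apply ENNReal.ofReal_le_ofReal
  have := le_max_left (eLpNorm (u t) p volume).toReal (eLpNorm (v t) p volume).toReal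
  linarith

theorem eLpNorm_le_half_M0_right {p : ℝ≥0∞} {u v : ℝ → E3 → E3} {t : ℝ}
    (h : eLpNorm (v t) p volume ≠ ∞) :
    eLpNorm (v t) p volume ≤ ENNReal.ofReal (M0 p u v t / 2) := by
  rw [← ENNReal.ofReal_toReal h, M0]
  apply ENNReal.ofReal_le_ofReal
  have := le_max_right (eLpNorm (u t) p volume).toReal (eLpNorm (v t) p volume).toReal
  linarith

theorem M0_nonneg (p : ℝ≥0∞) (u v : ℝ → E3 → E3) (t : ℝ) : 0 ≤ M0 p u v t :=
  mul_nonneg zero_le_two (le_max_of_le_left ENNReal.toReal_nonneg)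

theorem ErrorLowerBound.le_eLpNorm {p : ℝ≥0∞} {c₂ : ℝ} {w : ℝ → E3 → E3}
    (h : ErrorLowerBound p c₂ w) {t Θ : ℝ} (ht : 0 < t) (hΘ : 0 < Θ) (hle : t ^ critExp p ≤ Θ) :
    ENNReal.ofReal (c₂ / Θ) ≤ eLpNorm (w t) p volume := by
  rw [ENNReal.ofReal_div_of_pos hΘ]
  refine ENNReal.div_le_of_le_mul ((h t ht).trans ?_)
  gcongr

namespace IsMildSolution

variable {u v : ℝ → E3 → E3} {u₀ v₀ : 𝓓'((⊤ : TopologicalSpace.Opens E3), E3)} {p : ℝ≥0∞}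

theorem eLpNorm_sub_le_M0 (hu : IsMildSolution u u₀) (hv : IsMildSolution v v₀) (hp : 1 ≤ p) {t : ℝ}
    (h1 : eLpNorm (u t) p volume ≠ ∞) (h2 : eLpNorm (v t) p volume ≠ ∞) :
    eLpNorm (u t - v t) p volume ≤ ENNReal.ofReal (M0 p u v t) := by
  have hM := M0_nonneg p u v t
  refine (eLpNorm_sub_le (hu.measurable_apply t).aestronglyMeasurable
    (hv.measurable_apply t).aestronglyMeasurable hp).trans ?_
  refine (add_le_add (eLpNorm_le_half_M0_left (v := v) h1)
    (eLpNorm_le_half_M0_right (u := u) h2)).trans ?_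
  rw [← ENNReal.ofReal_add (by linarith) (by linarith), add_halves]

theorem M0_pos (hu : IsMildSolution u u₀) (hv : IsMildSolution v v₀) (hp : 1 ≤ p) {c₂ : ℝ}
    (hc₂ : 0 < c₂) (hE : ErrorLowerBound p c₂ fun t => u t - v t) {t : ℝ} (ht : 0 < t)
    (h1 : eLpNorm (u t) p volume ≠ ∞) (h2 : eLpNorm (v t) p volume ≠ ∞) : 0 < M0 p u v t := by
  refine (M0_nonneg p u v t).lt_of_ne fun h0 => ?_
  have h3 := hu.eLpNorm_sub_le_M0 hv hp h1 h2
  rw [← h0, ENNReal.ofReal_zero] at h3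
  have h4 := hE t ht
  simp only [le_antisymm h3 zero_le, zero_mul, nonpos_iff_eq_zero, ENNReal.ofReal_eq_zero] at h4
  linarith

end IsMildSolution

theorem timeFactor_pos {p : ℝ≥0∞} {ct M t : ℝ} (hct : 0 < ct) (hM : 0 < M) (ht : 0 < t) :
    0 < timeFactor p ct M t := by
  unfold timeFactor
  positivity

theorem rpow_critExp_le_timeFactor {p : ℝ≥0∞} (hp : 3 < p) {ct M t : ℝ} (hct : 0 < ct) (hM : 0 < M)
    (ht : 0 < t) : t ^ critExp p ≤ timeFactor p ct M t := by
  unfold timeFactor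
  refine Real.rpow_le_rpow ht.le ?_ (critExp_pos hp).le
  have : 0 ≤ 4 * ct * M ^ (2 * thetaExp p) := by positivity
  linarith

theorem freqScale_pos {p : ℝ≥0∞} {CB ct c₂ M t : ℝ} (hCB : 0 < CB) (hct : 0 < ct) (hc₂ : 0 < c₂)
    (hM : 0 < M) (ht : 0 < t) : 0 < freqScale p CB ct c₂ M t := by
  have := timeFactor_pos (p := p) hct hM ht
  unfold freqScale
  positivity

/-- Compares the assumed lower bound for the error at time t with the triangle inequality ‖w‖ ≤ M₀,
using t^a ≤ Θ. -/
theorem IsMildSolution.lower_le_M0_mul {u v : ℝ → E3 → E3}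
    {u₀ v₀ : 𝓓'((⊤ : TopologicalSpace.Opens E3), E3)} {p : ℝ≥0∞} (hu : IsMildSolution u u₀)
    (hv : IsMildSolution v v₀) (hp : 3 < p) {c₂ ct : ℝ} (hct : 0 < ct)
    (hE : ErrorLowerBound p c₂ fun t => u t - v t) {t : ℝ} (ht : 0 < t)
    (h1 : eLpNorm (u t) p volume ≠ ∞) (h2 : eLpNorm (v t) p volume ≠ ∞) (hM : 0 < M0 p u v t) :
    c₂ ≤ M0 p u v t * timeFactor p ct (M0 p u v t) t := by
  have hΘ := timeFactor_pos (p := p) hct hM ht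
  have h := (hE.le_eLpNorm ht hΘ (rpow_critExp_le_timeFactor hp hct hM ht)).trans
    (hu.eLpNorm_sub_le_M0 hv (one_le_of_three_lt hp) h1 h2)
  rw [ENNReal.ofReal_le_ofReal_iff hM.le, div_le_iff₀ hΘ] at h
  exact h

/-- Quantitative form of the statement that low frequencies are active. -/
theorem IsLPCutoff.exists_lowFreq_lower_bound {χ : E3 → ℝ} (hχ : IsLPCutoff χ) {p : ℝ≥0∞}
    (hp : 3 < p) {CB ct : ℝ} (hCB : 0 < CB) (hct : 0 < ct) :
    ∃ K₀ : ℝ, 0 < K₀ ∧ ∀ c₂ : ℝ, 0 < c₂ → ∀ (u v : ℝ → E3 → E3)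
      (u₀ v₀ : 𝓓'((⊤ : TopologicalSpace.Opens E3), E3)),
      IsMildSolution u u₀ → IsMildSolution v v₀ → LocBddLp p u → LocBddLp p v →
      ErrorLowerBound p c₂ (fun t => u t - v t) → ∀ t : ℝ, 0 < t → ∀ J : ℤ,
        K₀ * freqScale p CB ct c₂ (M0 p u v t) t ≤ (2 : ℝ) ^ J →
        ENNReal.ofReal (c₂ / (3 * timeFactor p ct (M0 p u v t) t)) ≤
          eLpNorm (lowFreq χ J (u t - v t)) p volume := by
  obtain ⟨N, hN1, hN⟩ := hχ.exists_heatFlow_highFreq_le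
  obtain ⟨N', hN1', hN'⟩ := hχ.exists_kernelBound
  have ha := critExp_pos hp
  have hp1 := one_le_of_three_lt hp
  obtain ⟨κ, hκ, hτ⟩ := exists_time_scale ha (bilinConst_pos hp) hCB hct
  refine ⟨N * κ ^ (-(1 / 2) : ℝ), by positivity, ?_⟩
  intro c₂ hc₂ u v u₀ v₀ hu hv hlu hlv hE t ht J hJ
  have hut := hlu.eLpNorm_ne_top ht
  have hvt := hlv.eLpNorm_ne_top ht
  have hM := hu.M0_pos hv hp1 hc₂ hE ht hut hvt
  have hcM := hu.lower_le_M0_mul hv hp hct hE ht hut hvt hM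
  have hwt := hu.eLpNorm_sub_le_M0 hv hp1 hut hvt
  have hu2 := eLpNorm_le_half_M0_left (v := v) hut
  have hv2 := eLpNorm_le_half_M0_right (u := u) hvt
  have hΘ := timeFactor_pos (p := p) hct hM ht
  have hΘdef : timeFactor p ct (M0 p u v t) t =
    (4 * ct * M0 p u v t ^ (2 * thetaExp p) + t) ^ critExp p := rfl
  have hF : freqScale p CB ct c₂ (M0 p u v t) t = 4 * M0 p u v t *
    timeFactor p ct (M0 p u v t) t / c₂ * (c₂ / (4 * M0 p u v t ^ 2 * CB *
      timeFactor p ct (M0 p u v t) t)) ^ thetaExp p := rfl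
  set M := M0 p u v t with hMdef
  set Θ := timeFactor p ct M t with hΘ'
  obtain ⟨τ, hτ0, hτ1, hτ2, hτ3, hτ4⟩ := hτ c₂ M Θ hc₂ hM hΘ hcM
  have hθ : thetaExp p = -(1 / critExp p) / 2 := by rw [← two_mul_thetaExp hp]; ring
  rw [← hθ] at hτ4
  set X := c₂ / (4 * M ^ 2 * CB * Θ) with hX
  have hX0 : 0 < X := by positivity
  set f := u t - v t with hf
  have hfm : Measurable f := hu.measurable_sub_apply hv t
  have hft : eLpNorm f p volume ≠ ∞ := ne_top_of_le_ne_top ENNReal.ofReal_ne_top hwt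
  by_contra hlow
  rw [not_le] at hlow
  have hub := hu.eLpNorm_le_two_mul hp hlu ht (half_pos hM) hu2 hτ1
  have hvb := hv.eLpNorm_le_two_mul hp hlv ht (half_pos hM) hv2 hτ1
  rw [show 2 * (M / 2) = M by ring] at hub hvb
  -- Θ was built so that (t+τ)^a ≤ Θ for this τ; the lower bound is used at the later time t + τ.
  have hlower : ENNReal.ofReal (c₂ / Θ) ≤ eLpNorm (u (t + τ) - v (t + τ)) p volume := by
    refine hE.le_eLpNorm (by linarith) hΘ ?_
    rw [hΘdef]
    refine Real.rpow_le_rpow (by linarith) ?_ ha.le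
    rw [two_mul_thetaExp hp]
    linarith
  have hR := hu.eLpNorm_heatFlow_sub_sub_le_of_bounds hv hp ht hτ0 (W := ENNReal.ofReal (2 * M)) hM.le
    (fun s hs => by
      refine (eLpNorm_sub_le (hu.measurable_apply _).aestronglyMeasurable
        (hv.measurable_apply _).aestronglyMeasurable hp1).trans ?_
      refine (add_le_add (hub s ⟨hs.1.le, hs.2.le⟩) (hvb s ⟨hs.1.le, hs.2.le⟩)).trans ?_
      rw [← ENNReal.ofReal_add hM.le hM.le, two_mul])
    (fun s hs => hub s ⟨hs.1.le, hs.2.le⟩) (fun s hs => hvb s ⟨hs.1.le, hs.2.le⟩)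
  have hC := bilinConst_pos hp
  rw [← ENNReal.ofReal_mul (by positivity)] at hR
  replace hR := hR.trans (ENNReal.ofReal_le_ofReal hτ3)
  -- The threshold on 2^J is exactly what makes N 2^{-J}τ^{-1/2}M at most c₂/(4Θ).
  have hhigh : eLpNorm (heatFlow τ (highFreq χ J f)) p volume ≤
      ENNReal.ofReal (c₂ / (3 * Θ)) := by
    refine (hN J τ hτ0 p hp1 f hfm hft).trans ?_
    refine (mul_le_mul_right hwt _).trans ?_
    rw [← ENNReal.ofReal_mul (by positivity)]
    apply ENNReal.ofReal_le_ofReal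
    rw [hτ4]
    rw [hF] at hJ
    have h2J : (0 : ℝ) < 2 ^ J := by positivity
    calc N * ((2 : ℝ) ^ J)⁻¹ * (κ ^ (-(1 / 2) : ℝ) * X ^ thetaExp p) * M
        = (N * κ ^ (-(1 / 2) : ℝ) * (4 * M * Θ / c₂ * X ^ thetaExp p)) * ((2 : ℝ) ^ J)⁻¹ *
          (c₂ / (4 * Θ)) := by field_simp
      _ ≤ (2 : ℝ) ^ J * ((2 : ℝ) ^ J)⁻¹ * (c₂ / (4 * Θ)) := by gcongr
      _ = c₂ / (4 * Θ) := by field_simp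
      _ ≤ c₂ / (3 * Θ) := by gcongr; norm_num
  have hG := kernelBound_heatKernel hτ0
  have hK := (hN' J).1
  have hlm : Measurable (lowFreq χ J f) := measurable_conv hK.measurable hfm
  have hhm : Measurable (highFreq χ J f) := hfm.sub hlm
  have hlt : eLpNorm (lowFreq χ J f) p volume ≠ ∞ := (hlow.trans_le le_top).ne
  have hsplit : heatFlow τ f = heatFlow τ (lowFreq χ J f) + heatFlow τ (highFreq χ J f) := by
    rw [highFreq, heatFlow_eq_conv, heatFlow_eq_conv, heatFlow_eq_conv,
      hG.conv_sub ENNReal.one_ne_top ENNReal.ofReal_ne_top hfm hlm hp1 hft hp1 hlt]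
    abel
  have hheat : eLpNorm (heatFlow τ (lowFreq χ J f)) p volume ≤ eLpNorm (lowFreq χ J f) p volume := by
    have := hG.eLpNorm_conv_le_self hlm hp1
    rwa [one_mul] at this
  have m1 : Measurable (heatFlow τ (lowFreq χ J f)) := measurable_conv hG.measurable hlm
  have m2 : Measurable (heatFlow τ (highFreq χ J f)) := measurable_conv hG.measurable hhm
  have m3 : Measurable (heatFlow τ f) := measurable_conv hG.measurable hfm
  have m4 := hu.measurable_sub_apply hv (t + τ)
  have e : u (t + τ) - v (t + τ) = (heatFlow τ (lowFreq χ J f) + heatFlow τ (highFreq χ J f)) -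
      (heatFlow τ f - (u (t + τ) - v (t + τ))) := by
    rw [hsplit]; abel
  -- Three contributions, two at most c₂/(3Θ) and the low frequency one strictly below it by the
  -- hypothesis to be refuted.
  have hupper : eLpNorm (u (t + τ) - v (t + τ)) p volume < ENNReal.ofReal (c₂ / Θ) := by
    rw [e]
    calc _ ≤ eLpNorm (heatFlow τ (lowFreq χ J f) + heatFlow τ (highFreq χ J f)) p volume +
          eLpNorm (heatFlow τ f - (u (t + τ) - v (t + τ))) p volume :=
          eLpNorm_sub_le (m1.add m2).aestronglyMeasurable (m3.sub m4).aestronglyMeasurable hp1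
      _ ≤ (eLpNorm (heatFlow τ (lowFreq χ J f)) p volume +
          eLpNorm (heatFlow τ (highFreq χ J f)) p volume) + ENNReal.ofReal (c₂ / (3 * Θ)) := by
          gcongr
          exact eLpNorm_add_le m1.aestronglyMeasurable m2.aestronglyMeasurable hp1
      _ ≤ (eLpNorm (lowFreq χ J f) p volume + ENNReal.ofReal (c₂ / (3 * Θ))) +
          ENNReal.ofReal (c₂ / (3 * Θ)) := by gcongr
      _ < (ENNReal.ofReal (c₂ / (3 * Θ)) + ENNReal.ofReal (c₂ / (3 * Θ))) +
          ENNReal.ofReal (c₂ / (3 * Θ)) := by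
          refine ENNReal.add_lt_add_of_lt_of_le ENNReal.ofReal_ne_top ?_ le_rfl
          exact ENNReal.add_lt_add_of_lt_of_le ENNReal.ofReal_ne_top hlow le_rfl
      _ = ENNReal.ofReal (c₂ / Θ) := by
          rw [← ENNReal.ofReal_add (by positivity) (by positivity),
            ← ENNReal.ofReal_add (by positivity) (by positivity)]
          congr 1
          field_simp
          norm_num
  exact absurd hlower (not_le.2 hupper)

/-- The ratio of the high and the low frequencies. -/
theorem div_eLpNorm_lowFreq_le {χ : E3 → ℝ} (hχ : IsLPCutoff χ) {p : ℝ≥0∞} (hp : 1 ≤ p)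
    {J : ℤ} {f : E3 → E3} (hf : Measurable f) {M c₂ Θ : ℝ} (hM : 0 < M) (hc₂ : 0 < c₂) (hΘ : 0 < Θ)
    (hcM : c₂ ≤ M * Θ) (hfM : eLpNorm f p volume ≤ ENNReal.ofReal M)
    (hlow : ENNReal.ofReal (c₂ / (3 * Θ)) ≤ eLpNorm (lowFreq χ J f) p volume) :
    eLpNorm (highFreq χ J f) p volume / eLpNorm (lowFreq χ J f) p volume ≤
      ENNReal.ofReal (c₂ / (4 * M * Θ))⁻¹ := by
  obtain ⟨N, -, hN⟩ := hχ.exists_kernelBound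
  have hK := (hN J).1
  have hlm : Measurable (lowFreq χ J f) := measurable_conv hK.measurable hf
  have hx : 0 < ENNReal.ofReal (c₂ / (3 * Θ)) := ENNReal.ofReal_pos.2 (by positivity)
  set l := eLpNorm (lowFreq χ J f) p volume with hl
  have hl0 : l ≠ 0 := (hx.trans_le hlow).ne'
  have hlt : l ≠ ∞ := ne_top_of_le_ne_top (ENNReal.mul_ne_top ENNReal.ofReal_ne_top
    (ne_top_of_le_ne_top ENNReal.ofReal_ne_top hfM)) (hK.eLpNorm_conv_le_self hf hp)
  have h1 : eLpNorm (highFreq χ J f) p volume ≤ ENNReal.ofReal M + l :=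
    (eLpNorm_sub_le hf.aestronglyMeasurable hlm.aestronglyMeasurable hp).trans (by gcongr)
  have hge : 1 ≤ M * Θ / c₂ := by rwa [le_div_iff₀ hc₂, one_mul]
  have h2 : ENNReal.ofReal M ≤ ENNReal.ofReal (3 * (M * Θ / c₂)) * l := by
    refine le_trans ?_ (mul_le_mul_right hlow _)
    rw [← ENNReal.ofReal_mul (by positivity)]
    apply ENNReal.ofReal_le_ofReal
    apply le_of_eq
    field_simp
  have h3 : l ≤ ENNReal.ofReal (M * Θ / c₂) * l := by
    calc l = 1 * l := (one_mul l).symm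
      _ ≤ _ := by
        gcongr
        rw [← ENNReal.ofReal_one]
        exact ENNReal.ofReal_le_ofReal hge
  -- The 4 in γ arises as 3 + 1: M costs 3MΘ/c₂ times the low frequency norm, and that norm itself
  -- costs at most MΘ/c₂ times itself since c₂ ≤ MΘ.
  refine ENNReal.div_le_of_le_mul (h1.trans ((add_le_add h2 h3).trans (le_of_eq ?_)))
  rw [← add_mul, ← ENNReal.ofReal_add (by positivity) (by positivity), inv_div]
  congr 2
  ring

/-! ### Consequences of the scaling invariant upper bounds -/

/-- Positivity stands inside the existential so that `choose` yields a function defined on all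
reals; its value is 0 where y is not positive. -/
theorem exists_zpow_between (y : ℝ) : ∃ n : ℤ, 0 < y → y ≤ (2 : ℝ) ^ n ∧ (2 : ℝ) ^ n ≤ 2 * y := by
  by_cases hy : 0 < y
  · obtain ⟨n, hn⟩ := exists_mem_Ioc_zpow hy (y := (2 : ℝ)) (by norm_num)
    refine ⟨n + 1, fun _ => ⟨hn.2, ?_⟩⟩
    rw [zpow_add_one₀ (by norm_num), mul_comm]
    linarith [hn.1]
  · exact ⟨0, fun h => absurd h hy⟩

theorem Comparable.of_bounds {K A B l U : ℝ} (hl : 0 < l) (hB : 0 ≤ B) (h1 : l * B ≤ A)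
    (h2 : A ≤ U * B) (hK1 : l⁻¹ ≤ K) (hK2 : U ≤ K) : Comparable K A B := by
  refine ⟨le_trans ?_ h1, h2.trans (by gcongr)⟩
  gcongr
  exact inv_le_of_inv_le₀ hl hK1

theorem EComparable.of_bounds {K l U : ℝ} {A B : ℝ≥0∞} (hl : 0 < l)
    (h1 : ENNReal.ofReal l * B ≤ A) (h2 : A ≤ ENNReal.ofReal U * B) (hK1 : l⁻¹ ≤ K) (hK2 : U ≤ K) :
    EComparable K A B := by
  refine ⟨le_trans ?_ h1, h2.trans (by gcongr)⟩
  gcongr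
  exact inv_le_of_inv_le₀ hl hK1

section TypeI

variable {χ : E3 → ℝ} {c₁ : ℝ} {u v : ℝ → E3 → E3} {q : ℝ≥0∞}

theorem TypeIBound.eLpNorm_add_le (h : TypeIBound χ c₁ u v) (hq : 3 < q) {t : ℝ}
    (ht : 0 < t) : eLpNorm (u t) q volume + eLpNorm (v t) q volume ≤
      ENNReal.ofReal (c₁ * t ^ (-critExp q)) := by
  have h1 : ENNReal.ofReal (t ^ critExp q) * (eLpNorm (u t) q volume + eLpNorm (v t) q volume) ≤
      ENNReal.ofReal c₁ := le_trans (le_add_right le_self_add) (h t ht q hq)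
  have h2 : 0 < t ^ critExp q := by positivity
  rw [Real.rpow_neg ht.le, ← div_eq_mul_inv, ENNReal.ofReal_div_of_pos h2,
    ENNReal.le_div_iff_mul_le (Or.inl (ENNReal.ofReal_pos.2 h2).ne') (Or.inl ENNReal.ofReal_ne_top),
    mul_comm]
  exact h1

theorem TypeIBound.eLpNorm_left_le (h : TypeIBound χ c₁ u v) (hq : 3 < q) {t : ℝ}
    (ht : 0 < t) : eLpNorm (u t) q volume ≤ ENNReal.ofReal (c₁ * t ^ (-critExp q)) :=
  le_self_add.trans (h.eLpNorm_add_le hq ht)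

theorem TypeIBound.eLpNorm_right_le (h : TypeIBound χ c₁ u v) (hq : 3 < q) {t : ℝ}
    (ht : 0 < t) : eLpNorm (v t) q volume ≤ ENNReal.ofReal (c₁ * t ^ (-critExp q)) :=
  le_add_self.trans (h.eLpNorm_add_le hq ht)

theorem TypeIBound.eLpNorm_sub_le (h : TypeIBound χ c₁ u v) (hq : 3 < q) {t : ℝ}
    (ht : 0 < t) (hu : Measurable (u t)) (hv : Measurable (v t)) :
    eLpNorm (u t - v t) q volume ≤ ENNReal.ofReal (c₁ * t ^ (-critExp q)) :=
  (MeasureTheory.eLpNorm_sub_le hu.aestronglyMeasurable hv.aestronglyMeasurable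
    (one_le_of_three_lt hq)).trans (h.eLpNorm_add_le hq ht)

theorem rpow_neg_critExp_le (hq : 3 < q) {a t : ℝ} (ha : 0 < a) (hat : a ≤ t) :
    t ^ (-critExp q) ≤ a ^ (-critExp q) :=
  Real.rpow_le_rpow_of_nonpos ha hat (by linarith [critExp_pos hq])

theorem TypeIBound.locBddLp_left (h : TypeIBound χ c₁ u v) (hc₁ : 0 < c₁) (hq : 3 < q) :
    LocBddLp q u := fun a b ha hab =>
  ⟨(c₁ * a ^ (-critExp q)).toNNReal, fun t ht =>
    (h.eLpNorm_left_le hq (ha.trans_le ht.1)).trans (ENNReal.ofReal_le_ofReal (by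
      have := rpow_neg_critExp_le hq ha ht.1
      gcongr))⟩

theorem TypeIBound.locBddLp_right (h : TypeIBound χ c₁ u v) (hc₁ : 0 < c₁) (hq : 3 < q) :
    LocBddLp q v := fun a b ha hab =>
  ⟨(c₁ * a ^ (-critExp q)).toNNReal, fun t ht =>
    (h.eLpNorm_right_le hq (ha.trans_le ht.1)).trans (ENNReal.ofReal_le_ofReal (by
      have := rpow_neg_critExp_le hq ha ht.1
      gcongr))⟩

theorem TypeIBound.M0_le {p : ℝ≥0∞} (h : TypeIBound χ c₁ u v) (hc₁ : 0 < c₁) (hp : 3 < p) {t : ℝ}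
    (ht : 0 < t) : M0 p u v t ≤ 2 * c₁ * t ^ (-critExp p) := by
  have h0 : 0 ≤ c₁ * t ^ (-critExp p) := by positivity
  rw [M0, mul_assoc]
  gcongr
  exact max_le (ENNReal.toReal_le_of_le_ofReal h0 (h.eLpNorm_left_le hp ht))
    (ENNReal.toReal_le_of_le_ofReal h0 (h.eLpNorm_right_le hp ht))

end TypeI

/-- Bernstein's inequality for the low frequency projections. -/
theorem IsLPCutoff.exists_bernstein {χ : E3 → ℝ} (hχ : IsLPCutoff χ) : ∃ N : ℝ, 1 ≤ N ∧
    ∀ (J : ℤ) (q p : ℝ≥0∞), 1 ≤ q → q ≤ p → ∀ f : E3 → E3, Measurable f →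
      eLpNorm (lowFreq χ J f) p volume ≤
        ENNReal.ofReal (N * ((2 : ℝ) ^ J) ^ (3 * (q⁻¹.toReal - p⁻¹.toReal))) *
          eLpNorm f q volume := by
  obtain ⟨N, hN1, hN⟩ := hχ.exists_kernelBound
  refine ⟨N, hN1, fun J q p hq hqp f hf => ?_⟩
  have h := (hN J).1.eLpNorm_conv_le hf hq hqp
  have e := ofReal_rpow_interpolate (c := N) (r := (2 : ℝ) ^ J) (a := 0) (b := 3) (by linarith)
    (by positivity) (inv_toReal_sub_nonneg hq hqp) (inv_toReal_sub_le_one (p := p) hq)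
  rw [Real.rpow_zero, mul_one, zero_mul, zero_add,
    show ((2 : ℝ) ^ J) ^ (3 : ℝ) = ((2 : ℝ) ^ J) ^ (3 : ℕ) by
      rw [← Real.rpow_natCast]; norm_num] at e
  rw [e] at h
  exact h

/-- If M is comparable to t^{-a}, then M^{-1/a} is comparable to t, so Θ ~ t^a and MΘ is bounded
above and below. What is left in `freqScale` is M^{1/(2a)} ~ t^{-1/2}. -/
theorem freqScale_bounds {p : ℝ≥0∞} (hp : 3 < p) {CB ct c₁ c₂ : ℝ} (hCB : 0 < CB) (hct : 0 < ct)
    (hc₁ : 0 < c₁) (hc₂ : 0 < c₂) : ∃ l U B : ℝ, 0 < l ∧ 0 < U ∧ 0 < B ∧ ∀ M t : ℝ, 0 < t →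
      c₂ * t ^ (-critExp p) ≤ M → M ≤ 2 * c₁ * t ^ (-critExp p) →
      l * t ^ (-(1 / 2) : ℝ) ≤ freqScale p CB ct c₂ M t ∧
      freqScale p CB ct c₂ M t ≤ U * t ^ (-(1 / 2) : ℝ) ∧
      timeFactor p ct M t ≤ B * t ^ critExp p := by
  have ha := critExp_pos hp
  set a := critExp p with ha'
  set B := (4 * ct * c₂ ^ (-(1 / a)) + 1) ^ a with hB
  have hB0 : 0 < B := by positivity
  refine ⟨4 * (4 * c₂ * CB) ^ (1 / a / 2), 8 * c₁ * B / c₂ *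
    (16 * c₁ ^ 2 * CB * B / c₂) ^ (1 / a / 2), B, by positivity, by positivity, hB0, ?_⟩
  intro M t ht hM1 hM2
  have hta : 0 < t ^ (-a) := by positivity
  have hM : 0 < M := lt_of_lt_of_le (by positivity) hM1
  have hΘ2 : timeFactor p ct M t ≤ B * t ^ a := by
    have h1 : M ^ (-(1 / a)) ≤ c₂ ^ (-(1 / a)) * t := by
      calc M ^ (-(1 / a)) ≤ (c₂ * t ^ (-a)) ^ (-(1 / a)) := by
            refine Real.rpow_le_rpow_of_nonpos (by positivity) hM1 ?_
            have : 0 < 1 / a := by positivity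
            linarith
        _ = _ := by
          rw [Real.mul_rpow hc₂.le hta.le, ← Real.rpow_mul ht.le]
          have : -a * -(1 / a) = 1 := by field_simp
          rw [this, Real.rpow_one]
    rw [timeFactor, two_mul_thetaExp hp, hB, ← Real.mul_rpow (by positivity) ht.le]
    refine Real.rpow_le_rpow (by positivity) ?_ ha.le
    have : 4 * ct * M ^ (-(1 / a)) ≤ 4 * ct * (c₂ ^ (-(1 / a)) * t) := by gcongr
    linarith
  have hΘ1 := rpow_critExp_le_timeFactor hp hct hM ht
  have hΘ0 := timeFactor_pos (p := p) hct hM ht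
  set Θ := timeFactor p ct M t with hΘ
  have hθ : thetaExp p = -(1 / a / 2) := by
    have := two_mul_thetaExp hp
    linarith
  have hF : freqScale p CB ct c₂ M t = 4 * M * Θ / c₂ * (4 * M ^ 2 * CB * Θ / c₂) ^ (1 / a / 2) := by
    rw [freqScale, ← hΘ, hθ, Real.rpow_neg (by positivity), ← Real.inv_rpow (by positivity), inv_div]
  have hb : 0 < 1 / a / 2 := by positivity
  have htt : t ^ (-a) * t ^ a = 1 := by rw [← Real.rpow_add ht]; simp
  have htb : (t ^ (-a)) ^ (1 / a / 2) = t ^ (-(1 / 2) : ℝ) := by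
    rw [← Real.rpow_mul ht.le]
    congr 1
    field_simp
  have p1 : c₂ ≤ M * Θ := by
    calc c₂ = (c₂ * t ^ (-a)) * t ^ a := by rw [mul_assoc, htt, mul_one]
      _ ≤ _ := by gcongr
  have p2 : M * Θ ≤ 2 * c₁ * B := by
    calc M * Θ ≤ (2 * c₁ * t ^ (-a)) * (B * t ^ a) := by gcongr
      _ = 2 * c₁ * B * (t ^ (-a) * t ^ a) := by ring
      _ = _ := by rw [htt, mul_one]
  refine ⟨?_, ?_, hΘ2⟩
  · rw [hF, ← htb, mul_assoc, ← Real.mul_rpow (by positivity) hta.le]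
    gcongr ?_ * ?_
    · rw [le_div_iff₀ hc₂]; linarith
    · refine Real.rpow_le_rpow (by positivity) ?_ hb.le
      rw [le_div_iff₀ hc₂]
      calc 4 * c₂ * CB * t ^ (-a) * c₂ = 4 * CB * (c₂ * t ^ (-a)) * c₂ := by ring
        _ ≤ 4 * CB * M * (M * Θ) := by gcongr
        _ = _ := by ring
  · rw [hF, ← htb, mul_assoc (8 * c₁ * B / c₂), ← Real.mul_rpow (by positivity) hta.le]
    gcongr ?_ * ?_
    · rw [div_le_div_iff_of_pos_right hc₂]; linarith
    · refine Real.rpow_le_rpow (by positivity) ?_ hb.le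
      calc 4 * M ^ 2 * CB * Θ / c₂ = 4 * CB * M * (M * Θ) / c₂ := by ring
        _ ≤ 4 * CB * (2 * c₁ * t ^ (-a)) * (2 * c₁ * B) / c₂ := by gcongr
        _ = _ := by ring

/-- A small multiple of the parabolic frequency carries a small part of the error. -/
theorem IsLPCutoff.exists_lowFreq_small {χ : E3 → ℝ} (hχ : IsLPCutoff χ) {p : ℝ≥0∞} (hp : 3 < p)
    {c₁ η : ℝ} (hc₁ : 0 < c₁) (hη : 0 < η) : ∃ δ₀ : ℝ, 0 < δ₀ ∧ ∀ u v : ℝ → E3 → E3,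
      TypeIBound χ c₁ u v → ∀ t : ℝ, 0 < t → Measurable (u t) → Measurable (v t) → ∀ J : ℤ,
        (2 : ℝ) ^ J ≤ δ₀ * t ^ (-(1 / 2) : ℝ) →
        eLpNorm (lowFreq χ J (u t - v t)) p volume ≤ ENNReal.ofReal (η * t ^ (-critExp p)) := by
  obtain ⟨N, hN1, hN⟩ := hχ.exists_bernstein
  -- An exponent strictly between 3 and p: the L^q bound is still available, and Bernstein's
  -- inequality from L^q to L^p gains a positive power of 2^J.
  obtain ⟨q, hq, hqp⟩ := exists_between hp
  have hqt : q ≠ ∞ := (hqp.trans_le le_top).ne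
  have hθ : 0 < q⁻¹.toReal - p⁻¹.toReal := by
    rw [sub_pos]
    exact ENNReal.toReal_strict_mono (ENNReal.inv_ne_top.2 (lt_trans (by norm_num) hq).ne')
      (ENNReal.inv_lt_inv.2 hqp)
  set θ := q⁻¹.toReal - p⁻¹.toReal with hθ'
  have hd : 0 < η / (N * c₁) := by positivity
  refine ⟨(η / (N * c₁)) ^ (1 / (3 * θ)), by positivity, fun u v h t ht hu hv J hJ => ?_⟩
  refine (hN J q p (one_le_of_three_lt hq) hqp.le _ (hu.sub hv)).trans ?_
  refine (mul_le_mul_right (h.eLpNorm_sub_le hq ht hu hv) _).trans ?_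
  rw [← ENNReal.ofReal_mul (by positivity)]
  apply ENNReal.ofReal_le_ofReal
  calc N * ((2 : ℝ) ^ J) ^ (3 * θ) * (c₁ * t ^ (-critExp q))
      ≤ N * ((η / (N * c₁)) ^ (1 / (3 * θ)) * t ^ (-(1 / 2) : ℝ)) ^ (3 * θ) *
        (c₁ * t ^ (-critExp q)) := by gcongr
    _ = N * (η / (N * c₁)) * c₁ * (t ^ (-(1 / 2) * (3 * θ)) * t ^ (-critExp q)) := by
        rw [Real.mul_rpow (by positivity) (by positivity), ← Real.rpow_mul hd.le,
          ← Real.rpow_mul ht.le, one_div (3 * θ), inv_mul_cancel₀ (by positivity), Real.rpow_one]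
        ring
    _ = η * t ^ (-critExp p) := by
        rw [← Real.rpow_add ht]
        have : -(1 / 2) * (3 * θ) + -critExp q = -critExp p := by
          rw [hθ', critExp, critExp]; ring
        rw [this]
        field_simp

set_option maxHeartbeats 800000 in
/-- Low and intermediate frequencies are active. -/
theorem IsLPCutoff.low_and_intermediate_frequencies {χ : E3 → ℝ} (hχ : IsLPCutoff χ) {p : ℝ≥0∞}
    (hp : 3 < p) {CB ct : ℝ} (hCB : 0 < CB) (hct : 0 < ct) :
    ∃ J₂ : ℝ → ℝ → ℝ → ℤ,
      (∃ K : ℝ, 1 ≤ K ∧ ∀ c₂ M t : ℝ, 0 < c₂ → 0 < M → 0 < t →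
        Comparable K ((2 : ℝ) ^ J₂ c₂ M t) (freqScale p CB ct c₂ M t)) ∧
      (∀ c₂ : ℝ, 0 < c₂ → ∀ (u v : ℝ → E3 → E3)
        (u₀ : 𝓓'((⊤ : TopologicalSpace.Opens E3), E3)),
        IsMildSolution u u₀ → IsMildSolution v u₀ → LocBddLp p u → LocBddLp p v →
        ErrorLowerBound p c₂ (fun t => u t - v t) →
        ∀ t : ℝ, 0 < t → 0 < M0 p u v t ∧
          0 < eLpNorm (lowFreq χ (J₂ c₂ (M0 p u v t) t) (u t - v t)) p volume ∧
          eLpNorm (highFreq χ (J₂ c₂ (M0 p u v t) t) (u t - v t)) p volume /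
            eLpNorm (lowFreq χ (J₂ c₂ (M0 p u v t) t) (u t - v t)) p volume ≤
            ENNReal.ofReal (gammaFactor p ct c₂ (M0 p u v t) t)⁻¹) ∧
      (∀ c₁ c₂ : ℝ, 0 < c₁ → 0 < c₂ → ∃ K : ℝ, 1 ≤ K ∧ ∀ (u v : ℝ → E3 → E3)
        (u₀ : 𝓓'((⊤ : TopologicalSpace.Opens E3), E3)),
        IsMildSolution u u₀ → IsMildSolution v u₀ → TypeIBound χ c₁ u v →
        ErrorLowerBound p c₂ (fun t => u t - v t) →
        ∃ J₃ : ℝ → ℤ, ∀ t : ℝ, 0 < t →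
          Comparable K ((2 : ℝ) ^ J₂ c₂ (M0 p u v t) t) (t ^ (-(1 / 2) : ℝ)) ∧
          Comparable K ((2 : ℝ) ^ J₃ t) (t ^ (-(1 / 2) : ℝ)) ∧
          J₃ t < J₂ c₂ (M0 p u v t) t ∧
          EComparable K
            (eLpNorm (bandFreq χ (J₃ t) (J₂ c₂ (M0 p u v t) t) (u t - v t)) p volume)
            (eLpNorm (u t - v t) p volume) ∧
          EComparable K (eLpNorm (u t - v t) p volume)
            (ENNReal.ofReal (t ^ (-critExp p)))) := by
  have hp1 := one_le_of_three_lt hp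
  obtain ⟨K₀, hK₀, hlow⟩ := hχ.exists_lowFreq_lower_bound hp hCB hct
  choose Z hZ using exists_zpow_between
  refine ⟨fun c₂ M t => Z (K₀ * freqScale p CB ct c₂ M t), ?_, ?_, ?_⟩
  · refine ⟨1 + K₀⁻¹ + 2 * K₀, by linarith [inv_pos.2 hK₀], fun c₂ M t hc₂ hM ht => ?_⟩
    have hF := freqScale_pos (p := p) hCB hct hc₂ hM ht
    obtain ⟨h1, h2⟩ := hZ _ (mul_pos hK₀ hF)
    exact Comparable.of_bounds hK₀ hF.le h1 (U := 2 * K₀) (by rw [mul_assoc]; exact h2)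
      (by linarith) (by linarith [inv_pos.2 hK₀])
  · intro c₂ hc₂ u v u₀ hu hv hlu hlv hE t ht
    have hut := hlu.eLpNorm_ne_top ht
    have hvt := hlv.eLpNorm_ne_top ht
    have hM := hu.M0_pos hv hp1 hc₂ hE ht hut hvt
    have hF := freqScale_pos (p := p) hCB hct hc₂ hM ht
    have hΘ := timeFactor_pos (p := p) hct hM ht
    have hl := hlow c₂ hc₂ u v u₀ u₀ hu hv hlu hlv hE t ht _ (hZ _ (mul_pos hK₀ hF)).1
    exact ⟨hM, lt_of_lt_of_le (ENNReal.ofReal_pos.2 (by positivity)) hl,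
      div_eLpNorm_lowFreq_le hχ hp1 (hu.measurable_sub_apply hv t) hM hc₂ hΘ
        (hu.lower_le_M0_mul hv hp hct hE ht hut hvt hM) (hu.eLpNorm_sub_le_M0 hv hp1 hut hvt) hl⟩
  · intro c₁ c₂ hc₁ hc₂
    obtain ⟨l, U, B, hl, hU, hB, hbd⟩ := freqScale_bounds hp hCB hct hc₁ hc₂
    obtain ⟨N, hN1, hN⟩ := hχ.exists_kernelBound
    obtain ⟨δ₀, hδ₀, hsmall⟩ := hχ.exists_lowFreq_small hp hc₁ (η := c₂ / (6 * B)) (by positivity)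
    -- The first bound makes the frequencies below J₃ negligible, the second forces J₃ < J₂.
    set δ := min δ₀ (K₀ * l / 2) with hδ
    have hδ0 : 0 < δ := lt_min hδ₀ (by positivity)
    have q1 : 0 < (K₀ * l)⁻¹ := by positivity
    have q2 : 0 < 2 * K₀ * U := by positivity
    have q3 : 0 < (δ / 2)⁻¹ := by positivity
    have q4 : 0 < (c₂ / (6 * B * c₁))⁻¹ := by positivity
    have q5 : 0 < c₂⁻¹ := by positivity
    refine ⟨1 + (K₀ * l)⁻¹ + 2 * K₀ * U + (δ / 2)⁻¹ + δ + (c₂ / (6 * B * c₁))⁻¹ + 2 * N + c₂⁻¹ + c₁,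
      by linarith, ?_⟩
    intro u v u₀ hu hv hA hE
    refine ⟨fun t => Z (δ / 2 * t ^ (-(1 / 2) : ℝ)), fun t ht => ?_⟩
    have hlu := hA.locBddLp_left hc₁ hp
    have hlv := hA.locBddLp_right hc₁ hp
    have hut := hlu.eLpNorm_ne_top ht
    have hvt := hlv.eLpNorm_ne_top ht
    have hM := hu.M0_pos hv hp1 hc₂ hE ht hut hvt
    have hF := freqScale_pos (p := p) hCB hct hc₂ hM ht
    have hΘ := timeFactor_pos (p := p) hct hM ht
    have htp : 0 < t ^ (-(1 / 2) : ℝ) := by positivity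
    have hta : 0 < t ^ (-critExp p) := by positivity
    have hwlow : ENNReal.ofReal (c₂ * t ^ (-critExp p)) ≤ eLpNorm (u t - v t) p volume := by
      have := hE.le_eLpNorm ht (Real.rpow_pos_of_pos ht (critExp p)) le_rfl
      rwa [div_eq_mul_inv, ← Real.rpow_neg ht.le] at this
    have hwm := hu.measurable_sub_apply hv t
    have hwup := hA.eLpNorm_sub_le hp ht (hu.measurable_apply t) (hv.measurable_apply t)
    have hMl : c₂ * t ^ (-critExp p) ≤ M0 p u v t := by
      have := hwlow.trans (hu.eLpNorm_sub_le_M0 hv hp1 hut hvt)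
      rwa [ENNReal.ofReal_le_ofReal_iff hM.le] at this
    obtain ⟨b1, b2, b3⟩ := hbd _ t ht hMl (hA.M0_le hc₁ hp ht)
    obtain ⟨z1, z2⟩ := hZ _ (mul_pos hK₀ hF)
    obtain ⟨y1, y2⟩ := hZ (δ / 2 * t ^ (-(1 / 2) : ℝ)) (by positivity)
    -- The band contains block J₂, so it is compared with the projection of index J₂ + 1; the
    -- threshold on 2^J holds there as well.
    have hl1 := hlow c₂ hc₂ u v u₀ u₀ hu hv hlu hlv hE t ht
      (Z (K₀ * freqScale p CB ct c₂ (M0 p u v t) t) + 1) (z1.trans (by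
        rw [zpow_add_one₀ (by norm_num)]
        have : (0 : ℝ) < 2 ^ Z (K₀ * freqScale p CB ct c₂ (M0 p u v t) t) := by positivity
        linarith))
    set J₂ := Z (K₀ * freqScale p CB ct c₂ (M0 p u v t) t) with hJ₂
    set J₃ := Z (δ / 2 * t ^ (-(1 / 2) : ℝ)) with hJ₃
    have y3 : (2 : ℝ) ^ J₃ ≤ δ * t ^ (-(1 / 2) : ℝ) := by linarith
    have hlt : J₃ < J₂ := by
      have h1 : (2 : ℝ) ^ J₃ < 2 ^ J₂ := by
        calc (2 : ℝ) ^ J₃ ≤ (K₀ * l / 2) * t ^ (-(1 / 2) : ℝ) :=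
              y3.trans (by gcongr; exact min_le_right _ _)
          _ < K₀ * (l * t ^ (-(1 / 2) : ℝ)) := by
              have : 0 < K₀ * l * t ^ (-(1 / 2) : ℝ) := by positivity
              linarith
          _ ≤ K₀ * freqScale p CB ct c₂ (M0 p u v t) t := by gcongr
          _ ≤ _ := z1
      exact (zpow_lt_zpow_iff_right₀ (by norm_num : (1 : ℝ) < 2)).1 h1
    have hs := hsmall u v hA t ht (hu.measurable_apply t) (hv.measurable_apply t) J₃
      (y3.trans (by gcongr; exact min_le_left _ _))
    have hwt : eLpNorm (u t - v t) p volume ≠ ∞ := ne_top_of_le_ne_top ENNReal.ofReal_ne_top hwup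
    have hband := hχ.bandFreq_eq (J := J₃) (J' := J₂) (by omega) hwm hp1 hwt
    set w := u t - v t with hw
    have mlow : ∀ J, Measurable (lowFreq χ J w) := fun J => measurable_conv (hN J).1.measurable hwm
    have nlow : ∀ J, eLpNorm (lowFreq χ J w) p volume ≤ ENNReal.ofReal N * eLpNorm w p volume :=
      fun J => (hN J).1.eLpNorm_conv_le_self hwm hp1
    -- Twice the smallness η = c₂/(6B) allowed below J₃, so that half survives the subtraction.
    have hl2 : ENNReal.ofReal (2 * (c₂ / (6 * B) * t ^ (-critExp p))) ≤
        eLpNorm (lowFreq χ (J₂ + 1) w) p volume := by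
      refine le_trans (ENNReal.ofReal_le_ofReal ?_) hl1
      calc 2 * (c₂ / (6 * B) * t ^ (-critExp p)) = c₂ / (3 * (B * t ^ critExp p)) := by
            rw [Real.rpow_neg ht.le]; field_simp; norm_num
        _ ≤ _ := by gcongr
    have hbl : ENNReal.ofReal (c₂ / (6 * B) * t ^ (-critExp p)) ≤
        eLpNorm (bandFreq χ J₃ J₂ w) p volume := by
      rw [hband]
      have h1 : eLpNorm (lowFreq χ (J₂ + 1) w) p volume ≤
          eLpNorm (lowFreq χ (J₂ + 1) w - lowFreq χ J₃ w) p volume +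
            eLpNorm (lowFreq χ J₃ w) p volume := by
        have e : lowFreq χ (J₂ + 1) w = (lowFreq χ (J₂ + 1) w - lowFreq χ J₃ w) + lowFreq χ J₃ w := by
          abel
        nth_rw 1 [e]
        exact MeasureTheory.eLpNorm_add_le ((mlow _).sub (mlow _)).aestronglyMeasurable
          (mlow _).aestronglyMeasurable hp1
      have h2 := hl2.trans (h1.trans (add_le_add_right hs _))
      rw [two_mul, ENNReal.ofReal_add (by positivity) (by positivity)] at h2
      exact (ENNReal.add_le_add_iff_right ENNReal.ofReal_ne_top).1 h2
    have hbu : eLpNorm (bandFreq χ J₃ J₂ w) p volume ≤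
        ENNReal.ofReal (2 * N) * eLpNorm w p volume := by
      rw [hband]
      refine (MeasureTheory.eLpNorm_sub_le (mlow _).aestronglyMeasurable
        (mlow _).aestronglyMeasurable hp1).trans ?_
      refine (add_le_add (nlow _) (nlow _)).trans (le_of_eq ?_)
      rw [← add_mul, ← ENNReal.ofReal_add (by linarith) (by linarith), two_mul]
    refine ⟨?_, ?_, hlt, ?_, ?_⟩
    · refine Comparable.of_bounds (l := K₀ * l) (U := 2 * K₀ * U) (by positivity) htp.le ?_ ?_
        (by linarith) (by linarith)
      · calc K₀ * l * t ^ (-(1 / 2) : ℝ) = K₀ * (l * t ^ (-(1 / 2) : ℝ)) := by ring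
          _ ≤ K₀ * freqScale p CB ct c₂ (M0 p u v t) t := by gcongr
          _ ≤ _ := z1
      · calc (2 : ℝ) ^ J₂ ≤ 2 * (K₀ * freqScale p CB ct c₂ (M0 p u v t) t) := z2
          _ ≤ 2 * (K₀ * (U * t ^ (-(1 / 2) : ℝ))) := by gcongr
          _ = _ := by ring
    · exact Comparable.of_bounds (l := δ / 2) (U := δ) (by positivity) htp.le y1 y3
        (by linarith) (by linarith)
    · refine EComparable.of_bounds (l := c₂ / (6 * B * c₁)) (U := 2 * N) (by positivity) ?_ hbu
        (by linarith) (by linarith)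
      refine le_trans (mul_le_mul_right hwup _) (le_trans (le_of_eq ?_) hbl)
      rw [← ENNReal.ofReal_mul (by positivity)]
      congr 1
      field_simp
    · refine EComparable.of_bounds (l := c₂) (U := c₁) hc₂ ?_ ?_ (by linarith) (by linarith)
      · rwa [← ENNReal.ofReal_mul hc₂.le]
      · rwa [← ENNReal.ofReal_mul hc₁.le]

/-! ### Vanishing of the low frequencies of the error at the initial time -/

theorem rpow_one_sub_mul_rpow (x : ℝ≥0∞) {r : ℝ} (h0 : 0 ≤ r) (h1 : r ≤ 1) :
    x ^ (1 - r) * x ^ r = x := by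
  rw [← ENNReal.rpow_add_of_nonneg _ _ (by linarith) h0]
  simp

/-- `K` and its gradient are bounded by `A` in `L¹` and in `L^∞`. -/
structure SmoothKernelBound (K : E3 → ℝ) (A : ℝ≥0∞) : Prop where
  contDiff : ContDiff ℝ 1 K
  kernelBound : KernelBound K A A
  lintegral_fderiv_le : ∫⁻ x, ‖fderiv ℝ K x‖ₑ ≤ A
  enorm_fderiv_le : ∀ x, ‖fderiv ℝ K x‖ₑ ≤ A

theorem KernelBound.enorm_conv_le_mul {K : E3 → ℝ} {A : ℝ≥0∞} (h : KernelBound K A A) {f : E3 → E3}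
    (hf : Measurable f) {q : ℝ≥0∞} (hq : 1 ≤ q) (x : E3) :
    ‖conv K f x‖ₑ ≤ A * eLpNorm f q volume := by
  have := h.enorm_conv_le hf hq x
  rwa [rpow_one_sub_mul_rpow _ ENNReal.toReal_nonneg (KernelBound.inv_toReal_le_one hq)] at this

/-- The heat flow changes a smoothed function by little in a short time. -/
theorem SmoothKernelBound.enorm_conv_heatFlow_sub_le {K : E3 → ℝ} {A : ℝ≥0∞}
    (h : SmoothKernelBound K A) (hA : A ≠ ∞) {f : E3 → E3} (hf : Measurable f) {q : ℝ≥0∞}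
    (hq : 1 ≤ q) (hfq : eLpNorm f q volume ≠ ∞) {s : ℝ} (hs : 0 < s) (x : E3) :
    ‖conv K f x - conv K (heatFlow s f) x‖ₑ ≤
      ENNReal.ofReal (12 * s ^ (1 / 2 : ℝ)) * (A * eLpNorm f q volume) := by
  have hG := kernelBound_heatKernel hs
  have hK := h.kernelBound
  have hKf : eLpNorm (conv K f) q volume ≠ ∞ :=
    ne_top_of_le_ne_top (ENNReal.mul_ne_top hA hfq) (hK.eLpNorm_conv_le_self hf hq)
  rw [heatFlow_eq_conv, hK.conv_comm hA hG ENNReal.one_ne_top ENNReal.ofReal_ne_top hf hq hfq]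
  refine (hG.enorm_sub_conv_le ENNReal.one_ne_top ENNReal.ofReal_ne_top (integral_heatKernel hs)
    (measurable_conv hK.measurable hf) hq hKf x).trans ?_
  have hΓ : Measurable (heatKernel s) := hG.measurable
  calc ∫⁻ y, ‖heatKernel s y‖ₑ * ‖conv K f (x - y) - conv K f x‖ₑ
      ≤ ∫⁻ y, ‖heatKernel s y‖ₑ * ‖y‖ₑ * (A * eLpNorm f q volume) := by
        refine lintegral_mono fun y => ?_
        rw [hK.conv_translate_sub hA hA hf hq hfq, mul_assoc]
        gcongr
        refine ((kernelBound_translate_sub h.contDiff h.lintegral_fderiv_le h.enorm_fderiv_le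
          y).enorm_conv_le_mul hf hq x).trans (le_of_eq ?_)
        ring
    _ = (∫⁻ y, ‖heatKernel s y‖ₑ * ‖y‖ₑ) * (A * eLpNorm f q volume) :=
        lintegral_mul_const _ (by fun_prop)
    _ ≤ _ := by
        gcongr
        exact lintegral_enorm_heatKernel_mul_enorm_le hs

/-! ### Time regularity of smoothed mild solutions near the initial time. -/

theorem critExp_four : critExp 4 = 1 / 8 := by
  unfold critExp
  rw [ENNReal.toReal_inv]
  norm_num

theorem critExp_six : critExp 6 = 1 / 4 := by
  unfold critExp
  rw [ENNReal.toReal_inv]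
  norm_num

/-- The product of two L⁴ functions lies in L², where the forcing on [s, 2s] is O(s^{-1/4}); the
kernel integrates to a multiple of s^{1/2}. The constant is 6480 = 3240 · 2. -/
theorem IsMildSolution.eLpNorm_heatFlow_sub_le_sqrt {u : ℝ → E3 → E3}
    {u₀ : 𝓓'((⊤ : TopologicalSpace.Opens E3), E3)} (hu : IsMildSolution u u₀) {c₁ : ℝ}
    (hc₁ : 0 < c₁) (hb : ∀ t : ℝ, 0 < t → eLpNorm (u t) 4 volume ≤ ENNReal.ofReal (c₁ * t ^ (-(1 / 8) : ℝ)))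
    {s : ℝ} (hs : 0 < s) :
    eLpNorm (heatFlow s (u s) - u (s + s)) (prodExp 4 4) volume ≤
      ENNReal.ofReal (6480 * c₁ ^ 2 * s ^ (1 / 4 : ℝ)) := by
  have h4 : (3 : ℝ≥0∞) < 4 := by norm_num
  have key := hu.eLpNorm_heatFlow_sub_le hs hs (one_le_prodExp h4 h4) le_rfl
    (measurable_const (a := ENNReal.ofReal (c₁ ^ 2 * s ^ (-(1 / 4) : ℝ)))) (fun r hr => by
      refine (eLpNorm_enorm_mul_self_le (hu.measurable_apply _) (one_le_of_three_lt h4)).trans ?_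
      have hr0 : 0 < s + r := by linarith [hr.1]
      have h1 : eLpNorm (u (s + r)) 4 volume ≤ ENNReal.ofReal (c₁ * s ^ (-(1 / 8) : ℝ)) := by
        refine (hb _ hr0).trans (ENNReal.ofReal_le_ofReal ?_)
        gcongr c₁ * ?_
        exact Real.rpow_le_rpow_of_nonpos hs (by linarith [hr.1]) (by norm_num)
      refine (mul_le_mul' h1 h1).trans (le_of_eq ?_)
      rw [← ENNReal.ofReal_mul (by positivity)]
      congr 1
      calc _ = c₁ ^ 2 * (s ^ (-(1 / 8) : ℝ) * s ^ (-(1 / 8) : ℝ)) := by ring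
        _ = _ := by rw [← Real.rpow_add hs]; norm_num)
  refine key.trans (le_of_eq ?_)
  have e : ∀ r : ℝ, ENNReal.ofReal (3240 * (s - r) ^ (-(1 / 2) - 3 / 2 *
      ((prodExp 4 4)⁻¹.toReal - (prodExp 4 4)⁻¹.toReal))) =
      ENNReal.ofReal 3240 * ENNReal.ofReal ((s - r) ^ (-(1 / 2) : ℝ)) := by
    intro r
    rw [sub_self, mul_zero, sub_zero, ENNReal.ofReal_mul (by norm_num)]
  simp_rw [e]
  rw [lintegral_mul_const _ (by fun_prop), lintegral_const_mul _ (by fun_prop),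
    lintegral_Ioo_sub_rpow (by norm_num) hs.le, ← ENNReal.ofReal_mul (by norm_num),
    ← ENNReal.ofReal_mul (by rw [sub_zero]; norm_num; positivity)]
  congr 1
  rw [sub_zero]
  have h1 : s ^ (1 / 4 : ℝ) = s ^ (1 / 2 : ℝ) * s ^ (-(1 / 4) : ℝ) := by
    rw [← Real.rpow_add hs]; norm_num
  rw [h1]
  norm_num
  ring

/-- Doubling the time moves a smoothed solution by O(s^{1/4}). The heat flow contributes s^{1/2} ·
s^{-1/8} = s^{3/8}, which is at most s^{1/4} for s ≤ 1, and the Duhamel term contributes s^{1/4}. -/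
theorem IsMildSolution.enorm_conv_sub_le {u : ℝ → E3 → E3}
    {u₀ : 𝓓'((⊤ : TopologicalSpace.Opens E3), E3)} (hu : IsMildSolution u u₀) {c₁ : ℝ}
    (hc₁ : 0 < c₁) (hb : ∀ t : ℝ, 0 < t → eLpNorm (u t) 4 volume ≤ ENNReal.ofReal (c₁ * t ^ (-(1 / 8) : ℝ)))
    {K : E3 → ℝ} {A : ℝ≥0∞} (h : SmoothKernelBound K A) (hA : A ≠ ∞)
    {s : ℝ} (hs : 0 < s) (hs1 : s ≤ 1) (x : E3) :
    ‖conv K (u (s + s)) x - conv K (u s) x‖ₑ ≤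
      A * ENNReal.ofReal ((12 * c₁ + 6480 * c₁ ^ 2) * s ^ (1 / 4 : ℝ)) := by
  have h4 : (3 : ℝ≥0∞) < 4 := by norm_num
  have h41 : (1 : ℝ≥0∞) ≤ 4 := by norm_num
  have hm1 := one_le_prodExp h4 h4
  have hK := h.kernelBound
  have hG := kernelBound_heatKernel hs
  have hmu := hu.measurable_apply
  have hus : eLpNorm (u s) 4 volume ≠ ∞ := ne_top_of_le_ne_top ENNReal.ofReal_ne_top (hb s hs)
  have hgm : Measurable (heatFlow s (u s)) := measurable_conv hG.measurable (hmu s)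
  have hgs : eLpNorm (heatFlow s (u s)) 4 volume ≠ ∞ :=
    ne_top_of_le_ne_top (ENNReal.mul_ne_top ENNReal.one_ne_top hus)
      (hG.eLpNorm_conv_le_self (hmu s) h41)
  have hR := hu.eLpNorm_heatFlow_sub_le_sqrt hc₁ hb hs
  set R := heatFlow s (u s) - u (s + s) with hRdef
  have hRm : Measurable R := hgm.sub (hmu _)
  have e : u (s + s) = heatFlow s (u s) - R := by rw [hRdef]; abel
  have e2 : conv K (u (s + s)) x - conv K (u s) x =
      -(conv K (u s) x - conv K (heatFlow s (u s)) x) - conv K R x := by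
    rw [e, hK.conv_sub hA hA hgm hRm h41 hgs hm1 (ne_top_of_le_ne_top ENNReal.ofReal_ne_top hR),
      Pi.sub_apply]
    abel
  rw [e2]
  refine (enorm_sub_le).trans ?_
  rw [enorm_neg]
  have b1 : ‖conv K (u s) x - conv K (heatFlow s (u s)) x‖ₑ ≤
      A * ENNReal.ofReal (12 * c₁ * s ^ (1 / 4 : ℝ)) := by
    refine (h.enorm_conv_heatFlow_sub_le hA (hmu s) h41 hus hs x).trans ?_
    calc _ ≤ ENNReal.ofReal (12 * s ^ (1 / 2 : ℝ)) *
          (A * ENNReal.ofReal (c₁ * s ^ (-(1 / 8) : ℝ))) := by gcongr; exact hb s hs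
      _ = A * ENNReal.ofReal (12 * c₁ * s ^ (3 / 8 : ℝ)) := by
          rw [mul_left_comm, ← ENNReal.ofReal_mul (by positivity)]
          congr 2
          calc _ = 12 * c₁ * (s ^ (1 / 2 : ℝ) * s ^ (-(1 / 8) : ℝ)) := by ring
            _ = _ := by rw [← Real.rpow_add hs]; norm_num
      _ ≤ _ := by
          refine mul_le_mul' le_rfl (ENNReal.ofReal_le_ofReal ?_)
          gcongr 12 * c₁ * ?_
          exact Real.rpow_le_rpow_of_exponent_ge hs hs1 (by norm_num)
  have b2 : ‖conv K R x‖ₑ ≤ A * ENNReal.ofReal (6480 * c₁ ^ 2 * s ^ (1 / 4 : ℝ)) :=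
    (hK.enorm_conv_le_mul hRm hm1 x).trans (by gcongr)
  refine (add_le_add b1 b2).trans (le_of_eq ?_)
  rw [← mul_add, ← ENNReal.ofReal_add (by positivity) (by positivity), add_mul]

/-- Convolution at x is the pairing with the test function y ↦ K(x - y). The limit depends only on
the initial data, hence is common to all solutions. -/
theorem exists_tendsto_conv (u₀ : 𝓓'((⊤ : TopologicalSpace.Opens E3), E3)) {K : E3 → ℝ}
    (hK : ContDiff ℝ ((⊤ : ℕ∞) : WithTop ℕ∞) K) (hKc : HasCompactSupport K) (x : E3) :
    ∃ l : E3, (∀ v : ℝ → E3 → E3, IsMildSolution v u₀ →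
      Tendsto (fun t => conv K (v t) x) (𝓝[>] 0) (𝓝 l)) := by
  set φ : 𝓓((⊤ : TopologicalSpace.Opens E3), ℝ) :=
    { toFun := fun y => K (x - y)
      contDiff' := hK.comp (contDiff_const.sub contDiff_id)
      hasCompactSupport' := hKc.comp_homeomorph (Homeomorph.subLeft x)
      tsupport_subset' := fun _ _ => trivial } with hφ
  exact ⟨u₀ φ, fun v hv => hv.initial φ⟩

/-- Sums a geometric series: E solves (C + E)ρ = E with ρ = 2^{-1/4}, so the constant survives each
halving of time. -/
theorem exists_geometric_constant (C : ℝ) (hC : 0 < C) : ∃ E : ℝ, 0 < E ∧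
    ∀ s : ℝ, 0 < s → (C + E) * (s / 2) ^ (1 / 4 : ℝ) ≤ E * s ^ (1 / 4 : ℝ) := by
  set ρ : ℝ := (1 / 2 : ℝ) ^ (1 / 4 : ℝ) with hρ
  have h0 : 0 < ρ := by positivity
  have h1 : ρ < 1 := Real.rpow_lt_one (by norm_num) (by norm_num) (by norm_num)
  have h2 : 0 < 1 - ρ := by linarith
  refine ⟨C * ρ / (1 - ρ), by positivity, fun s hs => ?_⟩
  have e : (s / 2) ^ (1 / 4 : ℝ) = ρ * s ^ (1 / 4 : ℝ) := by
    rw [hρ, ← Real.mul_rpow (by norm_num) hs.le]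
    congr 1
    ring
  rw [e, ← mul_assoc]
  gcongr
  apply le_of_eq
  field_simp
  ring

/-- Halve the time repeatedly: the increments of u and v sum geometrically to O(s^{1/4}), and the
remainder at time s/2^n tends to 0 because both solutions have the same initial data. The kernel
enters only through A, which later allows a limit of kernels. -/
theorem exists_enorm_conv_sub_le {c₁ : ℝ} (hc₁ : 0 < c₁) : ∃ E : ℝ, 0 < E ∧
    ∀ (u v : ℝ → E3 → E3) (u₀ : 𝓓'((⊤ : TopologicalSpace.Opens E3), E3)),
      IsMildSolution u u₀ → IsMildSolution v u₀ →
      (∀ t : ℝ, 0 < t → eLpNorm (u t) 4 volume ≤ ENNReal.ofReal (c₁ * t ^ (-(1 / 8) : ℝ))) →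
      (∀ t : ℝ, 0 < t → eLpNorm (v t) 4 volume ≤ ENNReal.ofReal (c₁ * t ^ (-(1 / 8) : ℝ))) →
      ∀ (K : E3 → ℝ) (A : ℝ≥0∞), SmoothKernelBound K A → A ≠ ∞ →
      ContDiff ℝ ((⊤ : ℕ∞) : WithTop ℕ∞) K → HasCompactSupport K → ∀ s : ℝ, 0 < s → s ≤ 1 → ∀ x,
      ‖conv K (u s - v s) x‖ₑ ≤ A * ENNReal.ofReal (E * s ^ (1 / 4 : ℝ)) := by
  set C := 2 * (12 * c₁ + 6480 * c₁ ^ 2) with hC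
  obtain ⟨E, hE, hEs⟩ := exists_geometric_constant C (by positivity)
  refine ⟨E, hE, fun u v u₀ hu hv hub hvb K A h hA hK hKc s hs hs1 x => ?_⟩
  have hfin : ∀ w : ℝ → E3 → E3,
      (∀ t : ℝ, 0 < t → eLpNorm (w t) 4 volume ≤ ENNReal.ofReal (c₁ * t ^ (-(1 / 8) : ℝ))) →
      ∀ t : ℝ, 0 < t → eLpNorm (w t) 4 volume ≠ ∞ := fun w hw t ht =>
    ne_top_of_le_ne_top ENNReal.ofReal_ne_top (hw t ht)
  have h41 : (1 : ℝ≥0∞) ≤ 4 := by norm_num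
  have hsub : ∀ t : ℝ, 0 < t → conv K (u t - v t) x = conv K (u t) x - conv K (v t) x := by
    intro t ht
    rw [h.kernelBound.conv_sub hA hA (hu.measurable_apply t) (hv.measurable_apply t) h41
      (hfin u hub t ht) h41 (hfin v hvb t ht), Pi.sub_apply]
  have step : ∀ t : ℝ, 0 < t → t ≤ 1 → ‖conv K (u t - v t) x‖ₑ ≤
      ‖conv K (u (t / 2) - v (t / 2)) x‖ₑ + A * ENNReal.ofReal (C * (t / 2) ^ (1 / 4 : ℝ)) := by
    intro t ht ht1
    have a1 := hu.enorm_conv_sub_le hc₁ hub h hA (half_pos ht) (by linarith) x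
    have a2 := hv.enorm_conv_sub_le hc₁ hvb h hA (half_pos ht) (by linarith) x
    rw [add_halves] at a1 a2
    have e : conv K (u t - v t) x = conv K (u (t / 2) - v (t / 2)) x +
        ((conv K (u t) x - conv K (u (t / 2)) x) - (conv K (v t) x - conv K (v (t / 2)) x)) := by
      rw [hsub t ht, hsub _ (half_pos ht)]; abel
    rw [e]
    refine (enorm_add_le _ _).trans ?_
    gcongr
    refine enorm_sub_le.trans ((add_le_add a1 a2).trans (le_of_eq ?_))
    rw [← mul_add, ← ENNReal.ofReal_add (by positivity) (by positivity), hC]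
    congr 2
    ring
  have iter : ∀ n : ℕ, ∀ t : ℝ, 0 < t → t ≤ 1 → ‖conv K (u t - v t) x‖ₑ ≤
      ‖conv K (u (t / 2 ^ n) - v (t / 2 ^ n)) x‖ₑ + A * ENNReal.ofReal (E * t ^ (1 / 4 : ℝ)) := by
    intro n
    induction n with
    | zero =>
      intro t ht ht1
      simp
    | succ n ih =>
      intro t ht ht1
      refine (step t ht ht1).trans ((add_le_add_left (ih (t / 2) (by linarith) (by linarith)) _).trans ?_)
      rw [add_assoc, ← mul_add, ← ENNReal.ofReal_add (by positivity) (by positivity), ← add_mul,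
        div_div, ← pow_succ']
      refine add_le_add le_rfl (mul_le_mul' le_rfl (ENNReal.ofReal_le_ofReal ?_))
      rw [add_comm E C]
      exact hEs t ht
  obtain ⟨l, hl⟩ := exists_tendsto_conv u₀ hK hKc x
  have hlim : Tendsto (fun t => conv K (u t - v t) x) (𝓝[>] 0) (𝓝 0) := by
    have h1 := (hl u hu).sub (hl v hv)
    rw [sub_self] at h1
    refine h1.congr' ?_
    filter_upwards [self_mem_nhdsWithin] with t ht
    exact (hsub t ht).symm
  have hseq : Tendsto (fun n : ℕ => s / 2 ^ n) atTop (𝓝[>] 0) := by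
    refine tendsto_nhdsWithin_iff.2 ⟨?_, Eventually.of_forall fun n => ?_⟩
    · have := (tendsto_pow_atTop_nhds_zero_of_lt_one (r := (1 / 2 : ℝ)) (by norm_num)
        (by norm_num)).const_mul s
      rw [mul_zero] at this
      refine this.congr fun n => ?_
      rw [one_div, inv_pow, div_eq_mul_inv]
    · exact div_pos hs (by positivity)
  have hlim2 := ((hlim.comp hseq).enorm).add_const (A * ENNReal.ofReal (E * s ^ (1 / 4 : ℝ)))
  rw [enorm_zero, zero_add] at hlim2
  exact ge_of_tendsto' hlim2 fun n => iter n s hs hs1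

/-- The Littlewood-Paley kernel, cut off at distance `n + 1`. -/
def cutKernel (χ : E3 → ℝ) (J : ℤ) (n : ℕ) (x : E3) : ℝ :=
  χ (((n : ℝ) + 1)⁻¹ • x) * lpKernel χ J x

/-! ### Truncated Littlewood-Paley kernels with uniform bounds. -/

namespace IsLPCutoff

variable {χ : E3 → ℝ}

theorem exists_bound (hχ : IsLPCutoff χ) :
    ∃ S : ℝ, 1 ≤ S ∧ (∀ x, ‖χ x‖ ≤ S) ∧ ∀ x, ‖fderiv ℝ χ x‖ ≤ S := by
  set X : SchwartzMap E3 ℝ := hχ.hasCompactSupport.toSchwartzMap hχ.smooth with hX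
  have e : ∀ x, fderiv ℝ χ x = SchwartzMap.fderivCLM ℝ E3 ℝ X x := fun x => by
    rw [SchwartzMap.fderivCLM_apply]; rfl
  have h1 : 0 ≤ SchwartzMap.seminorm ℝ 0 0 X := apply_nonneg _ _
  have h2 : 0 ≤ SchwartzMap.seminorm ℝ 0 0 (SchwartzMap.fderivCLM ℝ E3 ℝ X) := apply_nonneg _ _
  refine ⟨1 + SchwartzMap.seminorm ℝ 0 0 X +
    SchwartzMap.seminorm ℝ 0 0 (SchwartzMap.fderivCLM ℝ E3 ℝ X), by linarith, fun x => ?_, fun x => ?_⟩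
  · have : ‖χ x‖ ≤ _ := SchwartzMap.norm_le_seminorm ℝ X x
    linarith
  · rw [e]
    have := SchwartzMap.norm_le_seminorm ℝ (SchwartzMap.fderivCLM ℝ E3 ℝ X) x
    linarith

theorem contDiff_cutKernel (hχ : IsLPCutoff χ) (J : ℤ) (n : ℕ) :
    ContDiff ℝ ((⊤ : ℕ∞) : WithTop ℕ∞) (cutKernel χ J n) := by
  have h1 : ContDiff ℝ ((⊤ : ℕ∞) : WithTop ℕ∞) fun ξ : E3 => ((n : ℝ) + 1)⁻¹ • ξ := by fun_prop
  exact (hχ.smooth.comp h1).mul (hχ.contDiff_kernel J)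

theorem hasCompactSupport_cutKernel (hχ : IsLPCutoff χ) (J : ℤ) (n : ℕ) :
    HasCompactSupport (cutKernel χ J n) := by
  have h1 : HasCompactSupport fun ξ : E3 => χ (((n : ℝ) + 1)⁻¹ • ξ) :=
    hχ.hasCompactSupport.comp_homeomorph (Homeomorph.smulOfNeZero (((n : ℝ) + 1)⁻¹) (by positivity))
  exact h1.mul_right

/-- The bound has to be uniform in n. The truncation is dilated by a factor (n+1)^{-1} ≤ 1, so its
values and its gradient stay bounded, and the rest is the product rule. -/
theorem exists_smoothKernelBound_cutKernel (hχ : IsLPCutoff χ) (J : ℤ) :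
    ∃ A : ℝ≥0∞, A ≠ ∞ ∧ ∀ n, SmoothKernelBound (cutKernel χ J n) A := by
  obtain ⟨S, hS1, hS, hS'⟩ := hχ.exists_bound
  obtain ⟨N, hN1, hN⟩ := hχ.exists_kernelBound
  obtain ⟨C, hC, hC1, hC2⟩ := hχ.exists_fderiv_kernel_bound J
  have hK := (hN J).1
  set k := lpKernel χ J with hk
  have hkc : Continuous k := (hχ.contDiff_kernel J).continuous
  have hkd : Differentiable ℝ k := (hχ.contDiff_kernel J).differentiable (by simp)
  set N1 := ENNReal.ofReal N
  set N2 := ENNReal.ofReal (N * ((2 : ℝ) ^ J) ^ 3)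
  set s := ENNReal.ofReal S with hs
  have hval : ∀ n x, ‖cutKernel χ J n x‖ₑ ≤ s * ‖k x‖ₑ := by
    intro n x
    rw [cutKernel, enorm_mul, hs]
    gcongr
    rw [← ofReal_norm]
    exact ENNReal.ofReal_le_ofReal (hS _)
  have hder : ∀ n x, ‖fderiv ℝ (cutKernel χ J n) x‖ₑ ≤ s * (‖k x‖ₑ + ‖fderiv ℝ k x‖ₑ) := by
    intro n x
    set r := ((n : ℝ) + 1)⁻¹ with hr
    have hr0 : 0 ≤ r := by positivity
    have hr1 : r ≤ 1 := inv_le_one_of_one_le₀ (by linarith [Nat.cast_nonneg (α := ℝ) n])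
    have h1 : HasFDerivAt (fun y : E3 => χ (r • y)) ((fderiv ℝ χ (r • x)).comp
        (r • ContinuousLinearMap.id ℝ E3)) x := by
      have h2 : HasFDerivAt (fun y : E3 => r • y) (r • ContinuousLinearMap.id ℝ E3) x :=
        (hasFDerivAt_id x).const_smul r
      exact HasFDerivAt.comp x ((hχ.smooth.differentiable (by simp)) (r • x)).hasFDerivAt h2
    have h3 : HasFDerivAt (cutKernel χ J n) _ x := h1.fun_mul (hkd x).hasFDerivAt
    have e1 : ‖fderiv ℝ χ (r • x) ∘L (r • ContinuousLinearMap.id ℝ E3)‖ₑ ≤ s := by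
      rw [← ofReal_norm, hs]
      apply ENNReal.ofReal_le_ofReal
      rw [ContinuousLinearMap.comp_smul, ContinuousLinearMap.comp_id, norm_smul,
        Real.norm_of_nonneg hr0]
      calc r * ‖fderiv ℝ χ (r • x)‖ ≤ 1 * S := by gcongr; exact hS' _
        _ = S := one_mul S
    have e2 : ‖χ (r • x)‖ₑ ≤ s := by
      rw [← ofReal_norm]
      exact ENNReal.ofReal_le_ofReal (hS _)
    rw [h3.fderiv, mul_add, add_comm (s * ‖k x‖ₑ)]
    refine (enorm_add_le (χ (r • x) • fderiv ℝ k x)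
      (k x • (fderiv ℝ χ (r • x) ∘L (r • ContinuousLinearMap.id ℝ E3)))).trans ?_
    rw [enorm_smul, enorm_smul, mul_comm ‖k x‖ₑ]
    exact add_le_add (mul_le_mul' e2 le_rfl) (mul_le_mul' e1 le_rfl)
  have hst : s ≠ ∞ := ENNReal.ofReal_ne_top
  have hsum : N1 + N2 + C ≠ ∞ :=
    ENNReal.add_ne_top.2 ⟨ENNReal.add_ne_top.2 ⟨ENNReal.ofReal_ne_top, ENNReal.ofReal_ne_top⟩, hC⟩
  have g1 : N1 ≤ N1 + N2 + C := by rw [add_assoc]; exact le_self_add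
  have g2 : N2 ≤ N1 + N2 + C := le_add_right le_add_self
  have g3 : N1 + C ≤ N1 + N2 + C := by gcongr; exact le_self_add
  have g4 : N2 + C ≤ N1 + N2 + C := by gcongr; exact le_add_self
  refine ⟨s * (N1 + N2 + C), ENNReal.mul_ne_top hst hsum, fun n => ?_⟩
  refine ⟨(hχ.contDiff_cutKernel J n).of_le (by exact_mod_cast le_top),
    ⟨(hχ.contDiff_cutKernel J n).continuous.measurable, ?_, fun x => ?_⟩, ?_, fun x => ?_⟩
  · refine (lintegral_mono (hval n)).trans ?_
    rw [lintegral_const_mul _ hkc.measurable.enorm]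
    gcongr
    exact hK.lintegral_le.trans g1
  · refine (hval n x).trans ?_
    gcongr
    exact (hK.enorm_le x).trans g2
  · refine (lintegral_mono (hder n)).trans ?_
    rw [lintegral_const_mul _ (by fun_prop), lintegral_add_left (by fun_prop)]
    exact mul_le_mul' le_rfl ((add_le_add hK.lintegral_le hC1).trans g3)
  · refine (hder n x).trans ?_
    exact mul_le_mul' le_rfl ((add_le_add (hK.enorm_le x) (hC2 x)).trans g4)

/-- Convergence to the initial data is tested only on compactly supported functions, whereas the
Littlewood-Paley kernel is merely Schwartz. Dominated convergence removes the truncation, which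
equals 1 at each point for large n. -/
theorem tendsto_conv_cutKernel (hχ : IsLPCutoff χ) (J : ℤ) {f : E3 → E3} (hf : Measurable f)
    {q : ℝ≥0∞} (hq : 1 ≤ q) (hfq : eLpNorm f q volume ≠ ∞) (x : E3) :
    Tendsto (fun n => conv (cutKernel χ J n) f x) atTop (𝓝 (lowFreq χ J f x)) := by
  obtain ⟨S, hS1, hS, -⟩ := hχ.exists_bound
  obtain ⟨N, hN1, hN⟩ := hχ.exists_kernelBound
  have hi := (hN J).1.integrable_smul ENNReal.ofReal_ne_top ENNReal.ofReal_ne_top hf hq hfq x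
  refine tendsto_integral_of_dominated_convergence (fun y => S * ‖lpKernel χ J (x - y) • f y‖)
    (fun n => ?_) (hi.norm.const_mul S) (fun n => ae_of_all _ fun y => ?_) (ae_of_all _ fun y => ?_)
  · have := (hχ.contDiff_cutKernel J n).continuous.measurable
    exact Measurable.aestronglyMeasurable (by fun_prop)
  · rw [cutKernel, mul_smul, norm_smul]
    gcongr
    exact hS _
  · refine tendsto_const_nhds.congr' ?_
    have h1 : Tendsto (fun n : ℕ => ((n : ℝ) + 1)⁻¹ • (x - y)) atTop (𝓝 0) := by
      have := (tendsto_one_div_add_atTop_nhds_zero_nat (𝕜 := ℝ)).smul_const (x - y)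
      simpa using this
    filter_upwards [h1 (Metric.ball_mem_nhds (0 : E3) (by norm_num : (0 : ℝ) < 1 / 2))] with n hn
    rw [cutKernel, hχ.eq_one _ hn, one_mul]
    rfl

/-- The low frequencies of the error vanish at the initial time. -/
theorem exists_enorm_lowFreq_le (hχ : IsLPCutoff χ) (J : ℤ) {c₁ : ℝ} (hc₁ : 0 < c₁)
    {u v : ℝ → E3 → E3} {u₀ : 𝓓'((⊤ : TopologicalSpace.Opens E3), E3)} (hu : IsMildSolution u u₀)
    (hv : IsMildSolution v u₀) (hA : TypeIBound χ c₁ u v) : ∃ C : ℝ≥0∞, C ≠ ∞ ∧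
      ∀ s : ℝ, 0 < s → s ≤ 1 → ∀ x,
        ‖lowFreq χ J (u s - v s) x‖ₑ ≤ C * ENNReal.ofReal (s ^ (1 / 4 : ℝ)) := by
  obtain ⟨E, hE, hbd⟩ := exists_enorm_conv_sub_le hc₁
  obtain ⟨A, hAt, hcut⟩ := hχ.exists_smoothKernelBound_cutKernel J
  have h4 : (3 : ℝ≥0∞) < 4 := by norm_num
  refine ⟨A * ENNReal.ofReal E, ENNReal.mul_ne_top hAt ENNReal.ofReal_ne_top,
    fun s hs hs1 x => ?_⟩
  have hwm := hu.measurable_sub_apply hv s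
  have hw := hA.eLpNorm_sub_le h4 hs (hu.measurable_apply s) (hv.measurable_apply s)
  have hlim := (hχ.tendsto_conv_cutKernel J hwm (one_le_of_three_lt h4)
    (ne_top_of_le_ne_top ENNReal.ofReal_ne_top hw) x).enorm
  refine le_of_tendsto' hlim fun n => ?_
  rw [mul_assoc, ← ENNReal.ofReal_mul hE.le]
  refine hbd u v u₀ hu hv (fun t ht => ?_) (fun t ht => ?_) _ A (hcut n) hAt
    (hχ.contDiff_cutKernel J n) (hχ.hasCompactSupport_cutKernel J n) s hs hs1 x
  · have := hA.eLpNorm_left_le h4 ht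
    rwa [critExp_four] at this
  · have := hA.eLpNorm_right_le h4 ht
    rwa [critExp_four] at this

end IsLPCutoff

/-! ### Low frequencies of the error -/

/-- The two singularities sit at opposite ends of (0, t): on either side of t/2 one of the factors
is bounded by its value at t/2. -/
theorem rpow_neg_half_mul_rpow_le {b r t : ℝ} (hb : 0 ≤ b) (hr : 0 < r) (hrt : r < t) :
    (t - r) ^ (-(1 / 2) : ℝ) * r ^ (-b) ≤
      (t / 2) ^ (-(1 / 2) : ℝ) * r ^ (-b) + (t / 2) ^ (-b) * (t - r) ^ (-(1 / 2) : ℝ) := by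
  have ht : 0 < t := hr.trans hrt
  have h1 : 0 < t - r := sub_pos.2 hrt
  rcases le_total r (t / 2) with h | h
  · have : (t - r) ^ (-(1 / 2) : ℝ) ≤ (t / 2) ^ (-(1 / 2) : ℝ) :=
      Real.rpow_le_rpow_of_nonpos (by positivity) (by linarith) (by norm_num)
    calc _ ≤ (t / 2) ^ (-(1 / 2) : ℝ) * r ^ (-b) := by gcongr
      _ ≤ _ := le_add_of_nonneg_right (by positivity)
  · have : r ^ (-b) ≤ (t / 2) ^ (-b) :=
      Real.rpow_le_rpow_of_nonpos (by positivity) h (by linarith)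
    calc _ ≤ (t / 2) ^ (-b) * (t - r) ^ (-(1 / 2) : ℝ) := by rw [mul_comm]; gcongr
      _ ≤ _ := le_add_of_nonneg_left (by positivity)

theorem two_rpow_le_two {b : ℝ} (hb : b ≤ 1) : (2 : ℝ) ^ b ≤ 2 := by
  simpa using Real.rpow_le_rpow_of_exponent_le (x := 2) (by norm_num) hb

/-- A Beta integral bounded uniformly in the starting time t₀, which will tend to 0. The assumption
b ≤ 3/4 keeps 1 - b ≥ 1/4, and 12 = 8 + 4 collects the two halves of the split. -/
theorem lintegral_sub_rpow_mul_rpow_le {b t₀ τ : ℝ} (hb : 0 ≤ b) (hb1 : b ≤ 3 / 4) (ht₀ : 0 < t₀)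
    (hτ : 0 < τ) : ∫⁻ s in Ioo 0 τ, ENNReal.ofReal ((τ - s) ^ (-(1 / 2) : ℝ) * (t₀ + s) ^ (-b)) ≤
      ENNReal.ofReal (12 * (t₀ + τ) ^ (1 / 2 - b)) := by
  set t := t₀ + τ with ht_def
  have ht : 0 < t := by positivity
  have hτt : τ ≤ t := by linarith
  have key : ∀ s ∈ Ioo 0 τ, ENNReal.ofReal ((τ - s) ^ (-(1 / 2) : ℝ) * (t₀ + s) ^ (-b)) ≤
      ENNReal.ofReal ((t / 2) ^ (-(1 / 2) : ℝ)) * ENNReal.ofReal (s ^ (-b)) +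
      ENNReal.ofReal ((t / 2) ^ (-b)) * ENNReal.ofReal ((τ - s) ^ (-(1 / 2) : ℝ)) := by
    intro s hs
    have h0 : 0 < s := hs.1
    have h1 : 0 < τ - s := sub_pos.2 hs.2
    rw [← ENNReal.ofReal_mul (by positivity), ← ENNReal.ofReal_mul (by positivity),
      ← ENNReal.ofReal_add (by positivity) (by positivity)]
    apply ENNReal.ofReal_le_ofReal
    have h2 := rpow_neg_half_mul_rpow_le hb (r := t₀ + s) (t := t) (by positivity)
      (by linarith [hs.2])
    have e : t - (t₀ + s) = τ - s := by rw [ht_def]; ring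
    rw [e] at h2
    have h3 : (t₀ + s) ^ (-b) ≤ s ^ (-b) :=
      Real.rpow_le_rpow_of_nonpos h0 (by linarith) (by linarith)
    refine h2.trans ?_
    gcongr
  refine (setLIntegral_mono (by fun_prop) key).trans ?_
  rw [lintegral_add_left (by fun_prop), lintegral_const_mul _ (by fun_prop),
    lintegral_const_mul _ (by fun_prop), lintegral_Ioo_rpow (by linarith) hτ.le,
    lintegral_Ioo_sub_rpow (by norm_num) hτ.le, sub_zero]
  have h1b : 0 < -b + 1 := by linarith
  rw [← ENNReal.ofReal_mul (by positivity), ← ENNReal.ofReal_mul (by positivity),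
    ← ENNReal.ofReal_add (by positivity) (by norm_num; positivity)]
  apply ENNReal.ofReal_le_ofReal
  have e1 : (t / 2) ^ (-(1 / 2) : ℝ) * (τ ^ (-b + 1) / (-b + 1)) ≤ 8 * t ^ (1 / 2 - b) := by
    calc _ ≤ (t / 2) ^ (-(1 / 2) : ℝ) * (t ^ (-b + 1) / (1 / 4)) := by gcongr; linarith
      _ = 4 * (2 ^ (1 / 2 : ℝ)) * (t ^ (-(1 / 2) : ℝ) * t ^ (-b + 1)) := by
        rw [Real.div_rpow ht.le (by norm_num), Real.rpow_neg (by norm_num : (0 : ℝ) ≤ 2)]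
        field_simp
      _ = 4 * (2 ^ (1 / 2 : ℝ)) * t ^ (1 / 2 - b) := by
        rw [← Real.rpow_add ht]; congr 2; ring
      _ ≤ 4 * 2 * t ^ (1 / 2 - b) := by
        gcongr
        exact two_rpow_le_two (by norm_num)
      _ = _ := by ring
  have e2 : (t / 2) ^ (-b) * (τ ^ (-(1 / 2) + 1 : ℝ) / (-(1 / 2) + 1)) ≤ 4 * t ^ (1 / 2 - b) := by
    have h4 : (-(1 / 2) + 1 : ℝ) = 1 / 2 := by norm_num
    rw [h4]
    calc _ ≤ (t / 2) ^ (-b) * (t ^ (1 / 2 : ℝ) / (1 / 2)) := by gcongr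
      _ = 2 * 2 ^ b * (t ^ (1 / 2 : ℝ) * t ^ (-b)) := by
        rw [Real.div_rpow ht.le (by norm_num), Real.rpow_neg (by norm_num : (0 : ℝ) ≤ 2)]
        field_simp
      _ = 2 * 2 ^ b * t ^ (1 / 2 - b) := by rw [← Real.rpow_add ht]; congr 2
      _ ≤ 2 * 2 * t ^ (1 / 2 - b) := by
        gcongr
        exact two_rpow_le_two (by linarith)
      _ = _ := by ring
  linarith

section

variable {χ : E3 → ℝ} {c₁ : ℝ} {u v : ℝ → E3 → E3}
  {u₀ v₀ : 𝓓'((⊤ : TopologicalSpace.Opens E3), E3)} {p : ℝ≥0∞}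

/-- The error is measured in L^p and u, v in L⁶, with the bound s^{-1/4}. Keeping the exponent of
the product leaves only the singularity (τ-s)^{-1/2}; the return to L^p is left to Bernstein's
inequality, at the price 2^{J/2}. Here 38880 = 3240 · 12. -/
theorem TypeIBound.eLpNorm_heatFlow_sub_sub_le (hA : TypeIBound χ c₁ u v) (hc₁ : 0 < c₁)
    (hu : IsMildSolution u u₀) (hv : IsMildSolution v v₀) (hp : 3 < p) {t₀ τ : ℝ} (ht₀ : 0 < t₀)
    (hτ : 0 < τ) {L : ℝ≥0∞} (hL : ∀ s ∈ Ioo 0 (t₀ + τ),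
      eLpNorm (u s - v s) p volume ≤ L * ENNReal.ofReal (s ^ (-critExp p))) :
    eLpNorm (heatFlow τ (u t₀ - v t₀) - (u (t₀ + τ) - v (t₀ + τ))) (prodExp p 6) volume ≤
      ENNReal.ofReal (38880 * c₁ * (t₀ + τ) ^ (1 / 4 - critExp p)) * L := by
  have h6 : (3 : ℝ≥0∞) < 6 := by norm_num
  have ha := critExp_pos hp
  have ha' := critExp_le_half p
  have hψ : Measurable fun s : ℝ =>
      L * ENNReal.ofReal (c₁ * (t₀ + s) ^ (-(critExp p + 1 / 4))) := by fun_prop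
  have key := hu.eLpNorm_heatFlow_sub_sub_le hv ht₀ hτ (one_le_prodExp hp h6) le_rfl hψ
    (fun s hs => by
      have hs0 : 0 < t₀ + s := by linarith [hs.1]
      refine (eLpNorm_enorm_mul_add_le (hu.measurable_sub_apply hv _) (hu.measurable_apply _)
        (hv.measurable_apply _) (one_le_of_three_lt h6)).trans ?_
      refine (mul_le_mul' (hL _ ⟨hs0, by linarith [hs.2]⟩) (hA.eLpNorm_add_le h6 hs0)).trans ?_
      rw [mul_assoc, ← ENNReal.ofReal_mul (by positivity), critExp_six, mul_left_comm,
        ← Real.rpow_add hs0]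
      apply le_of_eq
      congr 4
      ring)
  refine key.trans ?_
  have e : ∀ s ∈ Ioo 0 τ, ENNReal.ofReal (3240 * (τ - s) ^ (-(1 / 2) - 3 / 2 *
      ((prodExp p 6)⁻¹.toReal - (prodExp p 6)⁻¹.toReal))) *
        (L * ENNReal.ofReal (c₁ * (t₀ + s) ^ (-(critExp p + 1 / 4)))) =
      ENNReal.ofReal (3240 * c₁) * L *
        ENNReal.ofReal ((τ - s) ^ (-(1 / 2) : ℝ) * (t₀ + s) ^ (-(critExp p + 1 / 4))) := by
    intro s hs
    have h0 : 0 < τ - s := sub_pos.2 hs.2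
    rw [sub_self, mul_zero, sub_zero, mul_left_comm, ← ENNReal.ofReal_mul (by positivity),
      mul_comm _ L, mul_assoc L, ← ENNReal.ofReal_mul (by positivity)]
    congr 2
    ring
  rw [setLIntegral_congr_fun measurableSet_Ioo e, lintegral_const_mul _ (by fun_prop)]
  refine (mul_le_mul' le_rfl (lintegral_sub_rpow_mul_rpow_le (by linarith) (by linarith) ht₀
    hτ)).trans (le_of_eq ?_)
  rw [mul_right_comm, ← ENNReal.ofReal_mul (by positivity)]
  congr 2
  rw [show 1 / 2 - (critExp p + 1 / 4) = 1 / 4 - critExp p by ring]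
  ring

/-- The low frequencies of the error are controlled by the nonlinear term alone, since the error
vanishes at the initial time. -/
theorem IsLPCutoff.exists_eLpNorm_lowFreq_le (hχ : IsLPCutoff χ) (hp : 3 < p) :
    ∃ N : ℝ, 1 ≤ N ∧ ∀ (c₁ : ℝ), 0 < c₁ → ∀ (u v : ℝ → E3 → E3)
      (u₀ : 𝓓'((⊤ : TopologicalSpace.Opens E3), E3)), IsMildSolution u u₀ → IsMildSolution v u₀ →
      TypeIBound χ c₁ u v → ∀ (J : ℤ) (t : ℝ), 0 < t → ∀ L : ℝ≥0∞, (∀ s ∈ Ioo 0 t,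
        eLpNorm (u s - v s) p volume ≤ L * ENNReal.ofReal (s ^ (-critExp p))) →
      eLpNorm (lowFreq χ J (u t - v t)) p volume ≤
        ENNReal.ofReal (N * ((2 : ℝ) ^ J) ^ (1 / 2 : ℝ) *
          (38880 * c₁ * t ^ (1 / 4 - critExp p))) * L := by
  obtain ⟨N, hN1, hN⟩ := hχ.exists_bernstein
  obtain ⟨N', hN'1, hN'⟩ := hχ.exists_kernelBound
  refine ⟨N, hN1, fun c₁ hc₁ u v u₀ hu hv hA J t ht L hL => ?_⟩
  have h6 : (3 : ℝ≥0∞) < 6 := by norm_num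
  have hp1 := one_le_of_three_lt hp
  have hm1 := one_le_prodExp hp h6
  have hwm := hu.measurable_sub_apply hv
  have hk := (hN' J).1
  have hwp : ∀ s : ℝ, 0 < s → eLpNorm (u s - v s) p volume ≠ ∞ := fun s hs =>
    ne_top_of_le_ne_top ENNReal.ofReal_ne_top
      (hA.eLpNorm_sub_le hp hs (hu.measurable_apply s) (hv.measurable_apply s))
  have hlm : ∀ s, Measurable (lowFreq χ J (u s - v s)) := fun s =>
    measurable_conv hk.measurable (hwm s)
  obtain ⟨C, hC, hCs⟩ := hχ.exists_enorm_lowFreq_le J hc₁ hu hv hA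
  -- Starting times tending to 0; n + 2 rather than n + 1 keeps them strictly below both t and 1.
  set t₀ : ℕ → ℝ := fun n => min 1 t / (n + 2) with ht₀_def
  have hmin : 0 < min 1 t := lt_min one_pos ht
  have ht₀ : ∀ n, 0 < t₀ n := fun n => by positivity
  have hlt : ∀ n, t₀ n < min 1 t := fun n => by
    refine div_lt_self hmin ?_
    have : (0 : ℝ) ≤ n := Nat.cast_nonneg n
    linarith
  have ht₀1 : ∀ n, t₀ n ≤ 1 := fun n => (hlt n).le.trans (min_le_left _ _)
  have ht₀t : ∀ n, 0 < t - t₀ n := fun n => sub_pos.2 ((hlt n).trans_le (min_le_right _ _))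
  set F : ℕ → E3 → E3 := fun n => lowFreq χ J (u t - v t) -
    heatFlow (t - t₀ n) (lowFreq χ J (u (t₀ n) - v (t₀ n))) with hF
  have hheat : ∀ n f, Measurable f → Measurable (heatFlow (t - t₀ n) f) := fun n f hf =>
    measurable_conv (kernelBound_heatKernel (ht₀t n)).measurable hf
  -- Fatou: F n is minus the projected Duhamel term started at t₀ n and obeys a bound uniform in n,
  -- while its heat flow part tends to 0 pointwise because the low frequencies vanish at the initial
  -- time.
  refine Lp.eLpNorm_le_of_ae_tendsto (u := atTop) (f := F) (Eventually.of_forall fun n => ?_)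
    (fun n => ((hlm t).sub (hheat n _ (hlm _))).aestronglyMeasurable) (ae_of_all _ fun x => ?_)
  · have hR := hA.eLpNorm_heatFlow_sub_sub_le hc₁ hu hv hp (ht₀ n) (ht₀t n) (L := L)
      (by rwa [add_sub_cancel])
    rw [add_sub_cancel] at hR
    set R := heatFlow (t - t₀ n) (u (t₀ n) - v (t₀ n)) - (u t - v t) with hRdef
    have hgm := hheat n _ (hwm (t₀ n))
    have hgp : eLpNorm (heatFlow (t - t₀ n) (u (t₀ n) - v (t₀ n))) p volume ≠ ∞ :=
      ne_top_of_le_ne_top (ENNReal.mul_ne_top ENNReal.one_ne_top (hwp _ (ht₀ n)))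
        ((kernelBound_heatKernel (ht₀t n)).eLpNorm_conv_le_self (hwm _) hp1)
    have eF : F n = -lowFreq χ J R := by
      have e1 : lowFreq χ J R = lowFreq χ J (heatFlow (t - t₀ n) (u (t₀ n) - v (t₀ n))) -
          lowFreq χ J (u t - v t) :=
        hk.conv_sub ENNReal.ofReal_ne_top ENNReal.ofReal_ne_top hgm (hwm t) hp1 hgp hp1 (hwp t ht)
      have e2 : lowFreq χ J (heatFlow (t - t₀ n) (u (t₀ n) - v (t₀ n))) =
          heatFlow (t - t₀ n) (lowFreq χ J (u (t₀ n) - v (t₀ n))) :=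
        hk.conv_comm ENNReal.ofReal_ne_top (kernelBound_heatKernel (ht₀t n)) ENNReal.one_ne_top
          ENNReal.ofReal_ne_top (hwm _) hp1 (hwp _ (ht₀ n))
      rw [e1, e2, neg_sub]
    rw [eF, eLpNorm_neg]
    refine (hN J _ p hm1 (prodExp_le_left p 6) R (hgm.sub (hwm t))).trans ?_
    have e3 : 3 * ((prodExp p 6)⁻¹.toReal - p⁻¹.toReal) = 1 / 2 := by
      rw [inv_prodExp_toReal hp h6, ENNReal.toReal_inv 6]
      norm_num
    rw [e3]
    refine (mul_le_mul' le_rfl hR).trans (le_of_eq ?_)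
    rw [← mul_assoc, ← ENNReal.ofReal_mul (by positivity)]
  · have h0 : Tendsto (fun n => heatFlow (t - t₀ n) (lowFreq χ J (u (t₀ n) - v (t₀ n))) x)
        atTop (𝓝 0) := by
      rw [tendsto_zero_iff_enorm_tendsto_zero]
      have hb : ∀ n, ‖heatFlow (t - t₀ n) (lowFreq χ J (u (t₀ n) - v (t₀ n))) x‖ₑ ≤
          C * ENNReal.ofReal (t₀ n ^ (1 / 4 : ℝ)) := by
        intro n
        have h1 := (kernelBound_heatKernel (ht₀t n)).enorm_conv_le (hlm (t₀ n)) le_top x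
        refine h1.trans ?_
        simp only [ENNReal.one_rpow, ENNReal.inv_top, ENNReal.toReal_zero, ENNReal.rpow_zero,
          one_mul]
        rw [eLpNorm_exponent_top]
        exact eLpNormEssSup_le_of_ae_enorm_bound
          (ae_of_all _ fun y => hCs _ (ht₀ n) (ht₀1 n) y)
      refine tendsto_of_tendsto_of_tendsto_of_le_of_le tendsto_const_nhds ?_ (fun n => bot_le) hb
      have ht0 : Tendsto t₀ atTop (𝓝 0) :=
        Tendsto.div_atTop tendsto_const_nhds
          (tendsto_atTop_add_const_right _ _ tendsto_natCast_atTop_atTop)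
      have h2 : Tendsto (fun n => t₀ n ^ (1 / 4 : ℝ)) atTop (𝓝 0) := by
        have := ht0.rpow_const (p := (1 / 4 : ℝ)) (Or.inr (by norm_num))
        rwa [Real.zero_rpow (by norm_num)] at this
      have h3 := ENNReal.Tendsto.const_mul (a := C) (ENNReal.tendsto_ofReal h2) (Or.inr hC)
      simpa using h3
    have := tendsto_const_nhds (x := lowFreq χ J (u t - v t) x).sub h0
    rw [sub_zero] at this
    exact this

end

/-! ### Uniqueness -/

/-- Closes the contraction arguments; finiteness is essential, since ∞ satisfies the inequality. -/
theorem eq_zero_of_le_half_mul {a : ℝ≥0∞} (ha : a ≠ ∞) (h : a ≤ ENNReal.ofReal (1 / 2) * a) :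
    a = 0 := by
  lift a to ℝ≥0 using ha
  rw [← ENNReal.ofReal_coe_nnreal, ← ENNReal.ofReal_mul (by norm_num),
    ENNReal.ofReal_le_ofReal_iff (by positivity)] at h
  have : (a : ℝ) = 0 := le_antisymm (by linarith) a.2
  exact_mod_cast this

theorem exists_pos_mul_rpow_le {a C : ℝ} (ha : 0 < a) (hC : 0 ≤ C) :
    ∃ h : ℝ, 0 < h ∧ ∀ s : ℝ, 0 ≤ s → s ≤ h → C * s ^ a ≤ 1 / 2 := by
  refine ⟨(1 / (2 * (C + 1))) ^ a⁻¹, by positivity, fun s hs hsh => ?_⟩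
  have h1 : s ^ a ≤ 1 / (2 * (C + 1)) := by
    calc s ^ a ≤ ((1 / (2 * (C + 1))) ^ a⁻¹) ^ a := by gcongr
      _ = _ := Real.rpow_inv_rpow (by positivity) ha.ne'
  calc C * s ^ a ≤ (C + 1) * (1 / (2 * (C + 1))) := by gcongr; linarith
    _ = 1 / 2 := by field_simp

/-! ### Forward uniqueness from positive times. -/

section

variable {u v : ℝ → E3 → E3} {u₀ v₀ : 𝓓'((⊤ : TopologicalSpace.Opens E3), E3)} {p : ℝ≥0∞}

namespace IsMildSolution

/-- Two mild solutions which agree at time `t` agree for a short time after `t`. -/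
theorem eLpNorm_sub_eq_zero_of_short_time (hu : IsMildSolution u u₀) (hv : IsMildSolution v v₀)
    (hp : 3 < p) {t τ B : ℝ} (ht : 0 < t) (hB : 0 ≤ B)
    (hB1 : ∀ s ∈ Icc 0 τ, eLpNorm (u (t + s)) p volume ≤ ENNReal.ofReal B)
    (hB2 : ∀ s ∈ Icc 0 τ, eLpNorm (v (t + s)) p volume ≤ ENNReal.ofReal B)
    (hτ : ∀ s : ℝ, 0 ≤ s → s ≤ τ → bilinConst p * (2 * B) * s ^ critExp p ≤ 1 / 2)
    (h0 : eLpNorm (u t - v t) p volume = 0) {s : ℝ} (hs : s ∈ Icc 0 τ) :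
    eLpNorm (u (t + s) - v (t + s)) p volume = 0 := by
  have hp1 := one_le_of_three_lt hp
  have hwm := hu.measurable_sub_apply hv
  set W := ⨆ r ∈ Icc 0 τ, eLpNorm (u (t + r) - v (t + r)) p volume with hW
  have hle : ∀ r ∈ Icc 0 τ, eLpNorm (u (t + r) - v (t + r)) p volume ≤ W := fun r hr =>
    le_iSup₂ (f := fun r (_ : r ∈ Icc 0 τ) => eLpNorm (u (t + r) - v (t + r)) p volume) r hr
  have hWt : W ≠ ∞ := by
    refine ne_top_of_le_ne_top (ENNReal.add_ne_top.2 ⟨ENNReal.ofReal_ne_top (r := B),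
      ENNReal.ofReal_ne_top (r := B)⟩) (iSup₂_le fun r hr => ?_)
    exact (eLpNorm_sub_le (hu.measurable_apply _).aestronglyMeasurable
      (hv.measurable_apply _).aestronglyMeasurable hp1).trans (add_le_add (hB1 r hr) (hB2 r hr))
  -- The heat flow of the initial error is zero, so the error is its own Duhamel term, which over a
  -- short time halves the supremum.
  have hhalf : W ≤ ENNReal.ofReal (1 / 2) * W := by
    refine iSup₂_le fun r hr => ?_
    rcases hr.1.eq_or_lt with rfl | hr0
    · rw [add_zero, h0]
      exact bot_le
    have hsub : ∀ s ∈ Ioo 0 r, s ∈ Icc 0 τ := fun s hs => ⟨hs.1.le, hs.2.le.trans hr.2⟩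
    have key := hu.eLpNorm_heatFlow_sub_sub_le_of_bounds hv hp ht hr0 (W := W) hB
      (fun s hs => hle s (hsub s hs)) (fun s hs => hB1 s (hsub s hs)) (fun s hs => hB2 s (hsub s hs))
    have hG := kernelBound_heatKernel hr0
    have hg : eLpNorm (heatFlow r (u t - v t)) p volume = 0 := by
      have := hG.eLpNorm_conv_le_self (hwm t) hp1
      rw [h0, mul_zero] at this
      exact le_antisymm this bot_le
    have hgm : Measurable (heatFlow r (u t - v t)) := measurable_conv hG.measurable (hwm t)
    have e : u (t + r) - v (t + r) =
        heatFlow r (u t - v t) - (heatFlow r (u t - v t) - (u (t + r) - v (t + r))) := by abel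
    rw [e]
    refine (eLpNorm_sub_le hgm.aestronglyMeasurable
      (hgm.sub (hwm _)).aestronglyMeasurable hp1).trans ?_
    rw [hg, zero_add]
    refine key.trans (mul_le_mul' (ENNReal.ofReal_le_ofReal ?_) le_rfl)
    have := hτ r hr.1 hr.2
    rwa [mul_right_comm] at this
  have hW0 := eq_zero_of_le_half_mul hWt hhalf
  exact le_antisymm ((hle s hs).trans hW0.le) bot_le

/-- Forward uniqueness of mild solutions which are locally bounded in time with values in `L^p`. -/
theorem eLpNorm_sub_eq_zero_of_le (hu : IsMildSolution u u₀) (hv : IsMildSolution v v₀)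
    (hp : 3 < p) (hbu : LocBddLp p u) (hbv : LocBddLp p v) {t₁ t : ℝ} (ht₁ : 0 < t₁) (ht : t₁ ≤ t)
    (h0 : eLpNorm (u t₁ - v t₁) p volume = 0) : eLpNorm (u t - v t) p volume = 0 := by
  obtain ⟨M, hM⟩ := hbu t₁ t ht₁ ht
  obtain ⟨M', hM'⟩ := hbv t₁ t ht₁ ht
  set B : ℝ := max (M : ℝ) M' with hB
  have hB0 : 0 ≤ B := le_max_of_le_left M.2
  have hB1 : ∀ s ∈ Icc t₁ t, eLpNorm (u s) p volume ≤ ENNReal.ofReal B := fun s hs =>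
    (hM s hs).trans (by rw [← ENNReal.ofReal_coe_nnreal]; exact ENNReal.ofReal_le_ofReal (le_max_left _ _))
  have hB2 : ∀ s ∈ Icc t₁ t, eLpNorm (v s) p volume ≤ ENNReal.ofReal B := fun s hs =>
    (hM' s hs).trans (by rw [← ENNReal.ofReal_coe_nnreal]; exact ENNReal.ofReal_le_ofReal (le_max_right _ _))
  have hC := bilinConst_pos hp
  obtain ⟨h, hh, hsmall⟩ := exists_pos_mul_rpow_le (critExp_pos hp)
    (show 0 ≤ bilinConst p * (2 * B) by positivity)
  have step : ∀ n : ℕ, ∀ s ∈ Icc t₁ t, s ≤ t₁ + n * h → eLpNorm (u s - v s) p volume = 0 := by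
    intro n
    induction n with
    | zero =>
      intro s hs hsn
      have : s = t₁ := le_antisymm (by simpa using hsn) hs.1
      rw [this, h0]
    | succ n ih =>
      intro s hs hsn
      -- The restart time is at most one step before s and never before t₁.
      set r := max t₁ (s - h) with hr
      have hrs : r ≤ s := max_le hs.1 (by linarith)
      have hr1 : t₁ ≤ r := le_max_left _ _
      have hr2 : s - h ≤ r := le_max_right _ _
      have hr0 := ih r ⟨hr1, hrs.trans hs.2⟩ (max_le (le_add_of_nonneg_right (by positivity)) (by
        push_cast at hsn
        linarith))
      have hmem : ∀ y ∈ Icc 0 (s - r), r + y ∈ Icc t₁ t := fun y hy =>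
        ⟨by linarith [hy.1], by linarith [hy.2, hs.2]⟩
      have := hu.eLpNorm_sub_eq_zero_of_short_time hv hp (t := r) (τ := s - r) (ht₁.trans_le hr1) hB0
        (fun y hy => hB1 _ (hmem y hy)) (fun y hy => hB2 _ (hmem y hy))
        (fun y hy hys => hsmall y hy (by linarith)) hr0 (s := s - r) ⟨by linarith, le_rfl⟩
      rwa [add_sub_cancel] at this
  obtain ⟨n, hn⟩ := exists_nat_ge ((t - t₁) / h)
  rw [div_le_iff₀ hh] at hn
  exact step n t ⟨ht, le_rfl⟩ (by linarith)

end IsMildSolution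

end

/-- If the high frequencies of the difference of two mild solutions with the same initial data are
dominated by the low frequencies near the initial time, then the solutions agree. -/
theorem IsLPCutoff.uniqueness_of_highFreq_le {χ : E3 → ℝ} (hχ : IsLPCutoff χ) {p : ℝ≥0∞}
    (hp : 3 < p) {c₁ : ℝ} (hc₁ : 0 < c₁) :
    ∃ ε₂ : ℝ, 0 < ε₂ ∧ ∃ J₁ : ℝ → ℤ,
      (∃ K : ℝ, 1 ≤ K ∧ ∀ t : ℝ, 0 < t → Comparable K ((2 : ℝ) ^ J₁ t) (t ^ (-(1 / 2) : ℝ))) ∧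
      ∀ (u v : ℝ → E3 → E3) (u₀ : 𝓓'((⊤ : TopologicalSpace.Opens E3), E3)),
        IsMildSolution u u₀ → IsMildSolution v u₀ → TypeIBound χ c₁ u v →
        (∃ T : ℝ, 0 < T ∧ ∀ t ∈ Ioo 0 T,
          eLpNorm (highFreq χ (J₁ t) (u t - v t)) p volume ≤
            ENNReal.ofReal ε₂ * eLpNorm (lowFreq χ (J₁ t) (u t - v t)) p volume) →
        ∀ t : ℝ, 0 < t → u t =ᵐ[volume] v t := by
  have hp1 := one_le_of_three_lt hp
  have ha := critExp_pos hp
  obtain ⟨N, hN1, hN⟩ := hχ.exists_eLpNorm_lowFreq_le hp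
  obtain ⟨N', hN'1, hN'⟩ := hχ.exists_kernelBound
  -- At 2^J ≤ δs^{-1/2} the low frequency bound carries the factor δ^{1/2}. The leading 2
  -- anticipates that the whole error is at most twice its low part.
  obtain ⟨δ, hδ, hδs⟩ := exists_pos_mul_rpow_le (a := 1 / 2) (by norm_num)
    (show 0 ≤ 2 * (N * (38880 * c₁)) by positivity)
  choose Z hZ using exists_zpow_between
  have hJ : ∀ t : ℝ, 0 < t → δ / 2 * t ^ (-(1 / 2) : ℝ) ≤ (2 : ℝ) ^ Z (δ / 2 * t ^ (-(1 / 2) : ℝ)) ∧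
      (2 : ℝ) ^ Z (δ / 2 * t ^ (-(1 / 2) : ℝ)) ≤ δ * t ^ (-(1 / 2) : ℝ) := fun t ht => by
    have := hZ (δ / 2 * t ^ (-(1 / 2) : ℝ)) (by positivity)
    exact ⟨this.1, this.2.trans (by linarith)⟩
  -- The threshold 1 suffices, because the smallness is carried by δ, hence by J₁.
  refine ⟨1, one_pos, fun t => Z (δ / 2 * t ^ (-(1 / 2) : ℝ)), ⟨1 + (δ / 2)⁻¹ + δ, ?_, ?_⟩, ?_⟩
  · have := inv_pos.2 (half_pos hδ)
    linarith
  · intro t ht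
    have := inv_pos.2 (half_pos hδ)
    exact Comparable.of_bounds (half_pos hδ) (by positivity) (hJ t ht).1 (hJ t ht).2
      (by linarith) (by linarith)
  rintro u v u₀ hu hv hA ⟨T, hT, hlow⟩ t ht
  have hwm := hu.measurable_sub_apply hv
  have hwb : ∀ s : ℝ, 0 < s →
      eLpNorm (u s - v s) p volume ≤ ENNReal.ofReal (c₁ * s ^ (-critExp p)) := fun s hs =>
    hA.eLpNorm_sub_le hp hs (hu.measurable_apply s) (hv.measurable_apply s)
  set L := ⨆ s ∈ Ioo 0 T, ENNReal.ofReal (s ^ critExp p) * eLpNorm (u s - v s) p volume with hL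
  have hinv : ∀ s : ℝ, 0 < s → s ^ critExp p * s ^ (-critExp p) = 1 := fun s hs => by
    rw [← Real.rpow_add hs, add_neg_cancel, Real.rpow_zero]
  have hLt : L ≠ ∞ := by
    refine ne_top_of_le_ne_top (ENNReal.ofReal_ne_top (r := c₁)) (iSup₂_le fun s hs => ?_)
    have hs0 : 0 < s := hs.1
    refine (mul_le_mul' le_rfl (hwb s hs0)).trans (le_of_eq ?_)
    rw [← ENNReal.ofReal_mul (by positivity), mul_left_comm, hinv s hs0, mul_one]
  have hLs : ∀ s ∈ Ioo 0 T,
      eLpNorm (u s - v s) p volume ≤ L * ENNReal.ofReal (s ^ (-critExp p)) := by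
    intro s hs
    have hs0 : 0 < s := hs.1
    have h1 : ENNReal.ofReal (s ^ critExp p) * eLpNorm (u s - v s) p volume ≤ L :=
      le_iSup₂ (f := fun s (_ : s ∈ Ioo 0 T) =>
        ENNReal.ofReal (s ^ critExp p) * eLpNorm (u s - v s) p volume) s hs
    calc _ = ENNReal.ofReal (s ^ critExp p) * eLpNorm (u s - v s) p volume *
          ENNReal.ofReal (s ^ (-critExp p)) := by
          rw [mul_right_comm, ← ENNReal.ofReal_mul (by positivity), hinv s hs0,
            ENNReal.ofReal_one, one_mul]
      _ ≤ _ := by gcongr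
  have hhalf : L ≤ ENNReal.ofReal (1 / 2) * L := by
    refine iSup₂_le fun s hs => ?_
    have hs0 : 0 < s := hs.1
    set J := Z (δ / 2 * s ^ (-(1 / 2) : ℝ)) with hJdef
    have hl := hN c₁ hc₁ u v u₀ hu hv hA J s hs0 L fun r hr => hLs r ⟨hr.1, hr.2.trans hs.2⟩
    have hwJ : eLpNorm (u s - v s) p volume ≤ 2 * eLpNorm (lowFreq χ J (u s - v s)) p volume := by
      have hlm : Measurable (lowFreq χ J (u s - v s)) :=
        measurable_conv (hN' J).1.measurable (hwm s)
      have e : u s - v s = highFreq χ J (u s - v s) + lowFreq χ J (u s - v s) := by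
        rw [highFreq, sub_add_cancel]
      have hhm : Measurable (highFreq χ J (u s - v s)) := (hwm s).sub hlm
      calc eLpNorm (u s - v s) p volume
          = eLpNorm (highFreq χ J (u s - v s) + lowFreq χ J (u s - v s)) p volume := by rw [← e]
        _ ≤ _ := eLpNorm_add_le hhm.aestronglyMeasurable hlm.aestronglyMeasurable hp1
        _ ≤ 1 * eLpNorm (lowFreq χ J (u s - v s)) p volume +
            eLpNorm (lowFreq χ J (u s - v s)) p volume := by
          gcongr
          have := hlow s hs
          rwa [ENNReal.ofReal_one] at this
        _ = _ := by ring
    refine (mul_le_mul' le_rfl (hwJ.trans (mul_le_mul' le_rfl hl))).trans ?_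
    rw [← ENNReal.ofReal_ofNat 2, ← mul_assoc, ← mul_assoc, ← ENNReal.ofReal_mul (by positivity),
      ← ENNReal.ofReal_mul (by positivity)]
    refine mul_le_mul' (ENNReal.ofReal_le_ofReal ?_) le_rfl
    have h2 : ((2 : ℝ) ^ J) ^ (1 / 2 : ℝ) ≤ δ ^ (1 / 2 : ℝ) * s ^ (-(1 / 4) : ℝ) := by
      calc ((2 : ℝ) ^ J) ^ (1 / 2 : ℝ) ≤ (δ * s ^ (-(1 / 2) : ℝ)) ^ (1 / 2 : ℝ) := by
            have := (hJ s hs0).2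
            gcongr
        _ = _ := by
          rw [Real.mul_rpow hδ.le (by positivity), ← Real.rpow_mul hs0.le]
          norm_num
    calc s ^ critExp p * 2 * (N * ((2 : ℝ) ^ J) ^ (1 / 2 : ℝ) *
          (38880 * c₁ * s ^ (1 / 4 - critExp p)))
        ≤ s ^ critExp p * 2 * (N * (δ ^ (1 / 2 : ℝ) * s ^ (-(1 / 4) : ℝ)) *
          (38880 * c₁ * s ^ (1 / 4 - critExp p))) := by gcongr
      _ = 2 * (N * (38880 * c₁)) * δ ^ (1 / 2 : ℝ) *
          (s ^ critExp p * s ^ (-(1 / 4) : ℝ) * s ^ (1 / 4 - critExp p)) := by ring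
      -- The powers of s cancel, as scale invariance predicts, so the contraction is uniform on (0,
      -- T).
      _ = 2 * (N * (38880 * c₁)) * δ ^ (1 / 2 : ℝ) := by
        rw [← Real.rpow_add hs0, ← Real.rpow_add hs0,
          show critExp p + -(1 / 4) + (1 / 4 - critExp p) = 0 by ring, Real.rpow_zero, mul_one]
      _ ≤ 1 / 2 := hδs δ hδ.le le_rfl
  have hL0 := eq_zero_of_le_half_mul hLt hhalf
  have hsmall : ∀ s ∈ Ioo 0 T, eLpNorm (u s - v s) p volume = 0 := fun s hs => by
    have := hLs s hs
    rw [hL0, zero_mul] at this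
    exact le_antisymm this bot_le
  have hfin : eLpNorm (u t - v t) p volume = 0 := by
    rcases lt_or_ge t T with h | h
    · exact hsmall t ⟨ht, h⟩
    · exact hu.eLpNorm_sub_eq_zero_of_le hv hp (hA.locBddLp_left hc₁ hp) (hA.locBddLp_right hc₁ hp)
        (half_pos hT) (by linarith) (hsmall _ ⟨half_pos hT, by linarith⟩)
  rw [eLpNorm_eq_zero_iff (hwm t).aestronglyMeasurable (by positivity)] at hfin
  filter_upwards [hfin] with x hx
  simpa [sub_eq_zero] using hx

end NSFreq

end

theorem theorem2 (χ : NSFreq.E3 → ℝ) (hχ : NSFreq.IsLPCutoff χ) :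
    -- (1) uniqueness criterion
    (∀ p : ℝ≥0∞, 3 < p → ∀ c₁ : ℝ, 0 < c₁ →
      ∃ ε₂ : ℝ, 0 < ε₂ ∧ ∃ J₁ : ℝ → ℤ,
        (∃ K : ℝ, 1 ≤ K ∧ ∀ t : ℝ, 0 < t →
          NSFreq.Comparable K ((2 : ℝ) ^ J₁ t) (t ^ (-(1 / 2) : ℝ))) ∧
        ∀ (u v : ℝ → NSFreq.E3 → NSFreq.E3)
          (u₀ : 𝓓'((⊤ : TopologicalSpace.Opens NSFreq.E3), NSFreq.E3)),
          NSFreq.IsMildSolution u u₀ → NSFreq.IsMildSolution v u₀ →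
          NSFreq.TypeIBound χ c₁ u v →
          (∃ T : ℝ, 0 < T ∧ ∀ t ∈ Ioo 0 T,
            eLpNorm (NSFreq.highFreq χ (J₁ t) (u t - v t)) p volume ≤
              ENNReal.ofReal ε₂ * eLpNorm (NSFreq.lowFreq χ (J₁ t) (u t - v t)) p volume) →
          ∀ t : ℝ, 0 < t → u t =ᵐ[volume] v t) ∧
    -- (2) and (3); `CB` and `ct` are the constants which enter the definitions of `γ` and `J₂`
    (∀ p : ℝ≥0∞, 3 < p → ∀ CB ct : ℝ, 0 < CB → 0 < ct →
      ∃ J₂ : ℝ → ℝ → ℝ → ℤ,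
        (∃ K : ℝ, 1 ≤ K ∧ ∀ c₂ M t : ℝ, 0 < c₂ → 0 < M → 0 < t →
          NSFreq.Comparable K ((2 : ℝ) ^ J₂ c₂ M t) (NSFreq.freqScale p CB ct c₂ M t)) ∧
        -- (2) low frequencies are active
        (∀ c₂ : ℝ, 0 < c₂ → ∀ (u v : ℝ → NSFreq.E3 → NSFreq.E3)
          (u₀ : 𝓓'((⊤ : TopologicalSpace.Opens NSFreq.E3), NSFreq.E3)),
          NSFreq.IsMildSolution u u₀ → NSFreq.IsMildSolution v u₀ →
          NSFreq.LocBddLp p u → NSFreq.LocBddLp p v →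
          NSFreq.ErrorLowerBound p c₂ (fun t => u t - v t) →
          ∀ t : ℝ, 0 < t →
            0 < NSFreq.M0 p u v t ∧
            0 < eLpNorm (NSFreq.lowFreq χ (J₂ c₂ (NSFreq.M0 p u v t) t) (u t - v t)) p volume ∧
            eLpNorm (NSFreq.highFreq χ (J₂ c₂ (NSFreq.M0 p u v t) t) (u t - v t)) p volume /
              eLpNorm (NSFreq.lowFreq χ (J₂ c₂ (NSFreq.M0 p u v t) t) (u t - v t)) p volume ≤
              ENNReal.ofReal (NSFreq.gammaFactor p ct c₂ (NSFreq.M0 p u v t) t)⁻¹) ∧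
        -- (3) intermediate frequencies are active
        (∀ c₁ c₂ : ℝ, 0 < c₁ → 0 < c₂ → ∃ K : ℝ, 1 ≤ K ∧
          ∀ (u v : ℝ → NSFreq.E3 → NSFreq.E3)
            (u₀ : 𝓓'((⊤ : TopologicalSpace.Opens NSFreq.E3), NSFreq.E3)),
            NSFreq.IsMildSolution u u₀ → NSFreq.IsMildSolution v u₀ →
            NSFreq.TypeIBound χ c₁ u v →
            NSFreq.ErrorLowerBound p c₂ (fun t => u t - v t) →
            ∃ J₃ : ℝ → ℤ, ∀ t : ℝ, 0 < t →
              NSFreq.Comparable K ((2 : ℝ) ^ J₂ c₂ (NSFreq.M0 p u v t) t) (t ^ (-(1 / 2) : ℝ)) ∧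
              NSFreq.Comparable K ((2 : ℝ) ^ J₃ t) (t ^ (-(1 / 2) : ℝ)) ∧
              J₃ t < J₂ c₂ (NSFreq.M0 p u v t) t ∧
              NSFreq.EComparable K
                (eLpNorm (NSFreq.bandFreq χ (J₃ t) (J₂ c₂ (NSFreq.M0 p u v t) t) (u t - v t))
                  p volume)
                (eLpNorm (u t - v t) p volume) ∧
              NSFreq.EComparable K (eLpNorm (u t - v t) p volume)
                (ENNReal.ofReal (t ^ (-NSFreq.critExp p))))) := by
  exact ⟨fun p hp c₁ hc₁ => hχ.uniqueness_of_highFreq_le hp hc₁,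
    fun p hp CB ct hCB hct => hχ.low_and_intermediate_frequencies hp hCB hct⟩
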